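/- Let $q\in\mathbb C$ with $|q|<1$, and write $(a;q)_k=\prod_{j=0}^{k-1}(1-aq^j)$, $(a;q)_\infty=\prod_{j\ge 0}(1-aq^j)$, $\binom{a}{b}_q=\frac{(q;q)_a}{(q;q)_{a-b}(q;q)_b}$. Let $\mathbf u=(u_1,u_2,\dots)$ and $\mathbf v=(v_1,v_2,\dots)$ be complex parameters with $|u_i|\le 1$, $|v_i|\le 1$ for all $i$ and $\sup_i|u_iv_i|<1$. For non-negative integers $a,b,c,d$ let $$\mathbb W_{x;(u,v)}(a,b,c,d)=\mathbf 1_{a+b=c+d}\;x^{d}\sum_{p=0}^{\min(b,c)}(ux;q)_{c-p}\,(v/x;q)_p\,(v/x)^{b-p}\binom{c+d-p}{c-p}_q\binom{b}{p}_q ,$$ a polynomial in $x$: the weight of a vertex with bottom, left, top and right labels $a,b,c,d$. For a partition $\lambda$ let $m_i(\lambda)$ be the number of parts of $\lambda$ equal to $i$, and let $\lambda'$ be the conjugate partition. For partitions $\lambda,\mu$ let $\langle\lambda'|\mathbb T(x)|\mu'\rangle$ be the partition function of one row of vertices at sites $i=1,2,\dots$ numbered from right to left, the vertex at site $i$ having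 weight $\mathbb W_{x;(u_i,v_i)}$, bottom label $m_i(\lambda')$ and top label $m_i(\mu')$; the horizontal edges far to the left are labelled $0$, and the right-most horizontal edge is free. For $\mu\subseteq\lambda$ set $$\mathfrak G^{(\mathbf u,\mathbf v)}_{\lambda/\mu}(x_1,\dots,x_n)=\langle\lambda'|\mathbb T(x_n)\cdots\mathbb T(x_1)|\mu'\rangle,\qquad c_\lambda=\prod_{i\ge 1}\frac{(u_iv_i;q)_{m_i(\lambda)}}{(q;q)_{m_i(\lambda)}} .$$ Let $n,m\ge 0$ and let $x_1,\dots,x_n,y_1,\dots,y_m\in\mathbb C$ have modulus less than $1$. Then: (1) For all partitions $\lambda,\mu$, $$\sum_{\kappa\supseteq\lambda,\mu}\frac{c_{\kappa'}}{c_{\lambda'}}\,\mathfrak G^{(\mathbf v,\mathbf u)}_{\kappa/\lambda}(x_1,\dots,x_n)\,\mathfrak G^{(\mathbf u,\mathbf v)}_{\kappa/\mu}(y_1,\dots,y_m)=\prod_{i=1}^n\prod_{j=1}^m\frac1{(x_iy_j;q)_\infty}\sum_{\kappa\subseteq\lambda,\mu}\frac{c_{\mu'}}{c_{\kappa'}}\,\mathfrak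 G^{(\mathbf v,\mathbf u)}_{\mu/\kappa}(x_1,\dots,x_n)\,\mathfrak G^{(\mathbf u,\mathbf v)}_{\lambda/\kappa}(y_1,\dots,y_m),$$ where the sum on the left, over all partitions $\kappa$ containing $\lambda$ and $\mu$, converges absolutely, and the sum on the right is over all partitions contained in both $\lambda$ and $\mu$. (2) In particular, put $\mathbb F_\kappa=\mathfrak G^{(\mathbf u,\mathbf 0)}_{\kappa/\emptyset}$ and $\mathbb G_\kappa=\mathfrak G^{(\mathbf 0,\mathbf u)}_{\kappa/\emptyset}$. The case $\lambda=\mu=\emptyset$, $\mathbf v=\mathbf 0$ of (1), in which $c_{\kappa'}=\prod_{i\ge1}1/(q;q)_{m_i(\kappa')}$, gives the duality of $\mathbb F$ and $\mathbb G$ in Cauchy form: their Cauchy sum is the reproducing kernel of the $q$-Hall inner product, $\langle p_\rho,p_\sigma\rangle_q=\delta_{\rho\sigma}\prod_{i\ge1}i^{m_i(\rho)}m_i(\rho)!\,\prod_i(1-q^{\rho_i})$ on power sums, that is, $$\sum_{\kappa}c_{\kappa'}\,\mathbb G_\kappa(x_1,\dots,x_n)\,\mathbb F_\kappa(y_1,\dots,y_m)=\prod_{i=1}^n\prod_{j=1}^m\frac1{(x_iy_j;q)_\infty}=\sum_{\rho}\frac{p_\rho(x_1,\dots,x_n)\,p_\rho(y_1,\dots,y_m)}{\langle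 p_\rho,p_\rho\rangle_q},$$ both sums being over all partitions and absolutely convergent. -/

import Mathlib

/-! Partitions are Young diagrams, ordered by containment; `κ.transpose` is the conjugate partition.
Lattice sites are numbered from the right starting at `0`, so that `u i`, `v i` are the parameters
`u_{i+1}`, `v_{i+1}` of the `(i+1)`-st column of the lattice. -/

namespace QWhittaker

noncomputable section

/-- The finite `q`-Pochhammer symbol `(a; q)_k`. -/
def qPoch (a q : ℂ) (k : ℕ) : ℂ := ∏ j ∈ Finset.range k, (1 - a * q ^ j)

/-- The infinite `q`-Pochhammer symbol `(a; q)_∞` (for `|q| < 1`). -/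
def qPochInf (a q : ℂ) : ℂ := ∏' j : ℕ, (1 - a * q ^ j)

/-- The `q`-binomial coefficient, for `b ≤ a`. -/
def qBinom (q : ℂ) (a b : ℕ) : ℂ := qPoch q q a / (qPoch q q (a - b) * qPoch q q b)

/-- The Boltzmann weight `𝕎_{x;(u,v)}(a, b, c, d)` of a vertex with bottom, left, top and right labels
`a, b, c, d`. The factor `(x / v) ^ (p - b)` is written as `(v / x) ^ (b - p)`, with `p ≤ b`, so that
it makes sense for `v = 0`. The weight is a polynomial in `x`. For `x = 0` the formula below is still
the value of this polynomial when `b = 0`, and this is all that matters there: in a row whose left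
boundary is `0`, the leftmost vertex with `d > 0` has `b = 0`, hence weight `0` at `x = 0`. -/
def vertexWeight (q x u v : ℂ) (a b c d : ℕ) : ℂ :=
  if a + b = c + d then
    x ^ d * ∑ p ∈ Finset.range (min b c + 1),
      qPoch (u * x) q (c - p) * qPoch (v / x) q p * (v / x) ^ (b - p)
        * qBinom q (c + d - p) (c - p) * qBinom q b p
  else 0

/-- Partition function of a single row made of the sites `N - 1, …, 1, 0` (from left to right), with
bottom labels `a`, top labels `c`, left boundary label `b` and free right boundary. The sum is over
the label `d` of the edge to the right of the leftmost site; conservation forces `d ≤ a + b`. -/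
def rowWeight (q x : ℂ) (u v : ℕ → ℂ) (a c : ℕ → ℕ) : ℕ → ℕ → ℂ
  | 0, _ => 1
  | N + 1, b => ∑ d ∈ Finset.range (a N + b + 1),
      vertexWeight q x (u N) (v N) (a N) b (c N) d * rowWeight q x u v a c N d

/-- `m_i(κ)`, the number of rows of size `i` in the diagram of `κ`. -/
def mult (κ : YoungDiagram) (i : ℕ) : ℕ := κ.rowLens.count i

/-- The matrix element `⟨κ'| 𝕋(x) |ν'⟩` of the transfer matrix: the row partition function with bottom
labels `m_i(κ')`, top labels `m_i(ν')` and left boundary `0`. All sites beyond the number of rows of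
`κ` and of `ν` are empty and have weight `1`, so the row is cut off there. -/
def transfer (q x : ℂ) (u v : ℕ → ℂ) (κ ν : YoungDiagram) : ℂ :=
  rowWeight q x u v (fun i => mult κ.transpose (i + 1)) (fun i => mult ν.transpose (i + 1))
    (max (κ.colLen 0) (ν.colLen 0)) 0

theorem finite_Iic (κ : YoungDiagram) : (Set.Iic κ).Finite := by
  refine Set.Finite.of_finite_image (f := YoungDiagram.cells)
    ((Finset.finite_toSet κ.cells.powerset).subset ?_) ?_
  · rintro _ ⟨ν, hν, rfl⟩
    exact Finset.mem_coe.2 (Finset.mem_powerset.2 (YoungDiagram.cells_subset_iff.2 hν))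
  · intro a _ b _ h
    exact YoungDiagram.ext h

/-- The finite set of partitions contained in `κ`. -/
def below (κ : YoungDiagram) : Finset YoungDiagram := (finite_Iic κ).toFinset

open Classical in
/-- The skew polynomial
`𝔊^{(u,v)}_{κ/μ}(x_1, …, x_n) = ⟨κ'| 𝕋(x_n) ⋯ 𝕋(x_1) |μ'⟩`.
The intermediate states are the `ν'` with `ν ⊆ κ`; the matrix elements `⟨κ'| 𝕋(x) |ν'⟩` for the other
partitions `ν` vanish by conservation. -/
def skewG (q : ℂ) (u v : ℕ → ℂ) (κ μ : YoungDiagram) : (n : ℕ) → (Fin n → ℂ) → ℂ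
  | 0, _ => if κ = μ then 1 else 0
  | n + 1, x => ∑ ν ∈ below κ,
      transfer q (x (Fin.last n)) u v κ ν * skewG q u v ν μ n (Fin.init x)

/-- `c_κ = ∏_{i ≥ 1} (u_i v_i; q)_{m_i(κ)} / (q; q)_{m_i(κ)}`; the factors with `i` larger than the
largest part of `κ` are `1`. -/
def cCoeff (q : ℂ) (u v : ℕ → ℂ) (κ : YoungDiagram) : ℂ :=
  ∏ i ∈ Finset.range (κ.rowLen 0),
    qPoch (u i * v i) q (mult κ (i + 1)) / qPoch q q (mult κ (i + 1))

/-- The inhomogeneous `q`-Whittaker polynomial `𝔽_κ`, the specialization `v = 0`, with parameters `w`. -/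
def polyF (q : ℂ) (w : ℕ → ℂ) (κ : YoungDiagram) (n : ℕ) (x : Fin n → ℂ) : ℂ :=
  skewG q w 0 κ ⊥ n x

/-- The dual inhomogeneous `q`-Whittaker polynomial `𝔾_κ`, the specialization `u = 0`, with
parameters `w`. -/
def polyG (q : ℂ) (w : ℕ → ℂ) (κ : YoungDiagram) (n : ℕ) (x : Fin n → ℂ) : ℂ :=
  skewG q 0 w κ ⊥ n x

/-- The power sum symmetric polynomial `p_ρ(x_1, …, x_n)`. -/
def powerSum (ρ : YoungDiagram) (n : ℕ) (x : Fin n → ℂ) : ℂ :=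
  (ρ.rowLens.map fun k => ∑ i, x i ^ k).prod

/-- The `q`-Hall square norm `⟨p_ρ, p_ρ⟩_q = z_ρ ∏_i (1 - q^{ρ_i})`, where
`z_ρ = ∏_{i ≥ 1} i^{m_i(ρ)} m_i(ρ)!`. The power sums are orthogonal for the `q`-Hall inner product, so
`∑_ρ p_ρ(x) p_ρ(y) / ⟨p_ρ, p_ρ⟩_q` is its reproducing kernel. -/
def qHallNorm (q : ℂ) (ρ : YoungDiagram) : ℂ :=
  (∏ i ∈ Finset.range (ρ.rowLen 0),
    ((i + 1 : ℕ) : ℂ) ^ mult ρ (i + 1) * ((mult ρ (i + 1)).factorial : ℂ))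
    * (ρ.rowLens.map fun k => 1 - q ^ k).prod

end

end QWhittaker

namespace QWhittaker

/-! ### `q`-Pochhammer symbols and `q`-binomial coefficients -/

/-! View the row partition functions as matrices indexed by partitions, lower triangular for
containment, and let `D` be the diagonal matrix with entries `c_{κ'}`. The skew Cauchy identity says
that the adjoint `D⁻¹ Aᵀ D` of `A = T^{(v,u)}(x)` commutes with `B = T^{(u,v)}(y)` up to the scalar
`1/(xy;q)_∞`; this is the predicate `IsDual`. Scalars multiply under products of matrices
(`IsDual.mul`) and the predicate is symmetric (`IsDual.symm`), so everything reduces to one row in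
`x` and one row in `y`.

The one-row relation is not obtained from an exchange matrix with infinitely many states on both
lines. Instead, an auxiliary row `L(y)` with horizontal labels in `{0, 1}` plays two roles. First,
`T(qy) = L(y) T(y)` (`mat_tWeight_mul_q`). Second, `L(y)` satisfies the duality with the dual row
`T^{(v,u)}(x)`, with scalar `1 - xy` (`zipper`, `isDual_lWeight`). Both rest on linear relations for
the vertex weight, proved by induction on its left label from the polynomial recursion `wt`.

Let `defect` be the difference of the two sides of the one-row relation, cleared of the infinite
product. The two facts give `defect_λ(qy) = ∑_{η ⊆ λ} (c_{λ'}/c_{η'}) L_{λη}(y) defect_η(y)`. By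
induction on the size of `λ` only the diagonal term survives, and `L_{λλ}(y) = P(qy)/P(y)` for an
explicit product `P` of `q`-Pochhammer symbols. Hence `defect_λ / P` is invariant under `y ↦ qy`;
letting `y` tend to `0` along `q^k y`, where `T(0)` is the identity, shows that it vanishes for
small `y` (`defect_eq_zero_of_small`). Analyticity in `y` extends this to the disc
(`defect_eq_zero`).

Convergence is controlled by weights of partitions with a factor `σ_i` for each box of row `i` and a
constant for each nonempty site. Rows map such weights to such weights with a larger constant and
the same `σ` (`sum_row_mul_seqWeight_le`). The `σ` and `τ` that dominate the two families can be
chosen with `σ_i τ_i` bounded away from `1`, because `|u_i v_i|` and the spectral parameters are.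

For the power sums, `1/(z;q)_∞` is the exponential of `∑_k z^k / (k (1 - q^k))`; expanding the
exponential of the double sum over the variables gives the sum over partitions. -/

@[simp] theorem qPoch_zero (a q : ℂ) : qPoch a q 0 = 1 := by simp [qPoch]

theorem qPoch_succ (a q : ℂ) (k : ℕ) : qPoch a q (k + 1) = qPoch a q k * (1 - a * q ^ k) := by
  simp [qPoch, Finset.prod_range_succ]

theorem qPoch_mul_shift (a q : ℂ) (k : ℕ) :
    (1 - a) * qPoch (q * a) q k = qPoch a q k * (1 - a * q ^ k) := by
  rw [← qPoch_succ, qPoch, qPoch, Finset.prod_range_succ', mul_comm]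
  simp only [pow_zero, mul_one]
  congr 1
  exact Finset.prod_congr rfl fun j _ => by ring

theorem one_sub_ne_zero_of_norm_lt {a : ℂ} (h : ‖a‖ < 1) : 1 - a ≠ 0 := by
  intro h0
  rw [sub_eq_zero] at h0
  rw [← h0] at h
  simp at h

theorem qPoch_ne_zero {a q : ℂ} (ha : ‖a‖ < 1) (hq : ‖q‖ < 1) (k : ℕ) : qPoch a q k ≠ 0 := by
  refine Finset.prod_ne_zero_iff.2 fun j _ => one_sub_ne_zero_of_norm_lt ?_
  rw [norm_mul, norm_pow]
  calc ‖a‖ * ‖q‖ ^ j ≤ ‖a‖ * 1 := by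
        gcongr
        exact pow_le_one₀ (norm_nonneg _) hq.le
    _ < 1 := by simpa using ha

theorem qBinom_add (q : ℂ) (c d : ℕ) :
    qBinom q (c + d) c = qPoch q q (c + d) / (qPoch q q d * qPoch q q c) := by
  simp [qBinom]

theorem qBinom_succ_left {q : ℂ} (hq : ‖q‖ < 1) (c d : ℕ) :
    (1 - q ^ (c + 1)) * qBinom q (c + 1 + d) (c + 1) = (1 - q ^ (c + d + 1)) * qBinom q (c + d) c := by
  have h1 := qPoch_ne_zero hq hq c
  have h2 := qPoch_ne_zero hq hq d
  have h3 : 1 - q ^ (c + 1) ≠ 0 := by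
    have := qPoch_ne_zero hq hq (c + 1)
    rw [qPoch_succ] at this
    intro h
    exact this (by rw [pow_succ'] at h; simp [h])
  rw [qBinom_add, qBinom_add, show c + 1 + d = (c + d) + 1 by ring, qPoch_succ, qPoch_succ,
    ← pow_succ', ← pow_succ']
  field_simp

theorem qBinom_succ_right {q : ℂ} (hq : ‖q‖ < 1) (c d : ℕ) :
    (1 - q ^ (d + 1)) * qBinom q (c + (d + 1)) c = (1 - q ^ (c + d + 1)) * qBinom q (c + d) c := by
  have h1 := qPoch_ne_zero hq hq c
  have h2 := qPoch_ne_zero hq hq d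
  have h3 : 1 - q ^ (d + 1) ≠ 0 := by
    have := qPoch_ne_zero hq hq (d + 1)
    rw [qPoch_succ] at this
    intro h
    exact this (by rw [pow_succ'] at h; simp [h])
  rw [qBinom_add, qBinom_add, ← add_assoc, qPoch_succ, qPoch_succ, ← pow_succ', ← pow_succ']
  field_simp

theorem one_sub_pow_succ_ne_zero {q : ℂ} (hq : ‖q‖ < 1) (k : ℕ) : 1 - q ^ (k + 1) ≠ 0 :=
  one_sub_ne_zero_of_norm_lt (by
    rw [norm_pow]; exact pow_lt_one₀ (norm_nonneg _) hq (Nat.succ_ne_zero _))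

theorem qBinom_pascal {q : ℂ} (hq : ‖q‖ < 1) (c d : ℕ) :
    qBinom q (c + 1 + (d + 1)) (c + 1)
      = qBinom q (c + (d + 1)) c + q ^ (c + 1) * qBinom q (c + 1 + d) (c + 1) := by
  have h1 := qBinom_succ_left hq c (d + 1)
  refine mul_left_cancel₀ (mul_ne_zero (one_sub_pow_succ_ne_zero hq c)
    (one_sub_pow_succ_ne_zero hq d)) ?_
  have h3 := qBinom_succ_left hq c d
  have h4 := qBinom_succ_right hq c d
  rw [show c + (d + 1) + 1 = c + d + 2 by ring] at h1
  linear_combination (1 - q ^ (d + 1)) * h1 - q ^ (c + 1) * (1 - q ^ (d + 1)) * (h3 - h4)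

theorem qBinom_zero_right {q : ℂ} (hq : ‖q‖ < 1) (n : ℕ) : qBinom q n 0 = 1 := by
  simp [qBinom, qPoch_ne_zero hq hq n]

theorem qBinom_self {q : ℂ} (hq : ‖q‖ < 1) (n : ℕ) : qBinom q n n = 1 := by
  simp [qBinom, qPoch_ne_zero hq hq n]

end QWhittaker


namespace QWhittaker

/-! ### The vertex weight as a polynomial -/

/-- The vertex weight with left, top and right labels `b, c, d`; the bottom label is `c + d - b`. -/
noncomputable def wt (q x u v : ℂ) : ℕ → ℕ → ℕ → ℂ
  | 0, c, d => x ^ d * qPoch (u * x) q c * qBinom q (c + d) c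
  | b + 1, c, d =>
    (match c with
      | 0 => 0
      | c + 1 => (1 - u * v * q ^ c) * wt q x u v b c d) +
    (match d with
      | 0 => 0
      | d + 1 => v * q ^ c * wt q x u v b c d)

/-! ### Linear relations between neighbouring vertex weights. -/

section local_relations

variable {q x u v : ℂ}

theorem wt_zero (c d : ℕ) :
    wt q x u v 0 c d = x ^ d * qPoch (u * x) q c * qBinom q (c + d) c := rfl

theorem wt_succ_zero_zero (b : ℕ) : wt q x u v (b + 1) 0 0 = 0 := by simp [wt]

theorem wt_succ_zero_succ (b d : ℕ) :
    wt q x u v (b + 1) 0 (d + 1) = v * wt q x u v b 0 d := by simp [wt]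

theorem wt_succ_succ_zero (b c : ℕ) :
    wt q x u v (b + 1) (c + 1) 0 = (1 - u * v * q ^ c) * wt q x u v b c 0 := by simp [wt]

theorem wt_succ_succ_succ (b c d : ℕ) :
    wt q x u v (b + 1) (c + 1) (d + 1) = (1 - u * v * q ^ c) * wt q x u v b c (d + 1)
      + v * q ^ (c + 1) * wt q x u v b (c + 1) d := by simp [wt]

theorem wt_zero_right (hq : ‖q‖ < 1) (k b : ℕ) : wt q x u v b 0 (k + b) = v ^ b * x ^ k := by
  induction b with
  | zero => simp [wt_zero, qBinom_zero_right hq]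
  | succ b ih => rw [← add_assoc, wt_succ_zero_succ, ih]; ring

theorem wt_zero_d_succ (hq : ‖q‖ < 1) (c d : ℕ) :
    (1 - q ^ (d + 1)) * wt q x u v 0 c (d + 1)
      = x * (1 - q ^ (c + d + 1)) * wt q x u v 0 c d := by
  rw [wt_zero, wt_zero]
  linear_combination (x ^ (d + 1) * qPoch (u * x) q c) * qBinom_succ_right hq c d

theorem wt_zero_c_succ (hq : ‖q‖ < 1) (c d : ℕ) :
    (1 - q ^ (c + 1)) * wt q x u v 0 (c + 1) d
      = (1 - u * x * q ^ c) * (1 - q ^ (c + d + 1)) * wt q x u v 0 c d := by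
  rw [wt_zero, wt_zero, qPoch_succ]
  linear_combination (x ^ d * qPoch (u * x) q c * (1 - u * x * q ^ c)) * qBinom_succ_left hq c d

theorem wt_zero_pascal (hq : ‖q‖ < 1) (c d : ℕ) :
    wt q x u v 0 (c + 1) (d + 1) = (1 - u * x * q ^ c) * wt q x u v 0 c (d + 1)
      + x * q ^ (c + 1) * wt q x u v 0 (c + 1) d := by
  rw [wt_zero, wt_zero, wt_zero, qBinom_pascal hq, qPoch_succ]
  ring

/-- In this and the next three lemmas the factor `1 - q ^ b` vanishes at `b = 0`, so that the
recursion can be applied to the left label `b - 1` with truncated subtraction and no case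
distinction. -/
theorem one_sub_mul_wt_zero_zero (b : ℕ) : (1 - q ^ b) * wt q x u v b 0 0 = 0 := by
  cases b <;> simp [wt_succ_zero_zero]

theorem one_sub_mul_wt_zero_succ (b d : ℕ) :
    (1 - q ^ b) * wt q x u v b 0 (d + 1) = v * ((1 - q ^ b) * wt q x u v (b - 1) 0 d) := by
  cases b
  · simp
  · rw [wt_succ_zero_succ, add_tsub_cancel_right]; ring

theorem one_sub_mul_wt_succ_zero (b c : ℕ) :
    (1 - q ^ b) * wt q x u v b (c + 1) 0
      = (1 - u * v * q ^ c) * ((1 - q ^ b) * wt q x u v (b - 1) c 0) := by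
  cases b
  · simp
  · rw [wt_succ_succ_zero, add_tsub_cancel_right]; ring

theorem one_sub_mul_wt_succ_succ (b c d : ℕ) :
    (1 - q ^ b) * wt q x u v b (c + 1) (d + 1)
      = (1 - u * v * q ^ c) * ((1 - q ^ b) * wt q x u v (b - 1) c (d + 1))
        + v * q ^ (c + 1) * ((1 - q ^ b) * wt q x u v (b - 1) (c + 1) d) := by
  cases b
  · simp
  · rw [wt_succ_succ_succ, add_tsub_cancel_right]; ring

/-- Relation raising the right label. -/
theorem wt_raise_right (hq : ‖q‖ < 1) (a b c d : ℕ) (h : a + b = c + d + 1) :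
    (1 - q ^ (d + 1)) * wt q x u v b c (d + 1)
      = x * (1 - q ^ a) * wt q x u v b c d
        + v * q ^ a * ((1 - q ^ b) * wt q x u v (b - 1) c d) := by
  induction b generalizing c d with
  | zero =>
    obtain rfl : a = c + d + 1 := by omega
    rw [wt_zero_d_succ hq]; ring
  | succ b ih =>
    -- Conservation in multiplicative form: it trades the `q ^ b` hidden in `1 - q ^ (b + 1)` for
    -- powers in the other labels.
    have hp : q ^ a * q ^ b = q ^ c * q ^ d := by
      rw [← pow_add, ← pow_add]; congr 1; omega
    have e := add_tsub_cancel_right b 1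
    rcases c with _ | c <;> rcases d with _ | d
    · have V := one_sub_mul_wt_zero_zero (q := q) (x := x) (u := u) (v := v) b
      rw [wt_succ_zero_succ, wt_succ_zero_zero, e]
      linear_combination -(v * (1 - q) * wt q x u v b 0 0) * hp - v * q ^ a * V
    · have V := one_sub_mul_wt_zero_succ (q := q) (x := x) (u := u) (v := v) b d
      rw [wt_succ_zero_succ, wt_succ_zero_succ, e]
      linear_combination -(v * (1 - q) * wt q x u v b 0 (d + 1)) * hp - v * q ^ a * V
        + v * ih 0 d (by omega)
    · have V := one_sub_mul_wt_succ_zero (q := q) (x := x) (u := u) (v := v) b c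
      rw [wt_succ_succ_succ, wt_succ_succ_zero, e]
      linear_combination -(v * (1 - q) * wt q x u v b (c + 1) 0) * hp - v * q ^ a * V
        + (1 - u * v * q ^ c) * ih c 0 (by omega)
    · have V := one_sub_mul_wt_succ_succ (q := q) (x := x) (u := u) (v := v) b c d
      rw [wt_succ_succ_succ, wt_succ_succ_succ, e]
      linear_combination -(v * (1 - q) * wt q x u v b (c + 1) (d + 1)) * hp - v * q ^ a * V
        + (1 - u * v * q ^ c) * ih c (d + 1) (by omega)
        + v * q ^ (c + 1) * ih (c + 1) d (by omega)

/-- Relation raising the top label, right label zero. -/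
theorem wt_raise_both_zero (hq : ‖q‖ < 1) (a b c : ℕ) (h : a + b = c) :
    (1 - u * v * q ^ c) * wt q x u v b c 0
      = (1 - u * v * q ^ a) * wt q x u v b (c + 1) 0
        + x * u * q ^ a * wt q x u v (b + 1) (c + 1) 0 := by
  induction b generalizing c with
  | zero =>
    obtain rfl : c = a := by omega
    have h0 := qBinom_self hq c
    have h1 := qBinom_self hq (c + 1)
    rw [wt_succ_succ_zero, wt_zero, wt_zero, qPoch_succ, add_zero, add_zero, h0, h1]; ring
  | succ b ih =>
    obtain ⟨c, rfl⟩ : ∃ c', c = c' + 1 := ⟨c - 1, by omega⟩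
    have := ih c (by omega)
    rw [wt_succ_succ_zero] at this
    rw [wt_succ_succ_zero, wt_succ_succ_zero, wt_succ_succ_zero, wt_succ_succ_zero] 
    linear_combination (1 - u * v * q ^ (c + 1)) * this

/-- Relation raising the top label. -/
theorem wt_raise_top (hq : ‖q‖ < 1) (a b c d : ℕ) (h : a + b = c + d + 1) :
    (1 - u * v * q ^ c) * q ^ (d + 1) * wt q x u v b c (d + 1) + x * wt q x u v b (c + 1) d
      = (1 - u * v * q ^ a) * wt q x u v b (c + 1) (d + 1)
        + x * u * q ^ a * wt q x u v (b + 1) (c + 1) (d + 1) := by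
  induction b generalizing c d with
  | zero =>
    obtain rfl : a = c + d + 1 := by omega
    have h0 := wt_zero_pascal (x := x) (u := u) (v := v) hq c d
    have h1 := wt_zero_c_succ (x := x) (u := u) (v := v) hq c d
    have h2 := wt_zero_d_succ (x := x) (u := u) (v := v) hq c d
    rw [wt_succ_succ_succ]
    linear_combination x * h1 - (1 - u * x * q ^ c) * h2 - (1 - u * v * q ^ (c + d + 1)) * h0
  | succ b ih =>
    rcases c with _ | c <;> rcases d with _ | d
    · obtain ⟨rfl, rfl⟩ : a = 0 ∧ b = 0 := by omega
      have h0 := wt_raise_both_zero (x := x) (u := u) (v := v) hq 0 0 0 rfl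
      have h1 : wt q x u v 0 0 0 = 1 := by simpa using wt_zero_right (x := x) (u := u) hq 0 0
      have h2 : wt q x u v 0 0 1 = x := by simpa using wt_zero_right (x := x) (u := u) hq 1 0
      simp only [wt_succ_succ_succ, wt_succ_succ_zero, wt_succ_zero_succ, zero_add, h1, h2] at h0 ⊢
      linear_combination v * q * h0
    · have h0 := ih 0 d (by omega)
      have h1 := wt_zero_right (x := x) (u := u) (v := v) hq a b
      have h2 := wt_zero_right (x := x) (u := u) (v := v) hq (a + 1) b
      rw [show a + b = d + 1 by omega] at h1
      rw [show a + 1 + b = d + 1 + 1 by omega] at h2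
      simp only [wt_succ_succ_succ, wt_succ_zero_succ, h1, h2] at h0 ⊢
      linear_combination v * q * h0
    · have h0 := wt_raise_both_zero (x := x) (u := u) (v := v) hq a b (c + 1) (by omega)
      have h1 := ih c 0 (by omega)
      simp only [wt_succ_succ_succ, wt_succ_succ_zero, zero_add] at h0 h1 ⊢
      linear_combination v * q ^ (c + 2) * h0 + (1 - u * v * q ^ (c + 1)) * h1
    · have h0 := ih (c + 1) d (by omega)
      have h1 := ih c (d + 1) (by omega)
      simp only [wt_succ_succ_succ] at h0 h1 ⊢
      linear_combination v * q ^ (c + 2) * h0 + (1 - u * v * q ^ (c + 1)) * h1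

/-- Relation raising the left label. -/
theorem wt_raise_left (hq : ‖q‖ < 1) (a b c d : ℕ) (h : a + b = c + d) :
    (q ^ (d + 1) - x * u * q ^ a) * wt q x u v (b + 1) c (d + 1)
        + (x - v * q ^ (c + d + 1)) * wt q x u v b c d
      = (1 - u * v * q ^ a) * wt q x u v b c (d + 1) := by
  rcases c with _ | c
  · have h1 := wt_zero_right (x := x) (u := u) (v := v) hq a b
    have h2 := wt_zero_right (x := x) (u := u) (v := v) hq (a + 1) b
    rw [show a + b = d by omega] at h1
    rw [show a + 1 + b = d + 1 by omega] at h2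
    rw [wt_succ_zero_succ, h1, h2]
    ring
  · have h1 := wt_raise_top (x := x) (u := u) (v := v) hq a b c d (by omega)
    rw [wt_succ_succ_succ] at h1 ⊢
    linear_combination h1

theorem wt_raise_left_zero (hq : ‖q‖ < 1) (a b c : ℕ) (h : a + (b + 1) = c) :
    (1 - x * u * q ^ a) * wt q x u v (b + 1) c 0 = (1 - u * v * q ^ a) * wt q x u v b c 0 := by
  obtain ⟨c, rfl⟩ : ∃ c', c = c' + 1 := ⟨c - 1, by omega⟩
  have h1 := wt_raise_both_zero (x := x) (u := u) (v := v) hq a b c (by omega)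
  rw [wt_succ_succ_zero] at h1 ⊢
  linear_combination h1

/-- Relation lowering the left label. -/
theorem wt_lower_left (hq : ‖q‖ < 1) (a b c d : ℕ) (h : a + b = c + d + 1) :
    (1 - q ^ (c + 1)) * wt q x u v b (c + 1) d
        + u * q ^ c * ((1 - q ^ (d + 1)) * wt q x u v b c (d + 1))
      = q ^ b * (1 - q ^ a) * wt q x u v b c d + (1 - q ^ b) * wt q x u v (b - 1) c d := by
  induction b generalizing c d with
  | zero =>
    obtain rfl : a = c + d + 1 := by omega
    have h1 := wt_zero_c_succ (x := x) (u := u) (v := v) hq c d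
    have h2 := wt_zero_d_succ (x := x) (u := u) (v := v) hq c d
    linear_combination h1 + u * q ^ c * h2
  | succ b ih =>
    rw [add_tsub_cancel_right b 1]
    rcases c with _ | c <;> rcases d with _ | d
    · have V := one_sub_mul_wt_zero_zero (q := q) (x := x) (u := u) (v := v) b
      simp only [wt_succ_succ_zero, wt_succ_zero_succ, wt_succ_zero_zero]
      linear_combination - q * V
    · have V := one_sub_mul_wt_zero_succ (q := q) (x := x) (u := u) (v := v) b d
      have h0 := ih 0 d (by omega)
      simp only [wt_succ_succ_succ, wt_succ_zero_succ]
      linear_combination q * v * h0 - q * V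
    · have V := one_sub_mul_wt_succ_zero (q := q) (x := x) (u := u) (v := v) b c
      have h1 := ih c 0 (by omega)
      simp only [wt_succ_succ_succ, wt_succ_succ_zero]
      linear_combination q * (1 - u * v * q ^ c) * h1 - q * V
    · have V := one_sub_mul_wt_succ_succ (q := q) (x := x) (u := u) (v := v) b c d
      have h0 := ih (c + 1) d (by omega)
      have h1 := ih c (d + 1) (by omega)
      simp only [wt_succ_succ_succ]
      linear_combination q * (v * q ^ (c + 1)) * h0 + q * (1 - u * v * q ^ c) * h1 - q * V

/-- Relation exchanging the parameter `x` for `q x`, left label of the auxiliary row zero. -/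
theorem wt_shift_zero (a b c : ℕ) (h : a + b = c) :
    (1 - u * x * q ^ a) * wt q x u v b c 0 = (1 - u * x) * wt q (q * x) u v b c 0 := by
  induction b generalizing c with
  | zero =>
    obtain rfl : c = a := by omega
    have h1 := qPoch_mul_shift (u * x) q c
    rw [wt_zero, wt_zero, show u * (q * x) = q * (u * x) by ring]
    linear_combination -qBinom q (c + 0) c * h1
  | succ b ih =>
    obtain ⟨c, rfl⟩ : ∃ c', c = c' + 1 := ⟨c - 1, by omega⟩
    rw [wt_succ_succ_zero, wt_succ_succ_zero]
    linear_combination (1 - u * v * q ^ c) * ih c (by omega)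

/-- The recursion in the left label keeps `a` fixed and its coefficients do not involve `x`, so a
relation whose coefficients depend on `a` and `x` only propagates from `b = 0`. There it is the
shift `(1 - ux)(qux;q)_c = (ux;q)_c (1 - ux q^c)`. -/
theorem wt_shift_succ (hq : ‖q‖ < 1) (a b c d : ℕ) (h : a + b = c + d + 1) :
    (1 - u * x * q ^ a) * wt q x u v b c (d + 1) - x * (1 - q ^ a) * wt q x u v b c d
      = (1 - u * x) * wt q (q * x) u v b c (d + 1) := by
  induction b generalizing c d with
  | zero =>
    obtain rfl : a = c + d + 1 := by omega
    have h1 := qPoch_mul_shift (u * x) q c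
    have h2 := wt_zero_d_succ (x := x) (u := u) (v := v) hq c d
    have h3 : wt q (q * x) u v 0 c (d + 1) = (q * x) ^ (d + 1) * qPoch (q * (u * x)) q c
      * qBinom q (c + (d + 1)) c := by rw [wt_zero, show u * (q * x) = q * (u * x) by ring]
    have h4 := wt_zero (q := q) (x := x) (u := u) (v := v) c (d + 1)
    rw [h3]
    linear_combination h2 - (q * x) ^ (d + 1) * qBinom q (c + (d + 1)) c * h1
      + q ^ (d + 1) * (1 - u * x * q ^ c) * h4
  | succ b ih =>
    rcases c with _ | c <;> rcases d with _ | d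
    · have h0 := wt_shift_zero (q := q) (x := x) (u := u) (v := v) a b 0 (by omega)
      simp only [wt_succ_zero_succ, wt_succ_zero_zero]
      linear_combination v * h0
    · simp only [wt_succ_zero_succ]
      linear_combination v * ih 0 d (by omega)
    · have h0 := wt_shift_zero (q := q) (x := x) (u := u) (v := v) a b (c + 1) (by omega)
      simp only [wt_succ_succ_succ, wt_succ_succ_zero]
      linear_combination v * q ^ (c + 1) * h0 + (1 - u * v * q ^ c) * ih c 0 (by omega)
    · simp only [wt_succ_succ_succ]
      linear_combination v * q ^ (c + 1) * ih (c + 1) d (by omega)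
        + (1 - u * v * q ^ c) * ih c (d + 1) (by omega)

end local_relations

end QWhittaker


namespace QWhittaker

/-! ### The auxiliary two-state row and its exchange relations with the weights `wt` -/

/-- The weight of a vertex of the auxiliary row, with bottom label `a`, left label `b` and right
label `d`, where `b, d ∈ {0, 1}`. -/
noncomputable def lw (q y u v : ℂ) (a : ℕ) : ℕ → ℕ → ℂ
  | 0, 0 => (1 - u * y * q ^ a) / (1 - u * y)
  | 0, 1 => -(y * (1 - q ^ a)) / (1 - u * y)
  | 1, 0 => (1 - u * v * q ^ a) / (1 - u * y)
  | 1, 1 => (v * q ^ a - y) / (1 - u * y)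
  | _, _ => 0

section exchange

variable {q x y u v : ℂ}

/-- Local form of `L(y) T(y) = T(qy)`: after summing over the ways to split the outgoing total `n`
between the two rows, only the total `e + b` of the incoming labels matters. This lumping lets two
rows collapse site by site into one. -/
theorem lw_mul_wt (hq : ‖q‖ < 1) (hy : 1 - u * y ≠ 0) (a b c e n : ℕ) (he : e ≤ 1)
    (h : a + e + b = c + n) :
    lw q y u v a e 0 * wt q y u v b c n
        + (if 1 ≤ n then lw q y u v a e 1 * wt q y u v b c (n - 1) else 0)
      = wt q (q * y) u v (e + b) c n := by
  have hi : (1 - u * y) * (1 - u * y)⁻¹ = 1 := mul_inv_cancel₀ hy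
  obtain rfl | rfl : e = 0 ∨ e = 1 := by omega
  · rw [zero_add]
    rcases n with _ | n
    · have := wt_shift_zero (q := q) (x := y) (u := u) (v := v) a b c (by omega)
      simp only [lw, nonpos_iff_eq_zero, one_ne_zero, if_false]
      linear_combination (1 - u * y)⁻¹ * this + wt q (q * y) u v b c 0 * hi
    · have := wt_shift_succ (x := y) (u := u) (v := v) hq a b c n (by omega)
      simp only [lw, le_add_iff_nonneg_left, zero_le, if_true, add_tsub_cancel_right]
      linear_combination (1 - u * y)⁻¹ * this + wt q (q * y) u v b c (n + 1) * hi
  · rw [add_comm 1 b]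
    rcases n with _ | n
    · have h1 := wt_shift_zero (q := q) (x := y) (u := u) (v := v) a (b + 1) c (by omega)
      have h2 := wt_raise_left_zero (x := y) (u := u) (v := v) hq a b c (by omega)
      simp only [lw, nonpos_iff_eq_zero, one_ne_zero, if_false]
      linear_combination (1 - u * y)⁻¹ * (h1 - h2) + wt q (q * y) u v (b + 1) c 0 * hi
    · have h1 := wt_shift_succ (x := y) (u := u) (v := v) hq a (b + 1) c n (by omega)
      have h2 := wt_raise_left (x := y) (u := u) (v := v) hq a b c n (by omega)
      have h3 := wt_raise_right (x := y) (u := u) (v := v) hq a (b + 1) c n (by omega)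
      have hp : q ^ a * q ^ b = q ^ c * q ^ n := by
        rw [← pow_add, ← pow_add]; congr 1; omega
      rw [add_tsub_cancel_right] at h3
      simp only [lw, le_add_iff_nonneg_left, zero_le, if_true, add_tsub_cancel_right]
      linear_combination (1 - u * y)⁻¹ * (h1 - h2 - h3 + q * v * wt q y u v b c n * hp)
        + wt q (q * y) u v (b + 1) c (n + 1) * hi

variable {g : ℕ → ℂ}

theorem ratio_up (hg0 : ∀ k, g k ≠ 0)
    (hg : ∀ k, g (k + 1) * (1 - q ^ (k + 1)) = g k * (1 - u * v * q ^ k)) (a c : ℕ) :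
    g (c + 1) * g a / g c * (1 - q ^ (c + 1)) = g a * (1 - u * v * q ^ c) := by
  rw [div_mul_eq_mul_div, div_eq_iff (hg0 c)]
  linear_combination g a * hg c

theorem ratio_down (hg0 : ∀ k, g k ≠ 0)
    (hg : ∀ k, g (k + 1) * (1 - q ^ (k + 1)) = g k * (1 - u * v * q ^ k)) (a c : ℕ) :
    g c * g a / g (c + 1) * (1 - u * v * q ^ c) = g a * (1 - q ^ (c + 1)) := by
  rw [div_mul_eq_mul_div, div_eq_iff (hg0 _)]
  linear_combination -g a * hg c

theorem lw_pred_one_zero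
    (hg : ∀ k, g (k + 1) * (1 - q ^ (k + 1)) = g k * (1 - u * v * q ^ k)) (a : ℕ) (w : ℂ) :
    (if 1 ≤ a then g (a - 1) * w * lw q y u v (a - 1) 1 0 else 0)
      = g a * (1 - q ^ a) / (1 - u * y) * w := by
  rcases a with _ | a
  · simp
  · simp only [le_add_iff_nonneg_left, zero_le, if_true, add_tsub_cancel_right, lw, hg a]
    ring

theorem lw_zero_one_mul_wt_pred (hg0 : ∀ k, g k ≠ 0)
    (hg : ∀ k, g (k + 1) * (1 - q ^ (k + 1)) = g k * (1 - u * v * q ^ k)) (a b c d : ℕ) (r : ℂ) :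
    (if 1 ≤ c then lw q y u v c 0 1 * wt q x v u b (c - 1) (d + 1)
        * (g c * g a / g (c - 1)) * r else 0)
      = -y * g a / (1 - u * y) * r
        * (wt q x v u (b + 1) c (d + 1) - u * q ^ c * wt q x v u b c d) := by
  rcases c with _ | c
  · simp [wt_succ_zero_succ]
  · simp only [le_add_iff_nonneg_left, zero_le, if_true, add_tsub_cancel_right, lw,
      wt_succ_succ_succ]
    linear_combination -(1 - u * y)⁻¹ * y * wt q x v u b c (d + 1) * r * ratio_up hg0 hg a c

/-- The exchange lemmas are the entries of a Yang–Baxter relation for a two-state line and an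
unbounded one; their names record the left and right labels of the auxiliary row. The crossing has
entries `1` and `-xy` for auxiliary label `0`, and `q ^ b - xy` and `1 - q ^ b` for auxiliary label
`1`. The pairing coefficients `g` enter only through their two-term recursion. -/
theorem exchange_zero_zero (hq : ‖q‖ < 1) (hg0 : ∀ k, g k ≠ 0)
    (hg : ∀ k, g (k + 1) * (1 - q ^ (k + 1)) = g k * (1 - u * v * q ^ k))
    (a b c d : ℕ) (h : a + b = c + d) :
    lw q y u v c 0 0 * wt q x v u b c d * g a
        + (if 1 ≤ c then lw q y u v c 0 1 * wt q x v u b (c - 1) (d + 1) * (g c * g a / g (c - 1))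
            * (1 - q ^ (d + 1)) else 0)
      = g a * wt q x v u b c d * lw q y u v a 0 0
        - x * y * (if 1 ≤ a then g (a - 1) * wt q x v u (b + 1) c d * lw q y u v (a - 1) 1 0
            else 0) := by
  have hr := wt_raise_right (x := x) (u := v) (v := u) hq a (b + 1) c d (by omega)
  have hp : q ^ a * q ^ b = q ^ c * q ^ d := by
    rw [← pow_add, ← pow_add]; congr 1
  rw [add_tsub_cancel_right] at hr
  rw [lw_pred_one_zero hg, lw_zero_one_mul_wt_pred hg0 hg]
  simp only [lw]
  linear_combination (1 - u * y)⁻¹ * y * g a * (-hr + u * wt q x v u b c d * q * hp)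

theorem exchange_zero_one (hq : ‖q‖ < 1) (hg0 : ∀ k, g k ≠ 0)
    (hg : ∀ k, g (k + 1) * (1 - q ^ (k + 1)) = g k * (1 - u * v * q ^ k))
    (a b c d : ℕ) (h : a + b = c + d) :
    lw q y u v c 0 0 * wt q x v u b c d * g a * (-(x * y))
        + (if 1 ≤ c then lw q y u v c 0 1 * wt q x v u b (c - 1) (d + 1) * (g c * g a / g (c - 1))
            * (q ^ (d + 1) - x * y) else 0)
      = g (a + 1) * wt q x v u b c (d + 1) * lw q y u v (a + 1) 0 1
        - x * y * (g a * wt q x v u (b + 1) c (d + 1) * lw q y u v a 1 1) := by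
  have hl := wt_raise_left (x := x) (u := v) (v := u) hq a b c d h
  rw [lw_zero_one_mul_wt_pred hg0 hg]
  simp only [lw]
  linear_combination (1 - u * y)⁻¹ * (y * wt q x v u b c (d + 1) * hg a - y * g a * hl)

/-- Boundary case: conservation leaves total outgoing label `1`, carried by the auxiliary row, so
the term with outgoing auxiliary label `0` is absent and the crossing contributes `q ^ 0 - xy = 1 -
xy`. -/
theorem exchange_zero_one_edge (hq : ‖q‖ < 1) (hg0 : ∀ k, g k ≠ 0)
    (hg : ∀ k, g (k + 1) * (1 - q ^ (k + 1)) = g k * (1 - u * v * q ^ k))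
    (a b c : ℕ) (h : a + b = c) :
    lw q y u v (c + 1) 0 1 * wt q x v u b c 0 * (g (c + 1) * g a / g c) * (1 - x * y)
      = g (a + 1) * wt q x v u b (c + 1) 0 * lw q y u v (a + 1) 0 1
        - x * y * (g a * wt q x v u (b + 1) (c + 1) 0 * lw q y u v a 1 1) := by
  have h1 := wt_raise_left_zero (x := x) (u := v) (v := u) hq a b (c + 1) (by omega)
  rw [wt_succ_succ_zero] at h1 ⊢
  simp only [lw]
  linear_combination (1 - u * y)⁻¹ * (y * wt q x v u b (c + 1) 0 * hg a
    - y * (1 - x * y) * wt q x v u b c 0 * ratio_up hg0 hg a c - y * g a * h1)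

theorem exchange_one_zero (hq : ‖q‖ < 1) (hg0 : ∀ k, g k ≠ 0)
    (hg : ∀ k, g (k + 1) * (1 - q ^ (k + 1)) = g k * (1 - u * v * q ^ k))
    (a b c d : ℕ) (h : a + b = c + d + 1) :
    lw q y u v c 1 0 * wt q x v u b (c + 1) d * (g c * g a / g (c + 1))
        + lw q y u v c 1 1 * wt q x v u b c (d + 1) * g a * (1 - q ^ (d + 1))
      = (q ^ b - x * y) * (if 1 ≤ a then g (a - 1) * wt q x v u b c d * lw q y u v (a - 1) 1 0
            else 0)
        + (1 - q ^ b) * (g a * wt q x v u (b - 1) c d * lw q y u v a 0 0) := by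
  have h1 := wt_raise_right (x := x) (u := v) (v := u) hq a b c d h
  have h2 := wt_lower_left (x := x) (u := v) (v := u) hq a b c d h
  rw [lw_pred_one_zero hg]
  simp only [lw]
  linear_combination (1 - u * y)⁻¹ * (wt q x v u b (c + 1) d * ratio_down hg0 hg a c
    + g a * h2 - g a * y * h1)

theorem exchange_one_one (hq : ‖q‖ < 1) (hg0 : ∀ k, g k ≠ 0)
    (hg : ∀ k, g (k + 1) * (1 - q ^ (k + 1)) = g k * (1 - u * v * q ^ k))
    (a b c d : ℕ) (h : a + b = c + d + 1) :
    lw q y u v c 1 0 * wt q x v u b (c + 1) d * (g c * g a / g (c + 1)) * (-(x * y))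
        + lw q y u v c 1 1 * wt q x v u b c (d + 1) * g a * (q ^ (d + 1) - x * y)
      = (q ^ b - x * y) * (g a * wt q x v u b c (d + 1) * lw q y u v a 1 1)
        + (1 - q ^ b) * (g (a + 1) * wt q x v u (b - 1) c (d + 1) * lw q y u v (a + 1) 0 1) := by
  have h1 := wt_raise_right (x := x) (u := v) (v := u) hq a b c d h
  have h2 := wt_lower_left (x := x) (u := v) (v := u) hq a b c d h
  have hp : q ^ a * q ^ b = q ^ c * q ^ (d + 1) := by
    rw [← pow_add, ← pow_add]; congr 1
  have h3 : (1 - q ^ b) * ((q ^ (d + 1) - x * v * q ^ a) * wt q x v u b c (d + 1)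
      + (x - u * q ^ (c + d + 1)) * wt q x v u (b - 1) c d)
      = (1 - q ^ b) * ((1 - v * u * q ^ a) * wt q x v u (b - 1) c (d + 1)) := by
    rcases b with _ | b
    · simp
    · rw [add_tsub_cancel_right, ← wt_raise_left (x := x) (u := v) (v := u) hq a b c d (by omega)]
  simp only [lw]
  linear_combination (1 - u * y)⁻¹ * (-y * x * wt q x v u b (c + 1) d * ratio_down hg0 hg a c
    + y * (1 - q ^ b) * wt q x v u (b - 1) c (d + 1) * hg a
    + y * g a * (-x * h2 + q ^ b * h1 - h3)
    + g a * (-v * wt q x v u b c (d + 1) + y * (x * v * wt q x v u b c (d + 1)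
      + u * ((1 - q ^ b) * wt q x v u (b - 1) c d))) * hp)

/-- Boundary case as above, with incoming auxiliary label `1`. -/
theorem exchange_one_one_edge (hq : ‖q‖ < 1)
    (hg : ∀ k, g (k + 1) * (1 - q ^ (k + 1)) = g k * (1 - u * v * q ^ k))
    (a b c : ℕ) (h : a + b = c) :
    lw q y u v c 1 1 * wt q x v u b c 0 * g a * (1 - x * y)
      = (q ^ b - x * y) * (g a * wt q x v u b c 0 * lw q y u v a 1 1)
        + (1 - q ^ b) * (g (a + 1) * wt q x v u (b - 1) c 0 * lw q y u v (a + 1) 0 1) := by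
  have hp : q ^ a * q ^ b = q ^ c := by
    rw [← pow_add, h]
  have h3 : (1 - q ^ b) * ((1 - x * v * q ^ a) * wt q x v u b c 0)
      = (1 - q ^ b) * ((1 - v * u * q ^ a) * wt q x v u (b - 1) c 0) := by
    rcases b with _ | b
    · simp
    · rw [add_tsub_cancel_right,
        ← wt_raise_left_zero (x := x) (u := v) (v := u) hq a b c (by omega)]
  simp only [lw]
  linear_combination (1 - u * y)⁻¹ * (y * (1 - q ^ b) * wt q x v u (b - 1) c 0 * hg a
    - y * g a * h3 + g a * wt q x v u b c 0 * (-v + y * x * v) * hp)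

end exchange

end QWhittaker


namespace QWhittaker

open Finset

/-! ### Rows -/

/-- The partition function of the row of sites `N - 1, …, 0` with site weights `w`, bottom labels
`a`, top labels `c` and left boundary label `b`; the right boundary is free. The arguments of `w`
are the site and the bottom, left, top and right labels. -/
noncomputable def row (w : ℕ → ℕ → ℕ → ℕ → ℕ → ℂ) (a c : ℕ → ℕ) : ℕ → ℕ → ℂ
  | 0, _ => 1
  | N + 1, b => if c N ≤ a N + b then
      w N (a N) b (c N) (a N + b - c N) * row w a c N (a N + b - c N) else 0

/-- Site weights of the rows of `transfer`. -/
noncomputable def tWeight (q x : ℂ) (u v : ℕ → ℂ) (i _a b c d : ℕ) : ℂ := wt q x (u i) (v i) b c d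

/-- Site weights of the auxiliary rows. -/
noncomputable def lWeight (q y : ℂ) (u v : ℕ → ℂ) (i a b _c d : ℕ) : ℂ := lw q y (u i) (v i) a b d

theorem row_congr {w : ℕ → ℕ → ℕ → ℕ → ℕ → ℂ} {a a' c c' : ℕ → ℕ} {N : ℕ}
    (ha : ∀ i < N, a i = a' i) (hc : ∀ i < N, c i = c' i) (b : ℕ) :
    row w a c N b = row w a' c' N b := by
  induction N generalizing b with
  | zero => rfl
  | succ N ih =>
    simp only [row, ha N N.lt_succ_self, hc N N.lt_succ_self,
      ih (fun i hi => ha i (hi.trans N.lt_succ_self)) (fun i hi => hc i (hi.trans N.lt_succ_self))]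

/-- Finitely supported sequences with support in `{0, …, N - 1}` and entries at most `M`. -/
noncomputable def seqs (M N : ℕ) : Finset (ℕ →₀ ℕ) := (range N).finsupp fun _ => range (M + 1)

theorem mem_seqs {M N : ℕ} {f : ℕ →₀ ℕ} :
    f ∈ seqs M N ↔ (∀ i, N ≤ i → f i = 0) ∧ ∀ i, f i ≤ M := by
  rw [seqs, mem_finsupp_iff]
  constructor
  · rintro ⟨h1, h2⟩
    have h0 : ∀ i, N ≤ i → f i = 0 := fun i hi => by
      by_contra h
      exact absurd (mem_range.1 (h1 (Finsupp.mem_support_iff.2 h))) (not_lt.2 hi)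
    refine ⟨h0, fun i => ?_⟩
    by_cases hi : i < N
    · exact Nat.lt_succ_iff.1 (mem_range.1 (h2 i (mem_range.2 hi)))
    · simp [h0 i (not_lt.1 hi)]
  · rintro ⟨h1, h2⟩
    refine ⟨fun i hi => ?_, fun i _ => mem_range.2 (Nat.lt_succ_iff.2 (h2 i))⟩
    rw [mem_range]
    by_contra h
    exact Finsupp.mem_support_iff.1 hi (h1 i (not_lt.1 h))

theorem sum_seqs_zero {A : Type*} [AddCommMonoid A] (M : ℕ) (F : (ℕ →₀ ℕ) → A) :
    ∑ f ∈ seqs M 0, F f = F 0 := by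
  have : seqs M 0 = {0} := by
    ext f
    rw [mem_seqs, mem_singleton]
    constructor
    · rintro ⟨h, -⟩
      ext i
      exact h i (Nat.zero_le i)
    · rintro rfl
      simp
  rw [this, sum_singleton]

theorem sum_seqs_succ {A : Type*} [AddCommMonoid A] (M N : ℕ) (F : (ℕ →₀ ℕ) → A) :
    ∑ f ∈ seqs M (N + 1), F f = ∑ k ∈ range (M + 1), ∑ f ∈ seqs M N, F (f.update N k) := by
  rw [← sum_product']
  symm
  refine sum_bij' (fun p _ => p.2.update N p.1) (fun f _ => (f N, f.erase N)) ?_ ?_ ?_ ?_ ?_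
  · rintro ⟨k, f⟩ h
    simp only [mem_product, mem_range, mem_seqs] at h ⊢
    refine ⟨fun i hi => ?_, fun i => ?_⟩
    · rw [Finsupp.coe_update, Function.update_of_ne (by omega), h.2.1 i (by omega)]
    · rw [Finsupp.coe_update, Function.update_apply]
      split_ifs
      · omega
      · exact h.2.2 i
  · intro f h
    simp only [mem_product, mem_range, mem_seqs] at h ⊢
    refine ⟨Nat.lt_succ_iff.2 (h.2 N), fun i hi => ?_, fun i => ?_⟩
    · rw [Finsupp.erase_apply]
      split_ifs with hi'
      · rfl
      · exact h.1 i (by omega)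
    · rw [Finsupp.erase_apply]
      split_ifs
      · exact Nat.zero_le _
      · exact h.2 i
  · rintro ⟨k, f⟩ h
    simp only [mem_product, mem_range, mem_seqs] at h
    refine Prod.ext (by simp) ?_
    ext i
    simp only [Finsupp.erase_apply, Finsupp.coe_update, Function.update_apply]
    split_ifs with hi
    · rw [hi, h.2.1 N le_rfl]
    · rfl
  · intro f _
    ext i
    simp only [Finsupp.coe_update, Function.update_apply, Finsupp.erase_apply]
    split_ifs with hi
    · rw [hi]
    · rfl
  · intros; rfl

theorem row_update_top (w : ℕ → ℕ → ℕ → ℕ → ℕ → ℂ) (a f : ℕ → ℕ) (N k b : ℕ) :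
    row w a (Function.update f N k) N b = row w a f N b :=
  row_congr (fun _ _ => rfl) (fun _ hi => Function.update_of_ne hi.ne _ _) b

theorem row_update_bottom (w : ℕ → ℕ → ℕ → ℕ → ℕ → ℂ) (c f : ℕ → ℕ) (N k b : ℕ) :
    row w (Function.update f N k) c N b = row w f c N b :=
  row_congr (fun _ hi => Function.update_of_ne hi.ne _ _) (fun _ _ => rfl) b

theorem lw_of_two_le (q y u v : ℂ) (a e d : ℕ) (hd : 2 ≤ d) : lw q y u v a e d = 0 := by
  obtain ⟨d, rfl⟩ : ∃ k, d = k + 2 := ⟨d - 2, by omega⟩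
  rcases e with _ | _ | e <;> rfl

/-- The auxiliary row below: its top label takes two values. -/
theorem sum_lw_bottom (q y u v : ℂ) (a e M : ℕ) (hM : a + e ≤ M) (Φ : ℕ → ℕ → ℂ) :
    ∑ k ∈ range (M + 1), (if k ≤ a + e then lw q y u v a e (a + e - k) * Φ k (a + e - k) else 0)
      = lw q y u v a e 0 * Φ (a + e) 0
        + if 1 ≤ a + e then lw q y u v a e 1 * Φ (a + e - 1) 1 else 0 := by
  rw [← sum_subset (range_subset_range.2 (by omega : a + e + 1 ≤ M + 1))
    (fun k _ hk => if_neg (by simpa using hk)), sum_range_succ, if_pos le_rfl, tsub_self, add_comm]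
  congr 1
  rcases h : a + e with _ | n
  · simp
  · rw [sum_range_succ, if_pos (by omega), if_pos (by omega), add_tsub_cancel_right,
      add_tsub_cancel_left, sum_eq_zero, zero_add]
    intro k hk
    rw [mem_range] at hk
    rw [if_pos (by omega), lw_of_two_le _ _ _ _ _ _ _ (by omega), zero_mul]

/-- The auxiliary row above: its bottom label takes two values. -/
theorem sum_lw_top (q y u v : ℂ) (c e M : ℕ) (he : e ≤ 1) (hM : c + 1 ≤ M) (Φ : ℕ → ℕ → ℂ) :
    ∑ k ∈ range (M + 1), (if c ≤ k + e then Φ k (k + e - c) * lw q y u v k e (k + e - c) else 0)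
      = (if e ≤ c then Φ (c - e) 0 * lw q y u v (c - e) e 0 else 0)
        + Φ (c + 1 - e) 1 * lw q y u v (c + 1 - e) e 1 := by
  have hz : ∀ k, k ≠ c + 1 - e → (k + e ≠ c) →
      (if c ≤ k + e then Φ k (k + e - c) * lw q y u v k e (k + e - c) else 0) = 0 := by
    intro k h1 h2
    split_ifs
    · rw [lw_of_two_le _ _ _ _ _ _ _ (by omega), mul_zero]
    · rfl
  by_cases hec : e ≤ c
  · rw [← sum_subset (s₁ := {c - e, c + 1 - e})]
    · rw [sum_pair (by omega), if_pos (by omega), if_pos (by omega), if_pos hec,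
        show c - e + e - c = 0 by omega, show c + 1 - e + e - c = 1 by omega]
    · intro k hk
      simp only [mem_insert, mem_singleton, mem_range] at hk ⊢
      omega
    · intro k _ hk
      simp only [mem_insert, mem_singleton, not_or] at hk
      exact hz k hk.2 (by omega)
  · rw [← sum_subset (s₁ := {c + 1 - e})]
    · rw [sum_singleton, if_pos (by omega), if_neg hec, zero_add,
        show c + 1 - e + e - c = 1 by omega]
    · intro k hk
      simp only [mem_singleton, mem_range] at hk ⊢
      omega
    · intro k _ hk
      simp only [mem_singleton] at hk
      exact hz k hk (by omega)

/-- Composing an auxiliary row with a row of parameter `y` shifts the parameter to `q y`. -/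
theorem sum_row_lWeight_mul_row {q y : ℂ} {u v : ℕ → ℂ} (hq : ‖q‖ < 1)
    (hy : ∀ i, 1 - u i * y ≠ 0) (a c : ℕ → ℕ) (M N : ℕ) (hM : ∀ i < N, a i + 1 ≤ M) (b e : ℕ)
    (he : e ≤ 1) :
    ∑ f ∈ seqs M N, row (lWeight q y u v) a f N e * row (tWeight q y u v) f c N b
      = row (tWeight q (q * y) u v) a c N (e + b) := by
  induction N generalizing b e with
  | zero => rw [sum_seqs_zero]; simp [row]
  | succ N ih =>
    have ih' := ih fun i hi => hM i (hi.trans N.lt_succ_self)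
    rw [sum_seqs_succ]
    set Φ : ℕ → ℕ → ℂ := fun k d => if c N ≤ k + b then wt q y (u N) (v N) b (c N) (k + b - c N) *
      ∑ f ∈ seqs M N, row (lWeight q y u v) a f N d * row (tWeight q y u v) f c N (k + b - c N)
      else 0 with hΦ
    have step : ∀ k ∈ range (M + 1), ∑ f ∈ seqs M N,
        row (lWeight q y u v) a (f.update N k) (N + 1) e
          * row (tWeight q y u v) (f.update N k) c (N + 1) b
        = if k ≤ a N + e then
            lw q y (u N) (v N) (a N) e (a N + e - k) * Φ k (a N + e - k) else 0 := by
      intro k _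
      simp only [hΦ, row, Finsupp.coe_update, row_update_top, row_update_bottom,
        Function.update_self, tWeight, lWeight]
      split_ifs
      · rw [mul_sum, mul_sum]
        exact sum_congr rfl fun f _ => by ring
      all_goals simp
    rw [sum_congr rfl step, sum_lw_bottom _ _ _ _ _ _ _ (by have := hM N N.lt_succ_self; omega) Φ]
    simp only [hΦ]
    simp only [row]
    by_cases hc : c N ≤ a N + (e + b)
    · obtain ⟨n, hn⟩ := Nat.exists_eq_add_of_le hc
      have key := lw_mul_wt (v := v N) hq (hy N) (a N) b (c N) e n he (by omega)
      rw [if_pos (by omega), if_pos hc, show a N + e + b - c N = n by omega,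
        show a N + (e + b) - c N = n by omega, ih' n 0 (by omega), zero_add, tWeight, ← key]
      by_cases hn1 : 1 ≤ n
      · by_cases hae : 1 ≤ a N + e
        · rw [if_pos hae, if_pos (by omega), if_pos hn1, show a N + e - 1 + b - c N = n - 1 by omega,
            ih' (n - 1) 1 le_rfl, show 1 + (n - 1) = n by omega]
          ring
        · obtain ⟨h1, h2⟩ : a N = 0 ∧ e = 0 := by omega
          rw [if_neg hae, if_pos hn1, h1, h2]
          simp only [lw, pow_zero]
          ring
      · rw [if_neg hn1, add_zero, add_eq_left.2, mul_assoc]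
        split_ifs
        · omega
        · simp
        · rfl
    · rw [if_neg hc, if_neg (by omega), mul_zero, zero_add]
      split_ifs
      · omega
      · simp
      · rfl

end QWhittaker


namespace QWhittaker

open Finset

/-! ### Moving the crossing through a pair of rows. -/

section zipper

variable (q x y : ℂ) (u v : ℕ → ℂ) (g : ℕ → ℕ → ℂ) (a c : ℕ → ℕ) (M : ℕ)

/-- Two rows on the sites `N - 1, …, 0`: the auxiliary row below the dual row. -/
noncomputable def auxBelow (N b e : ℕ) : ℂ :=
  ∑ f ∈ seqs M N, row (lWeight q y u v) a f N e * row (tWeight q x v u) c f N b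
    * ∏ i ∈ range N, g i (a i) * g i (c i) / g i (f i)

/-- Two rows on the sites `N - 1, …, 0`: the auxiliary row above the dual row. -/
noncomputable def auxAbove (N b e : ℕ) : ℂ :=
  ∑ f ∈ seqs M N, (∏ i ∈ range N, g i (f i)) * row (tWeight q x v u) f a N b
    * row (lWeight q y u v) f c N e

theorem prod_update (h : ℕ → ℕ → ℂ) (f : ℕ → ℕ) (N k : ℕ) :
    ∏ i ∈ range N, h i (Function.update f N k i) = ∏ i ∈ range N, h i (f i) :=
  prod_congr rfl fun i hi => by rw [Function.update_of_ne (mem_range.1 hi).ne]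

theorem auxBelow_succ (N b e : ℕ) (hM : a N + e ≤ M) :
    auxBelow q x y u v g a c M (N + 1) b e
      = lw q y (u N) (v N) (a N) e 0 *
          (if a N + e ≤ c N + b then wt q x (v N) (u N) b (a N + e) (c N + b - (a N + e))
            * (g N (a N) * g N (c N) / g N (a N + e))
            * auxBelow q x y u v g a c M N (c N + b - (a N + e)) 0 else 0)
        + if 1 ≤ a N + e then lw q y (u N) (v N) (a N) e 1 *
          (if a N + e - 1 ≤ c N + b then
            wt q x (v N) (u N) b (a N + e - 1) (c N + b - (a N + e - 1))
            * (g N (a N) * g N (c N) / g N (a N + e - 1))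
            * auxBelow q x y u v g a c M N (c N + b - (a N + e - 1)) 1 else 0) else 0 := by
  rw [auxBelow, sum_seqs_succ]
  set Φ : ℕ → ℕ → ℂ := fun k d => if k ≤ c N + b then wt q x (v N) (u N) b k (c N + b - k)
    * (g N (a N) * g N (c N) / g N k) * auxBelow q x y u v g a c M N (c N + b - k) d else 0 with hΦ
  have step : ∀ k ∈ range (M + 1), ∑ f ∈ seqs M N,
      row (lWeight q y u v) a (f.update N k) (N + 1) e
        * row (tWeight q x v u) c (f.update N k) (N + 1) b
        * ∏ i ∈ range (N + 1), g i (a i) * g i (c i) / g i (f.update N k i)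
      = if k ≤ a N + e then
          lw q y (u N) (v N) (a N) e (a N + e - k) * Φ k (a N + e - k) else 0 := by
    intro k _
    simp only [hΦ, row, Finsupp.coe_update, row_update_top, Function.update_self, tWeight, lWeight,
      prod_range_succ, prod_update (fun i k => g i (a i) * g i (c i) / g i k), auxBelow]
    split_ifs
    · rw [mul_sum, mul_sum]
      exact sum_congr rfl fun f _ => by ring
    all_goals simp
  rw [sum_congr rfl step, sum_lw_bottom _ _ _ _ _ _ _ hM Φ]

theorem auxAbove_succ (N b e : ℕ) (he : e ≤ 1) (hM : c N + 1 ≤ M) :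
    auxAbove q x y u v g a c M (N + 1) b e
      = (if e ≤ c N then
          (if a N ≤ c N - e + b then g N (c N - e)
            * wt q x (v N) (u N) b (a N) (c N - e + b - a N)
            * auxAbove q x y u v g a c M N (c N - e + b - a N) 0 else 0)
            * lw q y (u N) (v N) (c N - e) e 0 else 0)
        + (if a N ≤ c N + 1 - e + b then g N (c N + 1 - e)
            * wt q x (v N) (u N) b (a N) (c N + 1 - e + b - a N)
            * auxAbove q x y u v g a c M N (c N + 1 - e + b - a N) 1 else 0)
            * lw q y (u N) (v N) (c N + 1 - e) e 1 := by
  rw [auxAbove, sum_seqs_succ]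
  set Φ : ℕ → ℕ → ℂ := fun k d => if a N ≤ k + b then g N k * wt q x (v N) (u N) b (a N) (k + b - a N)
    * auxAbove q x y u v g a c M N (k + b - a N) d else 0 with hΦ
  have step : ∀ k ∈ range (M + 1), ∑ f ∈ seqs M N,
      (∏ i ∈ range (N + 1), g i (f.update N k i))
        * row (tWeight q x v u) (f.update N k) a (N + 1) b
        * row (lWeight q y u v) (f.update N k) c (N + 1) e
      = if c N ≤ k + e then
          Φ k (k + e - c N) * lw q y (u N) (v N) k e (k + e - c N) else 0 := by
    intro k _
    simp only [hΦ, row, Finsupp.coe_update, row_update_bottom, Function.update_self, tWeight,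
      lWeight, prod_range_succ, prod_update, auxAbove]
    split_ifs
    · rw [mul_sum, sum_mul]
      exact sum_congr rfl fun f _ => by ring
    all_goals simp
  rw [sum_congr rfl step, sum_lw_top _ _ _ _ _ _ _ he hM Φ]

variable {q x y u v g a c M}

/-- The crossing of the two lines enters on the left and is pulled through the sites one at a time
by the exchange lemmas. At the free right boundary it disappears because its entries add up to `1 -
xy` for either auxiliary label: `1 - xy` and `(q ^ b - xy) + (1 - q ^ b)`. Both statements are
needed together, since each site mixes the auxiliary labels. -/
theorem zipper (hq : ‖q‖ < 1) (hg0 : ∀ i k, g i k ≠ 0)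
    (hg : ∀ i k, g i (k + 1) * (1 - q ^ (k + 1)) = g i k * (1 - u i * v i * q ^ k))
    (N : ℕ) (hMa : ∀ i < N, a i + 1 ≤ M) (hMc : ∀ i < N, c i + 1 ≤ M) (b : ℕ) :
    (1 - x * y) * auxBelow q x y u v g a c M N b 0
        = auxAbove q x y u v g a c M N b 0 - x * y * auxAbove q x y u v g a c M N (b + 1) 1 ∧
    (1 - x * y) * auxBelow q x y u v g a c M N b 1
        = (q ^ b - x * y) * auxAbove q x y u v g a c M N b 1
          + (1 - q ^ b) * auxAbove q x y u v g a c M N (b - 1) 0 := by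
  induction N generalizing b with
  | zero =>
    simp only [auxBelow, auxAbove, sum_seqs_zero, row, range_zero, prod_empty]
    constructor <;> ring
  | succ N ih =>
    have ih' := ih (fun i hi => hMa i (hi.trans N.lt_succ_self))
      (fun i hi => hMc i (hi.trans N.lt_succ_self))
    have hA := hMa N N.lt_succ_self
    have hC := hMc N N.lt_succ_self
    have hgg := hg0 N
    have hself : g N (a N) * g N (c N) / g N (a N) = g N (c N) := mul_div_cancel_left₀ _ (hgg _)
    constructor
    · rw [auxBelow_succ _ _ _ _ _ _ _ _ _ _ _ _ (by omega),
        auxAbove_succ _ _ _ _ _ _ _ _ _ _ _ _ (by omega) hC,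
        auxAbove_succ _ _ _ _ _ _ _ _ _ _ _ _ (by omega) hC]
      simp only [add_zero, tsub_zero, zero_le, if_true, add_tsub_cancel_right]
      -- Conservation fixes the total label leaving site `N`. The three cases are: both outgoing
      -- states `(E, 0)` and `(E + 1, 1)` occur, only `(0, 1)` occurs, or none does and both sides
      -- vanish.
      rcases lt_trichotomy (a N) (c N + b + 1) with h | h | h
      · obtain ⟨E, hE⟩ := Nat.exists_eq_add_of_le (Nat.lt_succ_iff.1 h)
        have h1 := (ih' E).1
        have h2 := (ih' (E + 1)).2
        have e0 := exchange_zero_zero (x := x) (y := y) hq hgg (hg N) (c N) b (a N) E hE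
        have e1 := exchange_zero_one (x := x) (y := y) hq hgg (hg N) (c N) b (a N) E hE
        rw [add_tsub_cancel_right] at h2
        rw [if_pos (show a N ≤ c N + b by omega), if_pos (show a N ≤ c N + b by omega),
          if_pos (show a N - 1 ≤ c N + b by omega), if_pos (show a N ≤ c N + 1 + b by omega),
          if_pos (show a N ≤ c N + (b + 1) by omega), show c N + b - a N = E by omega,
          show c N + 1 + b - a N = E + 1 by omega, show c N + (b + 1) - a N = E + 1 by omega, hself]
        have hlow : (if 1 ≤ a N then lw q y (u N) (v N) (a N) 0 1 *
            (wt q x (v N) (u N) b (a N - 1) (c N + b - (a N - 1))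
              * (g N (a N) * g N (c N) / g N (a N - 1))
              * auxBelow q x y u v g a c M N (c N + b - (a N - 1)) 1) else 0)
            = (if 1 ≤ a N then lw q y (u N) (v N) (a N) 0 1 * wt q x (v N) (u N) b (a N - 1) (E + 1)
                * (g N (a N) * g N (c N) / g N (a N - 1)) else 0)
              * auxBelow q x y u v g a c M N (E + 1) 1 := by
          split_ifs with ha
          · rw [show c N + b - (a N - 1) = E + 1 by omega]; ring
          · simp
        have hup : (if 1 ≤ c N then (if a N ≤ c N - 1 + (b + 1) then g N (c N - 1)
              * wt q x (v N) (u N) (b + 1) (a N) (c N - 1 + (b + 1) - a N)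
              * auxAbove q x y u v g a c M N (c N - 1 + (b + 1) - a N) 0 else 0)
              * lw q y (u N) (v N) (c N - 1) 1 0 else 0)
            = (if 1 ≤ c N then g N (c N - 1) * wt q x (v N) (u N) (b + 1) (a N) E
                * lw q y (u N) (v N) (c N - 1) 1 0 else 0)
              * auxAbove q x y u v g a c M N E 0 := by
          split_ifs
          · rw [show c N - 1 + (b + 1) - a N = E by omega]; ring
          · omega
          · simp
        rw [hlow, hup]
        have ite_mul_right : ∀ s r : ℂ, (if 1 ≤ a N then s * r else 0)
            = (if 1 ≤ a N then s else 0) * r := fun s r => by split_ifs <;> simp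
        rw [ite_mul_right _ (1 - q ^ (E + 1))] at e0
        rw [ite_mul_right _ (q ^ (E + 1) - x * y)] at e1
        linear_combination lw q y (u N) (v N) (a N) 0 0 * wt q x (v N) (u N) b (a N) E
            * g N (c N) * h1
          + (if 1 ≤ a N then lw q y (u N) (v N) (a N) 0 1 * wt q x (v N) (u N) b (a N - 1) (E + 1)
                * (g N (a N) * g N (c N) / g N (a N - 1)) else 0) * h2
          + auxAbove q x y u v g a c M N E 0 * e0
          + auxAbove q x y u v g a c M N (E + 1) 1 * e1
      · have h2 := (ih' 0).2
        have e1 := exchange_zero_one_edge (x := x) (y := y) hq hgg (hg N) (c N) b (c N + b) rfl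
        rw [← h] at e1
        rw [if_neg (show ¬ a N ≤ c N + b by omega), if_neg (show ¬ a N ≤ c N + b by omega),
          if_pos (show 1 ≤ a N by omega), if_pos (show a N - 1 ≤ c N + b by omega),
          if_pos (show a N ≤ c N + 1 + b by omega), if_pos (show a N ≤ c N + (b + 1) by omega),
          show c N + b - (a N - 1) = 0 by omega, show c N + 1 + b - a N = 0 by omega,
          show c N + (b + 1) - a N = 0 by omega, show a N - 1 = c N + b by omega]
        have hup : (if 1 ≤ c N then (if a N ≤ c N - 1 + (b + 1) then g N (c N - 1)
              * wt q x (v N) (u N) (b + 1) (a N) (c N - 1 + (b + 1) - a N)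
              * auxAbove q x y u v g a c M N (c N - 1 + (b + 1) - a N) 0 else 0)
              * lw q y (u N) (v N) (c N - 1) 1 0 else 0) = 0 := by
          split_ifs
          · omega
          · simp
          · rfl
        rw [hup]
        simp only [pow_zero] at h2
        linear_combination lw q y (u N) (v N) (a N) 0 1 * wt q x (v N) (u N) b (c N + b) 0
            * (g N (a N) * g N (c N) / g N (c N + b)) * h2
          + auxAbove q x y u v g a c M N 0 1 * e1
      · rw [if_neg (show ¬ a N ≤ c N + b by omega), if_neg (show ¬ a N ≤ c N + b by omega),
          if_neg (show ¬ a N - 1 ≤ c N + b by omega), if_neg (show ¬ a N ≤ c N + 1 + b by omega),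
          if_neg (show ¬ a N ≤ c N + (b + 1) by omega)]
        have hup : (if 1 ≤ c N then (if a N ≤ c N - 1 + (b + 1) then g N (c N - 1)
              * wt q x (v N) (u N) (b + 1) (a N) (c N - 1 + (b + 1) - a N)
              * auxAbove q x y u v g a c M N (c N - 1 + (b + 1) - a N) 0 else 0)
              * lw q y (u N) (v N) (c N - 1) 1 0 else 0) = 0 := by
          split_ifs
          · omega
          · simp
          · rfl
        rw [hup]
        simp
    · rw [auxBelow_succ _ _ _ _ _ _ _ _ _ _ _ _ (by omega),
        auxAbove_succ _ _ _ _ _ _ _ _ _ _ _ _ (by omega) hC,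
        auxAbove_succ _ _ _ _ _ _ _ _ _ _ _ _ (by omega) hC]
      simp only [tsub_zero, zero_le, if_true, add_tsub_cancel_right,
        le_add_iff_nonneg_left]
      rcases lt_trichotomy (a N) (c N + b) with h | h | h
      · obtain ⟨E, hE⟩ := Nat.exists_eq_add_of_le (Nat.succ_le_iff.2 h)
        have h1 := (ih' E).1
        have h2 := (ih' (E + 1)).2
        have e0 := exchange_one_zero (x := x) (y := y) hq hgg (hg N) (c N) b (a N) E (by omega)
        have e1 := exchange_one_one (x := x) (y := y) hq hgg (hg N) (c N) b (a N) E (by omega)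
        rw [add_tsub_cancel_right] at h2
        rw [if_pos (show a N + 1 ≤ c N + b by omega), if_pos (show a N ≤ c N + b by omega),
          if_pos (show a N ≤ c N + b by omega), show c N + b - a N = E + 1 by omega,
          show c N + b - (a N + 1) = E by omega, hself]
        have hup : (if 1 ≤ c N then (if a N ≤ c N - 1 + b then g N (c N - 1)
              * wt q x (v N) (u N) b (a N) (c N - 1 + b - a N)
              * auxAbove q x y u v g a c M N (c N - 1 + b - a N) 0 else 0)
              * lw q y (u N) (v N) (c N - 1) 1 0 else 0)
            = (if 1 ≤ c N then g N (c N - 1) * wt q x (v N) (u N) b (a N) E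
                * lw q y (u N) (v N) (c N - 1) 1 0 else 0)
              * auxAbove q x y u v g a c M N E 0 := by
          split_ifs
          · rw [show c N - 1 + b - a N = E by omega]; ring
          · omega
          · simp
        -- At `b = 0` the prefactor removes the term with left label `b - 1`, so the truncated
        -- subtraction is harmless.
        have hb0 : (1 - q ^ b) * ((if a N ≤ c N + (b - 1) then g N (c N)
              * wt q x (v N) (u N) (b - 1) (a N) (c N + (b - 1) - a N)
              * auxAbove q x y u v g a c M N (c N + (b - 1) - a N) 0 else 0)
              * lw q y (u N) (v N) (c N) 0 0
            + (if a N ≤ c N + 1 + (b - 1) then g N (c N + 1)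
              * wt q x (v N) (u N) (b - 1) (a N) (c N + 1 + (b - 1) - a N)
              * auxAbove q x y u v g a c M N (c N + 1 + (b - 1) - a N) 1 else 0)
              * lw q y (u N) (v N) (c N + 1) 0 1)
            = (1 - q ^ b) * (g N (c N) * wt q x (v N) (u N) (b - 1) (a N) E
                * lw q y (u N) (v N) (c N) 0 0) * auxAbove q x y u v g a c M N E 0
              + (1 - q ^ b) * (g N (c N + 1) * wt q x (v N) (u N) (b - 1) (a N) (E + 1)
                * lw q y (u N) (v N) (c N + 1) 0 1) * auxAbove q x y u v g a c M N (E + 1) 1 := by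
          rcases b with _ | b
          · simp
          · rw [add_tsub_cancel_right, if_pos (by omega), if_pos (by omega),
              show c N + b - a N = E by omega, show c N + 1 + b - a N = E + 1 by omega]
            ring
        rw [hup, hb0]
        linear_combination lw q y (u N) (v N) (a N) 1 0 * wt q x (v N) (u N) b (a N + 1) E
            * (g N (a N) * g N (c N) / g N (a N + 1)) * h1
          + lw q y (u N) (v N) (a N) 1 1 * wt q x (v N) (u N) b (a N) (E + 1) * g N (c N) * h2
          + auxAbove q x y u v g a c M N E 0 * e0
          + auxAbove q x y u v g a c M N (E + 1) 1 * e1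
      · have h2 := (ih' 0).2
        have e1 := exchange_one_one_edge (x := x) (y := y) hq (hg N) (c N) b (a N) h.symm
        rw [if_neg (show ¬ a N + 1 ≤ c N + b by omega), if_pos (show a N ≤ c N + b by omega),
          if_pos (show a N ≤ c N + b by omega), show c N + b - a N = 0 by omega, hself]
        have hup : (if 1 ≤ c N then (if a N ≤ c N - 1 + b then g N (c N - 1)
              * wt q x (v N) (u N) b (a N) (c N - 1 + b - a N)
              * auxAbove q x y u v g a c M N (c N - 1 + b - a N) 0 else 0)
              * lw q y (u N) (v N) (c N - 1) 1 0 else 0) = 0 := by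
          split_ifs
          · omega
          · simp
          · rfl
        have hb0 : (1 - q ^ b) * ((if a N ≤ c N + (b - 1) then g N (c N)
              * wt q x (v N) (u N) (b - 1) (a N) (c N + (b - 1) - a N)
              * auxAbove q x y u v g a c M N (c N + (b - 1) - a N) 0 else 0)
              * lw q y (u N) (v N) (c N) 0 0
            + (if a N ≤ c N + 1 + (b - 1) then g N (c N + 1)
              * wt q x (v N) (u N) (b - 1) (a N) (c N + 1 + (b - 1) - a N)
              * auxAbove q x y u v g a c M N (c N + 1 + (b - 1) - a N) 1 else 0)
              * lw q y (u N) (v N) (c N + 1) 0 1)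
            = (1 - q ^ b) * (g N (c N + 1) * wt q x (v N) (u N) (b - 1) (a N) 0
                * lw q y (u N) (v N) (c N + 1) 0 1) * auxAbove q x y u v g a c M N 0 1 := by
          rcases b with _ | b
          · simp
          · rw [add_tsub_cancel_right, if_neg (by omega), if_pos (by omega),
              show c N + 1 + b - a N = 0 by omega]
            ring
        rw [hup, hb0]
        simp only [pow_zero] at h2
        linear_combination lw q y (u N) (v N) (a N) 1 1 * wt q x (v N) (u N) b (a N) 0
            * g N (c N) * h2
          + auxAbove q x y u v g a c M N 0 1 * e1
      · rw [if_neg (show ¬ a N + 1 ≤ c N + b by omega), if_neg (show ¬ a N ≤ c N + b by omega),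
          if_neg (show ¬ a N ≤ c N + b by omega), if_neg (show ¬ a N ≤ c N + (b - 1) by omega)]
        have hup : (if 1 ≤ c N then (if a N ≤ c N - 1 + b then g N (c N - 1)
              * wt q x (v N) (u N) b (a N) (c N - 1 + b - a N)
              * auxAbove q x y u v g a c M N (c N - 1 + b - a N) 0 else 0)
              * lw q y (u N) (v N) (c N - 1) 1 0 else 0) = 0 := by
          split_ifs
          · omega
          · simp
          · rfl
        rw [hup]
        rcases b with _ | b
        · simp
        · rw [add_tsub_cancel_right, if_neg (show ¬ a N ≤ c N + 1 + b by omega)]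
          simp

end zipper

end QWhittaker


namespace QWhittaker

open Finset

/-! ### The rows of `transfer` -/

theorem sum_qBinom_succ_mul {q : ℂ} (hq : ‖q‖ < 1) (b : ℕ) (A : ℕ → ℂ) :
    ∑ p ∈ range (b + 2), qBinom q (b + 1) p * A p
      = ∑ p ∈ range (b + 1), qBinom q b p * (q ^ p * A p + A (p + 1)) := by
  have hmid : ∀ p ∈ range b, qBinom q (b + 1) (p + 1) * A (p + 1)
      = qBinom q b (p + 1) * (q ^ (p + 1) * A (p + 1)) + qBinom q b p * A (p + 1) := by
    intro p hp
    obtain ⟨d, rfl⟩ := Nat.exists_eq_add_of_le (Nat.succ_le_of_lt (mem_range.1 hp))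
    have := qBinom_pascal hq p d
    rw [show p + 1 + (d + 1) = p.succ + d + 1 by omega, show p + (d + 1) = p.succ + d by omega] at this
    rw [this, ← Nat.succ_eq_add_one p]
    ring
  simp only [mul_add, sum_add_distrib]
  rw [sum_range_succ, sum_range_succ', sum_congr rfl hmid, sum_add_distrib,
    sum_range_succ' (fun p => qBinom q b p * (q ^ p * A p)),
    sum_range_succ (fun p => qBinom q b p * A (p + 1)), qBinom_self hq, qBinom_self hq,
    qBinom_zero_right hq, qBinom_zero_right hq]
  ring

/-- By the `q`-Pascal rule in summed form the left side satisfies the recursion that defines `wt`,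
already term by term in `p`. The division by `x` disappears because each step produces one factor
`(v / x) * x = v`. -/
theorem sum_eq_wt {q x : ℂ} (hq : ‖q‖ < 1) (hx : x ≠ 0) (u v : ℂ) (b c d : ℕ) (h : b ≤ c + d) :
    ∑ p ∈ range (b + 1), qBinom q b p * (qPoch (v / x) q p * (v / x) ^ (b - p)
      * if p ≤ c then wt q x u v 0 (c - p) d else 0) = wt q x u v b c d := by
  have hvx : v / x * x = v := div_mul_cancel₀ v hx
  induction b generalizing c d with
  | zero => simp [qBinom_zero_right hq]
  | succ b ih =>
    rw [sum_qBinom_succ_mul hq]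
    rcases c with _ | c
    · obtain ⟨d, rfl⟩ : ∃ k, d = k + 1 := ⟨d - 1, by omega⟩
      rw [wt_succ_zero_succ, ← ih 0 d (by omega), mul_sum]
      refine sum_congr rfl fun p hp => ?_
      rcases p with _ | p
      · simp only [pow_zero, qPoch_zero, tsub_zero, wt_zero, le_refl, if_true, pow_succ]
        simp only [qBinom_zero_right hq, Nat.le_zero, Nat.succ_ne_zero, if_false]
        linear_combination (v / x) ^ b * x ^ d * hvx
      · simp
    · rcases d with _ | d
      · rw [wt_succ_succ_zero, ← ih c 0 (by omega), mul_sum]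
        refine sum_congr rfl fun p hp => ?_
        rw [mem_range] at hp
        obtain ⟨k, rfl⟩ := Nat.exists_eq_add_of_le (show p ≤ c by omega)
        obtain ⟨l, rfl⟩ := Nat.exists_eq_add_of_le (Nat.lt_succ_iff.1 hp)
        rw [if_pos (by omega), if_pos (by omega), if_pos (by omega), qPoch_succ,
          show p + k + 1 - (p + 1) = k by omega, show p + k + 1 - p = k + 1 by omega,
          show p + k - p = k by omega, show p + l + 1 - p = l + 1 by omega,
          show p + l + 1 - (p + 1) = l by omega, show p + l - p = l by omega]
        simp only [wt_zero, add_zero, qBinom_self hq, qPoch_succ, pow_zero, pow_add]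
        linear_combination (-(qBinom q (p + l) p * q ^ p * qPoch (v / x) q p * (v / x) ^ l
          * qPoch (u * x) q k * u * q ^ k)) * hvx
      · rw [wt_succ_succ_succ, ← ih c (d + 1) (by omega), ← ih (c + 1) d (by omega), mul_sum,
          mul_sum, ← sum_add_distrib]
        refine sum_congr rfl fun p hp => ?_
        rw [mem_range] at hp
        obtain ⟨l, rfl⟩ := Nat.exists_eq_add_of_le (Nat.lt_succ_iff.1 hp)
        rcases lt_trichotomy p (c + 1) with hpc | hpc | hpc
        · obtain ⟨k, rfl⟩ := Nat.exists_eq_add_of_le (show p ≤ c by omega)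
          have hz := wt_zero_pascal (x := x) (u := u) (v := v) hq k d
          rw [if_pos (by omega), if_pos (by omega), if_pos (by omega), if_pos (by omega), qPoch_succ,
            show p + k + 1 - (p + 1) = k by omega, show p + k + 1 - p = k + 1 by omega,
            show p + k - p = k by omega, show p + l + 1 - p = l + 1 by omega,
            show p + l + 1 - (p + 1) = l by omega, show p + l - p = l by omega, hz]
          simp only [pow_add]
          linear_combination (qBinom q (p + l) p * q ^ p * qPoch (v / x) q p * (v / x) ^ l
            * q ^ k * (- u * wt q x u v 0 k (d + 1) + q * wt q x u v 0 (k + 1) d)) * hvx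
        · subst hpc
          rw [if_pos (by omega), if_neg (by omega), if_neg (by omega), if_pos (by omega),
            show c + 1 + l + 1 - (c + 1) = l + 1 by omega, show c + 1 + l - (c + 1) = l by omega,
            tsub_self]
          simp only [wt_zero, zero_add, qBinom_zero_right hq, qPoch_zero, pow_succ]
          linear_combination (qBinom q (c + 1 + l) (c + 1) * q ^ c * q * qPoch (v / x) q (c + 1)
            * (v / x) ^ l * x ^ d) * hvx
        · rw [if_neg (by omega), if_neg (by omega), if_neg (by omega), if_neg (by omega)]
          ring

theorem vertexWeight_eq_wt {q x : ℂ} (hq : ‖q‖ < 1) (u v : ℂ) {a b c d : ℕ}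
    (hx : x ≠ 0 ∨ b = 0) (h : a + b = c + d) :
    vertexWeight q x u v a b c d = wt q x u v b c d := by
  rw [vertexWeight, if_pos h, mul_sum]
  rcases hx with hx | rfl
  · rw [← sum_eq_wt hq hx u v b c d (by omega)]
    symm
    rw [← sum_subset (range_subset_range.2 (Nat.succ_le_succ (min_le_left b c)))]
    · refine sum_congr rfl fun p hp => ?_
      rw [mem_range] at hp
      rw [if_pos (by omega), wt_zero, show c - p + d = c + d - p by omega]
      ring
    · intro p hp hp'
      rw [mem_range] at hp hp'
      rw [if_neg (by omega)]
      ring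
  · simp [wt_zero, qBinom_zero_right hq, mul_assoc]

theorem rowWeight_eq_row {q x : ℂ} (hq : ‖q‖ < 1) (u v : ℕ → ℂ) (a c : ℕ → ℕ) (N b : ℕ)
    (hx : x ≠ 0 ∨ b = 0) :
    rowWeight q x u v a c N b = row (tWeight q x u v) a c N b := by
  induction N generalizing b with
  | zero => rfl
  | succ N ih =>
    rw [rowWeight, row]
    split_ifs with h
    · rw [sum_eq_single_of_mem (a N + b - c N) (mem_range.2 (by omega)),
        vertexWeight_eq_wt hq _ _ hx (by omega), tWeight]
      · by_cases hd : x ≠ 0 ∨ a N + b - c N = 0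
        · rw [ih _ hd]
        -- Here `x = 0`, hence `b = 0`, and the right label is positive: the polynomial weight
        -- contains a positive power of `x` and vanishes, so the rest of the row does not matter.
        · push Not at hd
          rw [hx.resolve_left (not_not.2 hd.1), wt_zero, hd.1, zero_pow]
          · ring
          · have := hx.resolve_left (not_not.2 hd.1)
            have := hd.2
            omega
      · intro d _ hd
        rw [vertexWeight, if_neg (by omega), zero_mul]
    · refine sum_eq_zero fun d _ => ?_
      rw [vertexWeight, if_neg (by omega), zero_mul]

end QWhittaker


namespace QWhittaker

open Finset

/-! ### Partitions as finitely supported sequences of multiplicities -/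

/-- The columns of length `i + 1` are those whose index lies between two consecutive row lengths. -/
theorem mult_transpose (κ : YoungDiagram) (i : ℕ) :
    mult κ.transpose (i + 1) = κ.rowLen i - κ.rowLen (i + 1) := by
  have h : mult κ.transpose (i + 1)
      = ((range (κ.rowLen 0)).filter fun j => κ.colLen j = i + 1).card := by
    rw [mult, YoungDiagram.rowLens, YoungDiagram.colLen_transpose, List.count, List.countP_map,
      List.countP_eq_length_filter]
    simp only [Finset.card, Finset.filter, Finset.range, Multiset.range, Multiset.filter_coe,
      Multiset.coe_card]
    congr 2
    funext j
    simp [YoungDiagram.rowLen_transpose, beq_eq_decide]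
  rw [h, ← Nat.card_Ico]
  congr 1
  ext j
  have h1 := YoungDiagram.mem_iff_lt_rowLen (μ := κ) (i := i) (j := j)
  have h2 := YoungDiagram.mem_iff_lt_rowLen (μ := κ) (i := i + 1) (j := j)
  rw [YoungDiagram.mem_iff_lt_colLen] at h1 h2
  have h3 := κ.rowLen_anti 0 i (Nat.zero_le i)
  simp only [mem_filter, mem_range, mem_Ico]
  omega

theorem rowLen_eq_zero {κ : YoungDiagram} {i : ℕ} (h : κ.colLen 0 ≤ i) : κ.rowLen i = 0 := by
  by_contra h0
  have h1 := YoungDiagram.mem_iff_lt_rowLen.2 (Nat.pos_of_ne_zero h0)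
  rw [YoungDiagram.mem_iff_lt_colLen] at h1
  omega

theorem le_iff_rowLen {κ ν : YoungDiagram} : ν ≤ κ ↔ ∀ i, ν.rowLen i ≤ κ.rowLen i := by
  constructor
  · intro h i
    by_contra! hi
    have h1 := h (YoungDiagram.mem_iff_lt_rowLen.2 hi)
    exact (YoungDiagram.mem_iff_lt_rowLen.1 h1).ne rfl
  · rintro h ⟨i, j⟩ hj
    exact YoungDiagram.mem_iff_lt_rowLen.2 ((YoungDiagram.mem_iff_lt_rowLen.1 hj).trans_le (h i))

theorem ext_rowLen {κ ν : YoungDiagram} (h : ∀ i, κ.rowLen i = ν.rowLen i) : κ = ν :=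
  le_antisymm (le_iff_rowLen.2 fun i => (h i).le) (le_iff_rowLen.2 fun i => (h i).ge)

/-- The multiplicities of the columns of `κ`: the value at `i` is the number of columns of length
`i + 1`. -/
noncomputable def colMult (κ : YoungDiagram) : ℕ →₀ ℕ :=
  Finsupp.onFinset (range (κ.colLen 0)) (fun i => κ.rowLen i - κ.rowLen (i + 1)) fun i hi => by
    by_contra h
    rw [mem_range, not_lt] at h
    exact hi (by rw [rowLen_eq_zero h, zero_tsub])

theorem colMult_apply (κ : YoungDiagram) (i : ℕ) :
    colMult κ i = κ.rowLen i - κ.rowLen (i + 1) := rfl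

theorem rowLen_succ_add_colMult (κ : YoungDiagram) (i : ℕ) :
    κ.rowLen (i + 1) + colMult κ i = κ.rowLen i :=
  Nat.add_sub_cancel' (κ.rowLen_anti _ _ i.le_succ)

theorem mult_transpose_eq (κ : YoungDiagram) :
    (fun i => mult κ.transpose (i + 1)) = colMult κ := funext (mult_transpose κ)

theorem colMult_eq_zero {κ : YoungDiagram} {i : ℕ} (h : κ.colLen 0 ≤ i) : colMult κ i = 0 := by
  rw [colMult_apply, rowLen_eq_zero h, zero_tsub]

theorem colMult_injective : Function.Injective colMult := by
  intro κ ν h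
  -- Descending induction on the row: both diagrams are empty far enough down, and the differences
  -- of consecutive rows agree.
  have key : ∀ k i, max (κ.colLen 0) (ν.colLen 0) ≤ i + k → κ.rowLen i = ν.rowLen i := by
    intro k
    induction k with
    | zero =>
      intro i hi
      rw [rowLen_eq_zero (by omega), rowLen_eq_zero (by omega)]
    | succ k ih =>
      intro i hi
      rw [← rowLen_succ_add_colMult, ← rowLen_succ_add_colMult ν, h, ih (i + 1) (by omega)]
  exact ext_rowLen fun i => key _ i (Nat.le_add_left _ i)

theorem colMult_surjective : Function.Surjective colMult := by
  intro f
  -- The row lengths of the desired diagram are the tail sums of the multiplicities.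
  set tail : ℕ → ℕ := fun i => ∑ k ∈ f.support with i ≤ k, f k with htail
  have hanti : ∀ i j, i ≤ j → tail j ≤ tail i := fun i j hij =>
    sum_le_sum_of_subset (monotone_filter_right _ fun _ _ h => hij.trans h)
  have hsucc : ∀ i, tail (i + 1) + f i = tail i := by
    intro i
    simp only [htail]
    by_cases hi : i ∈ f.support
    · rw [show f.support.filter (i ≤ ·) = insert i (f.support.filter (i + 1 ≤ ·)) by
        ext k
        simp only [mem_filter, mem_insert]
        constructor
        · rintro ⟨h1, h2⟩
          rcases h2.eq_or_lt with h3 | h3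
          · exact Or.inl h3.symm
          · exact Or.inr ⟨h1, h3⟩
        · rintro (rfl | ⟨h1, h2⟩)
          · exact ⟨hi, le_rfl⟩
          · exact ⟨h1, by omega⟩, sum_insert (by simp), add_comm]
    · rw [Finsupp.notMem_support_iff.1 hi, add_zero]
      refine sum_congr (filter_congr fun k hk => ?_) fun _ _ => rfl
      have : k ≠ i := fun h => hi (h ▸ hk)
      omega
  have hbound : ∀ i, f.support.sup id < i → tail i = 0 := by
    intro i hi
    refine sum_eq_zero fun k hk => ?_
    rw [mem_filter] at hk
    have := le_sup (f := id) hk.1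
    simp only [id] at this
    omega
  let κ : YoungDiagram :=
    { cells := (range (f.support.sup id + 1) ×ˢ range (tail 0)).filter fun p => p.2 < tail p.1
      isLowerSet := by
        rintro ⟨i, j⟩ ⟨i', j'⟩ h hm
        simp only [coe_filter, mem_product, mem_range, Set.mem_ofPred_eq] at hm ⊢
        obtain ⟨h1, h2⟩ := Prod.mk_le_mk.1 h
        have := hanti _ _ h1
        omega }
  have hrow : ∀ i, κ.rowLen i = tail i := by
    intro i
    have hmem : ∀ j, j < κ.rowLen i ↔ j < tail i := by
      intro j
      rw [← YoungDiagram.mem_iff_lt_rowLen, ← YoungDiagram.mem_cells]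
      simp only [κ, mem_filter, mem_product, mem_range]
      have := hanti 0 i (Nat.zero_le i)
      have := hbound i
      omega
    have h1 := hmem (κ.rowLen i)
    have h2 := hmem (tail i)
    omega
  refine ⟨κ, Finsupp.ext fun i => ?_⟩
  rw [colMult_apply, hrow, hrow, ← hsucc i]
  omega

/-- Partitions correspond to the multiplicities of their columns. -/
noncomputable def colMultEquiv : YoungDiagram ≃ (ℕ →₀ ℕ) :=
  Equiv.ofBijective colMult ⟨colMult_injective, colMult_surjective⟩

theorem colMult_symm_apply (f : ℕ →₀ ℕ) : colMult (colMultEquiv.symm f) = f :=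
  colMultEquiv.apply_symm_apply f

theorem colLen_zero_le {κ : YoungDiagram} {N : ℕ} (h : ∀ i, N ≤ i → colMult κ i = 0) :
    κ.colLen 0 ≤ N := by
  have key : ∀ k i, κ.colLen 0 ≤ i + k → N ≤ i → κ.rowLen i = 0 := by
    intro k
    induction k with
    | zero => intro i hi _; exact rowLen_eq_zero hi
    | succ k ih =>
      intro i hi hN
      rw [← rowLen_succ_add_colMult, ih (i + 1) (by omega) (by omega), h i hN]
  by_contra! hlt
  have h1 := key _ N (Nat.le_add_left _ N) le_rfl
  rw [← YoungDiagram.mem_iff_lt_colLen, YoungDiagram.mem_iff_lt_rowLen, h1] at hlt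
  exact absurd hlt (lt_irrefl 0)

/-- The partitions with at most `N` rows and with column multiplicities at most `M`. -/
noncomputable def box (M N : ℕ) : Finset YoungDiagram :=
  (seqs M N).map colMultEquiv.symm.toEmbedding

theorem sum_box {A : Type*} [AddCommMonoid A] (M N : ℕ) (F : YoungDiagram → A) :
    ∑ κ ∈ box M N, F κ = ∑ f ∈ seqs M N, F (colMultEquiv.symm f) := by
  rw [box, sum_map]
  rfl

theorem mem_box {M N : ℕ} {κ : YoungDiagram} :
    κ ∈ box M N ↔ κ.colLen 0 ≤ N ∧ ∀ i, colMult κ i ≤ M := by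
  rw [box, mem_map_equiv, Equiv.symm_symm, mem_seqs]
  exact and_congr_left fun _ => ⟨colLen_zero_le, fun h i hi => colMult_eq_zero (h.trans hi)⟩

theorem exists_mem_box (κ : YoungDiagram) :
    ∃ K, ∀ M N, K ≤ M → K ≤ N → κ ∈ box M N :=
  ⟨κ.colLen 0 + κ.rowLen 0, fun M N hM hN => mem_box.2 ⟨by omega, fun i => by
    have := κ.rowLen_anti 0 i (Nat.zero_le i)
    rw [colMult_apply]
    omega⟩⟩

theorem tendsto_box : Filter.Tendsto (fun N => box N N) Filter.atTop Filter.atTop := by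
  refine Filter.tendsto_atTop_finset_of_monotone ?_ ?_
  · intro M N h κ hκ
    rw [mem_box] at hκ ⊢
    exact ⟨hκ.1.trans h, fun i => (hκ.2 i).trans h⟩
  · intro κ
    obtain ⟨K, hK⟩ := exists_mem_box κ
    exact ⟨K, hK K K le_rfl le_rfl⟩

/-! ### Row-to-row matrices -/

/-- The matrix of the rows with site weights `w` and left boundary label `0`. -/
noncomputable def mat (w : ℕ → ℕ → ℕ → ℕ → ℕ → ℂ) (κ ν : YoungDiagram) : ℂ :=
  row w (colMult κ) (colMult ν) (max (κ.colLen 0) (ν.colLen 0)) 0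

theorem transfer_eq_mat {q : ℂ} (hq : ‖q‖ < 1) (x : ℂ) (u v : ℕ → ℂ) (κ ν : YoungDiagram) :
    transfer q x u v κ ν = mat (tWeight q x u v) κ ν := by
  rw [transfer, mat, mult_transpose_eq, mult_transpose_eq, rowWeight_eq_row hq _ _ _ _ _ _ (Or.inr rfl)]

theorem mat_eq_row {w : ℕ → ℕ → ℕ → ℕ → ℕ → ℂ} (hw : ∀ i, w i 0 0 0 0 = 1) {κ ν : YoungDiagram}
    {N : ℕ} (hκ : κ.colLen 0 ≤ N) (hν : ν.colLen 0 ≤ N) :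
    mat w κ ν = row w (colMult κ) (colMult ν) N 0 := by
  obtain ⟨k, rfl⟩ := Nat.exists_eq_add_of_le (max_le hκ hν)
  clear hκ hν
  induction k with
  | zero => rfl
  | succ k ih =>
    rw [ih, ← add_assoc, row, colMult_eq_zero (by omega), colMult_eq_zero (by omega)]
    simp [hw]

/-- Conservation makes the horizontal label to the left of site `i` equal to the difference of the
row lengths of index `i + 1`. Containment is therefore just the nonnegativity of horizontal labels.
-/
theorem row_ne_zero {w : ℕ → ℕ → ℕ → ℕ → ℕ → ℂ} {κ ν : YoungDiagram} {N b : ℕ}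
    (h : row w (colMult κ) (colMult ν) N b ≠ 0) (hb : κ.rowLen N = ν.rowLen N + b ∨ N = 0) (i : ℕ)
    (hi : i < N) : ν.rowLen i ≤ κ.rowLen i := by
  induction N generalizing b with
  | zero => omega
  | succ N ih =>
    rw [row] at h
    split_ifs at h with hc
    · have h1 := rowLen_succ_add_colMult κ N
      have h2 := rowLen_succ_add_colMult ν N
      rcases Nat.lt_succ_iff_lt_or_eq.1 hi with hi | rfl
      · exact ih (right_ne_zero_of_mul h) (Or.inl (by omega)) hi
      · omega
    · exact absurd rfl h

theorem mat_eq_zero {w : ℕ → ℕ → ℕ → ℕ → ℕ → ℂ} {κ ν : YoungDiagram} (h : ¬ ν ≤ κ) :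
    mat w κ ν = 0 := by
  by_contra h0
  refine h (le_iff_rowLen.2 fun i => ?_)
  by_cases hi : i < max (κ.colLen 0) (ν.colLen 0)
  · refine row_ne_zero h0 (Or.inl ?_) i hi
    rw [rowLen_eq_zero (le_max_left _ _), rowLen_eq_zero (le_max_right _ _)]
  · rw [rowLen_eq_zero (i := i) (κ := ν) (by omega)]
    exact Nat.zero_le _

theorem row_self {w : ℕ → ℕ → ℕ → ℕ → ℕ → ℂ} (a : ℕ → ℕ) (N : ℕ) :
    row w a a N 0 = ∏ i ∈ range N, w i (a i) 0 (a i) 0 := by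
  induction N with
  | zero => rfl
  | succ N ih => rw [row, if_pos (Nat.le_add_right _ _), add_zero, tsub_self, ih, prod_range_succ,
      mul_comm]

theorem mem_below {κ ν : YoungDiagram} : ν ∈ below κ ↔ ν ≤ κ := by
  rw [below, Set.Finite.mem_toFinset, Set.mem_Iic]

theorem colLen_mono {κ ν : YoungDiagram} (h : ν ≤ κ) : ν.colLen 0 ≤ κ.colLen 0 := by
  by_contra! hlt
  have h1 := h (YoungDiagram.mem_iff_lt_colLen.2 hlt)
  exact (YoungDiagram.mem_iff_lt_colLen.1 h1).ne rfl

theorem rowLen_mono {κ ν : YoungDiagram} (h : ν ≤ κ) (i : ℕ) : ν.rowLen i ≤ κ.rowLen i :=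
  le_iff_rowLen.1 h i

theorem below_subset_box (κ : YoungDiagram) {M N : ℕ} (hN : κ.colLen 0 ≤ N) (hM : κ.rowLen 0 ≤ M) :
    below κ ⊆ box M N := by
  intro ν hν
  rw [mem_below] at hν
  refine mem_box.2 ⟨(colLen_mono hν).trans hN, fun i => ?_⟩
  have h1 := ν.rowLen_anti 0 i (Nat.zero_le i)
  have h2 := rowLen_mono hν 0
  rw [colMult_apply]
  omega

end QWhittaker


namespace QWhittaker

open Finset

/-! ### Bounds for rows -/

/-- The product `∏_{j < b} (1 + α η ^ j)`. -/
noncomputable def geomProd (α η : ℝ) (b : ℕ) : ℝ := ∏ j ∈ range b, (1 + α * η ^ j)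

section geomProd

variable {α η : ℝ}

theorem one_le_geomProd (hα : 0 ≤ α) (hη : 0 ≤ η) (b : ℕ) : 1 ≤ geomProd α η b := by
  calc (1 : ℝ) = ∏ j ∈ range b, 1 := by simp
    _ ≤ geomProd α η b := prod_le_prod (fun _ _ => zero_le_one) fun j _ => by
      have : 0 ≤ α * η ^ j := by positivity
      linarith

theorem geomProd_pos (hα : 0 ≤ α) (hη : 0 ≤ η) (b : ℕ) : 0 < geomProd α η b :=
  zero_lt_one.trans_le (one_le_geomProd hα hη b)

theorem geomProd_succ (b : ℕ) : geomProd α η (b + 1) = geomProd α η b * (1 + α * η ^ b) :=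
  prod_range_succ _ _

theorem sum_range_pow_le (hη : 0 ≤ η) (hη1 : η < 1) (n : ℕ) :
    ∑ j ∈ range n, η ^ j ≤ 1 / (1 - η) := by
  rw [one_div, ← tsum_geometric_of_lt_one hη hη1]
  exact (summable_geometric_of_lt_one hη hη1).sum_le_tsum _ fun _ _ => by positivity

theorem geomProd_le (hα : 0 ≤ α) (hη : 0 ≤ η) (hη1 : η < 1) (b : ℕ) :
    geomProd α η b ≤ Real.exp (α * (1 / (1 - η))) := by
  calc geomProd α η b ≤ ∏ j ∈ range b, Real.exp (α * η ^ j) := by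
        refine prod_le_prod (fun j _ => by positivity) fun j _ => ?_
        rw [add_comm]
        exact Real.add_one_le_exp _
    _ = Real.exp (α * ∑ j ∈ range b, η ^ j) := by rw [← Real.exp_sum, mul_sum]
    _ ≤ _ := by
        gcongr
        exact sum_range_pow_le hη hη1 b

theorem geomProd_eq_one_add (b : ℕ) :
    geomProd α η b = 1 + α * ∑ d ∈ range b, η ^ d * geomProd α η d := by
  induction b with
  | zero => simp [geomProd]
  | succ b ih =>
    rw [sum_range_succ, geomProd_succ]
    linear_combination ih

/-- `geomProd` is a supersolution of the recursion for the mass sent through an empty site: the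
first term is the label passing straight through, the sum is the part deposited at the site. No
constant is lost, so the estimate can be iterated over arbitrarily many empty sites. -/
theorem geomProd_ge (hα : 0 ≤ α) (hη : 0 ≤ η) (hη1 : η < 1) (b : ℕ) :
    η ^ b * geomProd α η b + (1 - η) * α * ∑ d ∈ range b, η ^ d * geomProd α η d
      ≤ geomProd α η b := by
  rcases b with _ | b
  · simp
  · have h1 := geomProd_eq_one_add (α := α) (η := η) (b + 1)
    have h2 : η ^ (b + 1) ≤ η := by
      rw [pow_succ]
      exact mul_le_of_le_one_left hη (pow_le_one₀ hη hη1.le)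
    have h3 := mul_le_mul_of_nonneg_right h2 (geomProd_pos hα hη (b + 1)).le
    nlinarith

end geomProd

/-- The weight of the label `k` at a site. -/
noncomputable def siteWeight (D h : ℝ) (k : ℕ) : ℝ := if k = 0 then 1 else D * h ^ k

theorem siteWeight_pos {D h : ℝ} (hD : 1 ≤ D) (hh : 0 < h) (k : ℕ) : 0 < siteWeight D h k := by
  rw [siteWeight]
  split_ifs <;> positivity

theorem siteWeight_le {D h : ℝ} (hD : 1 ≤ D) (k : ℕ) :
    siteWeight D h k ≤ D * h ^ k := by
  rw [siteWeight]
  split_ifs with hk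
  · simpa [hk]
  · rfl

/-- Weight of a sequence of labels of the sites `0, …, N - 1`. -/
noncomputable def seqWeight (D : ℝ) (σ : ℕ → ℝ) (N : ℕ) (f : ℕ → ℕ) : ℝ :=
  ∏ i ∈ range N, siteWeight D (∏ j ∈ range (i + 1), σ j) (f i)

theorem seqWeight_pos {D : ℝ} {σ : ℕ → ℝ} (hD : 1 ≤ D) (hσ : ∀ i, 0 < σ i) (N : ℕ) (f : ℕ → ℕ) :
    0 < seqWeight D σ N f :=
  prod_pos fun _ _ => siteWeight_pos hD (prod_pos fun j _ => hσ j) _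

theorem seqWeight_succ_update (D : ℝ) (σ : ℕ → ℝ) (N k : ℕ) (f : ℕ → ℕ) :
    seqWeight D σ (N + 1) (Function.update f N k)
      = seqWeight D σ N f * siteWeight D (∏ j ∈ range (N + 1), σ j) k := by
  rw [seqWeight, prod_range_succ, Function.update_self, seqWeight]
  congr 1
  exact prod_congr rfl fun i hi => by rw [Function.update_of_ne (mem_range.1 hi).ne]

/-- Site weights that decay geometrically, with ratio `η σ i` at the site `i`, in the right label. -/
structure IsBounded (w : ℕ → ℕ → ℕ → ℕ → ℕ → ℂ) (σ : ℕ → ℝ) (η K : ℝ) : Prop where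
  le : ∀ i a b c d, a + b = c + d → ‖w i a b c d‖ ≤ K * (η * σ i) ^ d
  empty_le : ∀ i b, ‖w i 0 b 0 b‖ ≤ (η * σ i) ^ b

/-- The horizontal label `d` between sites `N` and `N - 1` is charged `(∏_{j < N} σ_j) ^ d`, which
matches the weight of the columns it can still create. The decay `η ^ d` leaves a convergent
geometric sum. Its constant is absorbed into the new `D` when the site below is nonempty; at an
empty site `geomProd_ge` keeps the bound free of constants. The result does not depend on `M`, and
depends on `N` only through the weights. -/
theorem sum_row_mul_seqWeight_le {w : ℕ → ℕ → ℕ → ℕ → ℕ → ℂ} {σ : ℕ → ℝ} {η K D : ℝ}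
    (hσ : ∀ i, 0 < σ i) (hη : 0 ≤ η) (hη1 : η < 1) (hK : 1 ≤ K) (hD : 1 ≤ D)
    (hw : IsBounded w σ η K) (a : ℕ → ℕ) (M N b : ℕ) :
    ∑ f ∈ seqs M N, ‖row w a f N b‖ * seqWeight D σ N f
      ≤ geomProd (K * D / (1 - η)) η b * (∏ j ∈ range N, σ j) ^ b *
        seqWeight (K * D * Real.exp (K * D / (1 - η) * (1 / (1 - η))) * (1 / (1 - η))) σ N a := by
  set α := K * D / (1 - η) with hαdef
  set Γ := Real.exp (α * (1 / (1 - η))) with hΓdef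
  set D' := K * D * Γ * (1 / (1 - η)) with hD'def
  have h1η : 0 < 1 - η := by linarith
  have hα : 0 ≤ α := by positivity
  have hKD : K * D = (1 - η) * α := by rw [hαdef]; field_simp
  have hΓ1 : 1 ≤ Γ := Real.one_le_exp (by positivity)
  have hD' : 1 ≤ D' := by
    rw [hD'def]
    have : 1 ≤ 1 / (1 - η) := by rw [le_div_iff₀ h1η]; linarith
    exact one_le_mul_of_one_le_of_one_le (one_le_mul_of_one_le_of_one_le
      (one_le_mul_of_one_le_of_one_le hK hD) hΓ1) this
  induction N generalizing b with
  | zero =>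
    rw [sum_seqs_zero]
    simpa [row, seqWeight] using one_le_geomProd hα hη b
  | succ N ih =>
    set h := ∏ j ∈ range (N + 1), σ j with hh
    set H := ∏ j ∈ range N, σ j with hHdef
    have hhpos : 0 < h := prod_pos fun j _ => hσ j
    have hHpos : 0 < H := prod_pos fun j _ => hσ j
    have hhH : h = H * σ N := prod_range_succ _ _
    set W := seqWeight D' σ N a
    have hW : 0 < W := seqWeight_pos hD' hσ N a
    set A := a N + b with hA
    -- The summand is indexed by the outgoing right label `d` instead of the top label `A - d`.
    set Y : ℕ → ℝ := fun d => ‖w N (a N) b (A - d) d‖ * siteWeight D h (A - d)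
      * (geomProd α η d * H ^ d) with hY
    have hY0 : ∀ d, 0 ≤ Y d := fun d =>
      mul_nonneg (mul_nonneg (norm_nonneg _) (siteWeight_pos hD hhpos _).le)
        (mul_nonneg (geomProd_pos hα hη d).le (by positivity))
    have hYle : ∀ d ≤ A, Y d ≤ K * D * h ^ A * (η ^ d * geomProd α η d) := by
      intro d hd
      have e1 := hw.le N (a N) b (A - d) d (by omega)
      have e2 := siteWeight_le hD (h := h) (A - d)
      calc Y d ≤ (K * (η * σ N) ^ d) * (D * h ^ (A - d)) * (geomProd α η d * H ^ d) := by
            have := geomProd_pos hα hη d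
            have := siteWeight_pos hD hhpos (A - d)
            have := (hσ N).le
            simp only [hY]
            gcongr
        _ = K * D * (h ^ (A - d) * h ^ d) * (η ^ d * geomProd α η d) := by rw [hhH]; ring
        _ = _ := by rw [← pow_add, Nat.sub_add_cancel hd]
    have hsite : ∑ d ∈ range (A + 1), Y d ≤ geomProd α η b * h ^ b * siteWeight D' h (a N) := by
      -- An empty site allows no new constant and uses `geomProd_ge`; a nonempty one uses the
      -- uniform bound of `geomProd` and pays with `D'`.
      by_cases ha : a N = 0
      · rw [siteWeight, if_pos ha, mul_one, sum_range_succ]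
        have hAb : A = b := by omega
        have htop : Y A ≤ η ^ b * geomProd α η b * h ^ b := by
          have e1 := hw.empty_le N b
          simp only [hY, hAb, ha, tsub_self]
          rw [siteWeight, if_pos rfl, mul_one]
          calc _ ≤ (η * σ N) ^ b * (geomProd α η b * H ^ b) := by
                have := geomProd_pos hα hη b
                gcongr
            _ = _ := by rw [hhH]; ring
        have hlow : ∑ d ∈ range A, Y d
            ≤ h ^ b * ((1 - η) * α * ∑ d ∈ range b, η ^ d * geomProd α η d) := by
          rw [mul_sum, mul_sum, hAb]
          refine sum_le_sum fun d hd => ?_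
          have := hYle d (by rw [mem_range] at hd; omega)
          rw [hKD, hAb] at this
          linarith
        have := mul_le_mul_of_nonneg_right (geomProd_ge hα hη hη1 b) (pow_pos hhpos b).le
        linarith
      · rw [siteWeight, if_neg ha]
        calc ∑ d ∈ range (A + 1), Y d ≤ ∑ d ∈ range (A + 1), K * D * h ^ A * Γ * η ^ d := by
              refine sum_le_sum fun d hd => (hYle d (by rw [mem_range] at hd; omega)).trans ?_
              have := geomProd_le hα hη hη1 d
              rw [mul_assoc _ Γ, mul_comm Γ]
              gcongr
          _ = K * D * h ^ A * Γ * ∑ d ∈ range (A + 1), η ^ d := by rw [mul_sum]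
          _ ≤ K * D * h ^ A * Γ * (1 / (1 - η)) := by
              gcongr
              exact sum_range_pow_le hη hη1 _
          _ = 1 * h ^ b * (D' * h ^ a N) := by rw [hA, pow_add, hD'def]; ring
          _ ≤ _ := by
              gcongr
              exact one_le_geomProd hα hη b
    have hterm : ∀ k ∈ range (M + 1), ∑ f ∈ seqs M N, ‖row w a (f.update N k) (N + 1) b‖
        * seqWeight D σ (N + 1) (f.update N k) ≤ if k ≤ A then W * Y (A - k) else 0 := by
      intro k _
      simp only [row, Finsupp.coe_update, row_update_top, Function.update_self,
        seqWeight_succ_update]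
      split_ifs with hk
      · have hAk : A - (A - k) = k := by omega
        simp only [hY, hAk]
        calc _ = ‖w N (a N) b k (a N + b - k)‖ * siteWeight D h k
              * ∑ f ∈ seqs M N, ‖row w a f N (a N + b - k)‖ * seqWeight D σ N f := by
              rw [mul_sum]
              exact sum_congr rfl fun f _ => by rw [norm_mul]; ring
          _ ≤ ‖w N (a N) b k (a N + b - k)‖ * siteWeight D h k
              * (geomProd α η (a N + b - k) * H ^ (a N + b - k) * W) := by
              have := siteWeight_pos hD hhpos k
              gcongr
              exact ih _
          _ = _ := by ring
      · simp
    rw [sum_seqs_succ]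
    calc _ ≤ ∑ k ∈ range (M + 1), if k ≤ A then W * Y (A - k) else 0 := sum_le_sum hterm
      _ = ∑ k ∈ (range (M + 1)).filter (· ≤ A), W * Y (A - k) := (sum_filter _ _).symm
      _ ≤ ∑ k ∈ range (A + 1), W * Y (A - k) := by
          refine sum_le_sum_of_subset_of_nonneg (fun k hk => ?_) fun k _ _ =>
            mul_nonneg hW.le (hY0 _)
          rw [mem_filter] at hk
          exact mem_range.2 (Nat.lt_succ_of_le hk.2)
      _ = W * ∑ d ∈ range (A + 1), Y d := by rw [← mul_sum, sum_flip]
      _ ≤ W * (geomProd α η b * h ^ b * siteWeight D' h (a N)) := by gcongr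
      _ = _ := by rw [seqWeight, prod_range_succ]; simp only [W, seqWeight]; ring

/-- Weight of a partition. -/
noncomputable def diagWeight (D : ℝ) (σ : ℕ → ℝ) (κ : YoungDiagram) : ℝ :=
  seqWeight D σ (κ.colLen 0) (colMult κ)

theorem prod_colMult_eq {A : Type*} [CommMonoid A] (θ : ℕ → ℕ → A) (hθ : ∀ i, θ i 0 = 1)
    {κ : YoungDiagram} {N : ℕ} (h : κ.colLen 0 ≤ N) :
    ∏ i ∈ range (κ.colLen 0), θ i (colMult κ i) = ∏ i ∈ range N, θ i (colMult κ i) := by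
  refine prod_subset (range_subset_range.2 h) fun i _ hi => ?_
  rw [colMult_eq_zero (by simpa using hi), hθ]

theorem diagWeight_eq {D : ℝ} {σ : ℕ → ℝ} {κ : YoungDiagram} {N : ℕ} (h : κ.colLen 0 ≤ N) :
    diagWeight D σ κ = seqWeight D σ N (colMult κ) :=
  prod_colMult_eq (fun i k => siteWeight D (∏ j ∈ range (i + 1), σ j) k)
    (fun i => by simp [siteWeight]) h

theorem diagWeight_pos {D : ℝ} {σ : ℕ → ℝ} (hD : 1 ≤ D) (hσ : ∀ i, 0 < σ i) (κ : YoungDiagram) :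
    0 < diagWeight D σ κ := seqWeight_pos hD hσ _ _

/-- The constant `D'` is chosen before the weights `w`, so the bound is uniform in the spectral
parameter; this uniformity gives analyticity of the pairing. -/
theorem exists_sum_mat_mul_diagWeight_le {σ : ℕ → ℝ} {η K D : ℝ}
    (hσ : ∀ i, 0 < σ i) (hη : 0 ≤ η) (hη1 : η < 1) (hK : 1 ≤ K) (hD : 1 ≤ D) :
    ∃ D', 1 ≤ D' ∧ ∀ w : ℕ → ℕ → ℕ → ℕ → ℕ → ℂ, IsBounded w σ η K → (∀ i, w i 0 0 0 0 = 1) →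
      ∀ κ, ∑ ν ∈ below κ, ‖mat w κ ν‖ * diagWeight D σ ν ≤ diagWeight D' σ κ := by
  refine ⟨K * D * Real.exp (K * D / (1 - η) * (1 / (1 - η))) * (1 / (1 - η)), ?_,
    fun w hw hw0 κ => ?_⟩
  · have h1η : 0 < 1 - η := by linarith
    have h1 : 1 ≤ 1 / (1 - η) := by rw [le_div_iff₀ h1η]; linarith
    have h2 : 1 ≤ Real.exp (K * D / (1 - η) * (1 / (1 - η))) := Real.one_le_exp (by positivity)
    exact one_le_mul_of_one_le_of_one_le (one_le_mul_of_one_le_of_one_le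
      (one_le_mul_of_one_le_of_one_le hK hD) h2) h1
  · have key := sum_row_mul_seqWeight_le hσ hη hη1 hK hD hw (colMult κ) (κ.rowLen 0) (κ.colLen 0) 0
    rw [pow_zero, mul_one, geomProd, prod_range_zero, one_mul] at key
    refine le_trans ?_ key
    have hsub := below_subset_box κ le_rfl le_rfl
    have hbox := sum_box (κ.rowLen 0) (κ.colLen 0) fun ν =>
      ‖row w (colMult κ) (colMult ν) (κ.colLen 0) 0‖ * seqWeight D σ (κ.colLen 0) (colMult ν)
    simp only [colMult_symm_apply] at hbox
    rw [← hbox]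
    refine le_trans (le_of_eq (sum_congr rfl fun ν hν => ?_)) (sum_le_sum_of_subset_of_nonneg hsub
      fun ν _ _ => mul_nonneg (norm_nonneg _) (seqWeight_pos hD hσ _ _).le)
    have hle := colLen_mono (mem_below.1 hν)
    rw [mat_eq_row hw0 le_rfl hle, diagWeight_eq hle]

end QWhittaker


namespace QWhittaker

open Finset

/-! ### Bounds for the site weights -/

/-- With `α = 2 / (1 - Q)` and `z = Q ^ c ≤ 1`, one has `(1 - zQ)(1 + αz) ≥ 1 + z (α(1 - Q) - Q) = 1
+ z (2 - Q) ≥ 1 + z`. This is the common growth step for the vertex weights and the pairing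
coefficients. -/
theorem geomProd_step {Q : ℝ} (hQ : 0 ≤ Q) (hQ1 : Q < 1) (c : ℕ) :
    (1 + Q ^ c) * geomProd (2 / (1 - Q)) Q c
      ≤ (1 - Q ^ (c + 1)) * geomProd (2 / (1 - Q)) Q (c + 1) := by
  have h1 : 0 < 1 - Q := by linarith
  have hα : 2 / (1 - Q) * (1 - Q) = 2 := div_mul_cancel₀ _ h1.ne'
  have hα0 : 0 ≤ 2 / (1 - Q) := by positivity
  have hz0 : 0 ≤ Q ^ c := by positivity
  have hz1 : Q ^ c ≤ 1 := pow_le_one₀ hQ hQ1.le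
  have hG := geomProd_pos hα0 hQ c
  rw [geomProd_succ, pow_succ]
  set α := 2 / (1 - Q)
  set z := Q ^ c
  have key : 1 + z ≤ (1 - z * Q) * (1 + α * z) := by
    have h2 : α * Q * z ≤ α * Q := mul_le_of_le_one_right (by positivity) hz1
    nlinarith [mul_nonneg hz0 (sub_nonneg.2 h2)]
  calc (1 + z) * geomProd α Q c ≤ ((1 - z * Q) * (1 + α * z)) * geomProd α Q c := by gcongr
    _ = _ := by ring

theorem norm_one_sub_le {Q : ℝ} {a q : ℂ} (ha : ‖a‖ ≤ 1) (hq : ‖q‖ = Q) (c : ℕ) :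
    ‖1 - a * q ^ c‖ ≤ 1 + Q ^ c := by
  calc ‖1 - a * q ^ c‖ ≤ ‖(1 : ℂ)‖ + ‖a * q ^ c‖ := norm_sub_le _ _
    _ ≤ 1 + Q ^ c := by
      rw [norm_one, norm_mul, norm_pow, hq]
      have : 0 ≤ Q ^ c := by rw [← hq]; positivity
      gcongr
      exact mul_le_of_le_one_left this ha

/-- The recursion in `b`, and the `q`-Pascal rule at `b = 0`, have the same shape `(1 - a q^c) W₁ +
z q^(c+1) W₂` with `|a| ≤ 1` and `|z| ≤ S`. The bound `geomProd · c * S ^ d` reproduces itself under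
this step, and so is independent of `b`. -/
theorem norm_wt_le_geomProd {q x u v : ℂ} {S : ℝ} (hq : ‖q‖ < 1) (hu : ‖u‖ ≤ 1) (hv : ‖v‖ ≤ 1)
    (hvS : ‖v‖ ≤ S) (hxS : ‖x‖ ≤ S) (hS : S ≤ 1) (b c d : ℕ) :
    ‖wt q x u v b c d‖ ≤ geomProd (2 / (1 - ‖q‖)) ‖q‖ c * S ^ d := by
  set Q := ‖q‖ with hQ
  have hQ0 : 0 ≤ Q := norm_nonneg q
  have hS0 : 0 ≤ S := (norm_nonneg v).trans hvS
  have hα : 0 ≤ 2 / (1 - Q) := div_nonneg zero_le_two (by linarith)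
  have hG : ∀ c, 0 < geomProd (2 / (1 - Q)) Q c := geomProd_pos hα hQ0
  have hux : ‖u * x‖ ≤ 1 := by
    rw [norm_mul]
    exact mul_le_one₀ hu (norm_nonneg _) (hxS.trans hS)
  have huv : ‖u * v‖ ≤ 1 := by
    rw [norm_mul]
    exact mul_le_one₀ hu (norm_nonneg _) hv
  have hstep : ∀ (a z W₁ W₂ : ℂ) (c d : ℕ), ‖a‖ ≤ 1 → ‖z‖ ≤ S →
      ‖W₁‖ ≤ geomProd (2 / (1 - Q)) Q c * S ^ (d + 1) →
      ‖W₂‖ ≤ geomProd (2 / (1 - Q)) Q (c + 1) * S ^ d →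
      ‖(1 - a * q ^ c) * W₁ + z * q ^ (c + 1) * W₂‖
        ≤ geomProd (2 / (1 - Q)) Q (c + 1) * S ^ (d + 1) := by
    intro a z W₁ W₂ c d ha hz h1 h2
    calc _ ≤ ‖1 - a * q ^ c‖ * ‖W₁‖ + ‖z‖ * Q ^ (c + 1) * ‖W₂‖ := by
          refine (norm_add_le _ _).trans (le_of_eq ?_)
          rw [norm_mul, norm_mul, norm_mul, norm_pow]
      _ ≤ (1 + Q ^ c) * (geomProd (2 / (1 - Q)) Q c * S ^ (d + 1))
          + S * Q ^ (c + 1) * (geomProd (2 / (1 - Q)) Q (c + 1) * S ^ d) := by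
          gcongr
          exact norm_one_sub_le ha rfl c
      _ ≤ _ := by
          have := mul_le_mul_of_nonneg_right (geomProd_step hQ0 hq c) (pow_nonneg hS0 (d + 1))
          rw [pow_succ S] at this ⊢
          linarith
  have hstep0 : ∀ (a W : ℂ) (c : ℕ), ‖a‖ ≤ 1 → ‖W‖ ≤ geomProd (2 / (1 - Q)) Q c →
      ‖(1 - a * q ^ c) * W‖ ≤ geomProd (2 / (1 - Q)) Q (c + 1) := by
    intro a W c ha h1
    rw [norm_mul]
    calc _ ≤ (1 + Q ^ c) * geomProd (2 / (1 - Q)) Q c := by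
          gcongr
          exact norm_one_sub_le ha rfl c
      _ ≤ _ := (geomProd_step hQ0 hq c).trans
          (mul_le_of_le_one_left (hG _).le (sub_le_self _ (by positivity)))
  induction b generalizing c d with
  | zero =>
    induction c generalizing d with
    | zero =>
      simp only [wt_zero, qPoch_zero, qBinom_zero_right hq, mul_one, geomProd, prod_range_zero,
        one_mul, norm_pow]
      gcongr
    | succ c ihc =>
      induction d with
      | zero =>
        have : wt q x u v 0 (c + 1) 0 = (1 - u * x * q ^ c) * wt q x u v 0 c 0 := by
          simp only [wt_zero, add_zero, qBinom_self hq, qPoch_succ]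
          ring
        rw [this, pow_zero, mul_one]
        exact hstep0 _ _ _ hux (by simpa using ihc 0)
      | succ d ihd =>
        rw [wt_zero_pascal hq]
        exact hstep _ _ _ _ _ _ hux hxS (ihc _) ihd
  | succ b ih =>
    rcases c with _ | c <;> rcases d with _ | d
    · rw [wt_succ_zero_zero, norm_zero]
      have := hG 0
      positivity
    · rw [wt_succ_zero_succ, norm_mul, pow_succ, ← mul_assoc, mul_comm]
      have := ih 0 d
      have := (hG 0).le
      gcongr
    · rw [wt_succ_succ_zero, pow_zero, mul_one]
      exact hstep0 _ _ _ huv (by simpa using ih c 0)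
    · rw [wt_succ_succ_succ]
      exact hstep _ _ _ _ _ _ huv hvS (ih _ _) (ih _ _)

/-- A bound for the site weights of the rows of `transfer`. -/
noncomputable def boundT (q : ℂ) : ℝ := Real.exp (2 / (1 - ‖q‖) * (1 / (1 - ‖q‖)))

theorem one_le_boundT {q : ℂ} (hq : ‖q‖ < 1) : 1 ≤ boundT q := by
  have : 0 < 1 - ‖q‖ := by linarith
  exact Real.one_le_exp (by positivity)

theorem geomProd_le_boundT {q : ℂ} (hq : ‖q‖ < 1) (c : ℕ) :
    geomProd (2 / (1 - ‖q‖)) ‖q‖ c ≤ boundT q :=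
  geomProd_le (div_nonneg zero_le_two (by linarith)) (norm_nonneg _) hq c

theorem isBounded_tWeight {q x : ℂ} {u v : ℕ → ℂ} {σ : ℕ → ℝ} {η : ℝ} (hq : ‖q‖ < 1)
    (hu : ∀ i, ‖u i‖ ≤ 1) (hv : ∀ i, ‖v i‖ ≤ 1) (hx : ‖x‖ ≤ 1)
    (hσ : ∀ i, max ‖v i‖ ‖x‖ ≤ η * σ i) :
    IsBounded (tWeight q x u v) σ η (boundT q) where
  le i a b c d _ := by
    have h1 := norm_wt_le_geomProd hq (hu i) (hv i) (le_max_left ‖v i‖ ‖x‖)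
      (le_max_right ‖v i‖ ‖x‖) (max_le (hv i) hx) b c d
    have h0 : 0 ≤ max ‖v i‖ ‖x‖ := (norm_nonneg x).trans (le_max_right _ _)
    refine h1.trans ?_
    have := geomProd_le_boundT hq c
    have := (zero_le_one.trans (one_le_boundT hq))
    gcongr
    exact hσ i
  empty_le i b := by
    have := wt_zero_right (x := x) (u := u i) (v := v i) hq 0 b
    rw [zero_add, pow_zero, mul_one] at this
    rw [tWeight, this, norm_pow]
    gcongr
    exact (le_max_left _ _).trans (hσ i)

theorem tWeight_zero {q x : ℂ} (hq : ‖q‖ < 1) (u v : ℕ → ℂ) (i : ℕ) :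
    tWeight q x u v i 0 0 0 0 = 1 := by
  simp [tWeight, wt_zero, qBinom_self hq]

theorem norm_one_sub_mul_ge {u y : ℂ} {δ : ℝ} (hu : ‖u‖ ≤ 1) (hy : ‖y‖ ≤ δ) :
    1 - δ ≤ ‖1 - u * y‖ := by
  have h1 : ‖u * y‖ ≤ δ := by
    rw [norm_mul]
    exact (mul_le_of_le_one_left (norm_nonneg _) hu).trans hy
  have h2 := norm_sub_norm_le (1 : ℂ) (u * y)
  rw [norm_one] at h2
  linarith

theorem isBounded_lWeight {q y : ℂ} {u v : ℕ → ℂ} {σ : ℕ → ℝ} {η δ : ℝ} (hq : ‖q‖ < 1)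
    (hu : ∀ i, ‖u i‖ ≤ 1) (hv : ∀ i, ‖v i‖ ≤ 1) (hδ : δ < 1) (hy : ‖y‖ ≤ δ)
    (hσ : ∀ i, (‖v i‖ + δ) / (1 - δ) ≤ η * σ i) :
    IsBounded (lWeight q y u v) σ η (2 / (1 - δ)) := by
  have h1δ : 0 < 1 - δ := by linarith
  have hδ0 : 0 ≤ δ := (norm_nonneg y).trans hy
  have hqa : ∀ a : ℕ, ‖q ^ a‖ ≤ 1 := fun a => by
    rw [norm_pow]; exact pow_le_one₀ (norm_nonneg _) hq.le
  have hησ : ∀ i, 0 ≤ η * σ i := fun i => le_trans (by positivity) (hσ i)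
  have hden := fun i => norm_one_sub_mul_ge (hu i) hy
  have hdiv : ∀ i (z : ℂ) (B : ℝ), ‖z‖ ≤ B → ‖z / (1 - u i * y)‖ ≤ B / (1 - δ) := by
    intro i z B hz
    rw [norm_div]
    have h0 : 0 ≤ B := (norm_nonneg z).trans hz
    exact div_le_div₀ h0 hz h1δ (hden i)
  have h1sub : ∀ z : ℂ, ‖z‖ ≤ 1 → ‖1 - z‖ ≤ 2 := fun z hz =>
    (norm_sub_le _ _).trans (by rw [norm_one]; linarith)
  have h11 : ∀ i a, ‖lw q y (u i) (v i) a 1 1‖ ≤ η * σ i := by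
    intro i a
    refine (hdiv i _ (‖v i‖ + δ) ?_).trans (hσ i)
    refine (norm_sub_le _ _).trans (add_le_add ?_ hy)
    rw [norm_mul]
    exact mul_le_of_le_one_right (norm_nonneg _) (hqa a)
  have hK1 : 1 ≤ 2 / (1 - δ) := by rw [le_div_iff₀ h1δ]; linarith
  have hnn : ∀ i d, 0 ≤ 2 / (1 - δ) * (η * σ i) ^ d := fun i d =>
    mul_nonneg (by positivity) (pow_nonneg (hησ i) d)
  refine ⟨fun i a b c d _ => ?_, fun i b => ?_⟩
  · rw [lWeight]
    match b, d with
    | 0, 0 =>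
      rw [pow_zero, mul_one]
      refine hdiv i _ _ (h1sub _ ?_)
      rw [norm_mul, norm_mul]
      exact mul_le_one₀ (mul_le_one₀ (hu i) (norm_nonneg _) (hy.trans hδ.le)) (norm_nonneg _) (hqa a)
    | 1, 0 =>
      rw [pow_zero, mul_one]
      refine hdiv i _ _ (h1sub _ ?_)
      rw [norm_mul, norm_mul]
      exact mul_le_one₀ (mul_le_one₀ (hu i) (norm_nonneg _) (hv i)) (norm_nonneg _) (hqa a)
    | 0, 1 =>
      rw [pow_one]
      refine (hdiv i _ (2 * δ) ?_).trans ?_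
      · rw [norm_neg, norm_mul, mul_comm 2]
        gcongr
        exact h1sub _ (hqa a)
      · rw [mul_div_right_comm]
        gcongr
        refine le_trans ?_ (hσ i)
        rw [le_div_iff₀ h1δ]
        have := norm_nonneg (v i)
        nlinarith
    | 1, 1 =>
      rw [pow_one]
      exact (h11 i a).trans (le_mul_of_one_le_left (hησ i) hK1)
    | 0, d + 2 => rw [lw_of_two_le _ _ _ _ _ _ _ (by omega), norm_zero]; exact hnn i _
    | 1, d + 2 => rw [lw_of_two_le _ _ _ _ _ _ _ (by omega), norm_zero]; exact hnn i _
    | b + 2, d => rw [show lw q y (u i) (v i) a (b + 2) d = 0 from rfl, norm_zero]; exact hnn i _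
  · rw [lWeight]
    match b with
    | 0 =>
      have : 1 - u i * y ≠ 0 := norm_pos_iff.1 (h1δ.trans_le (hden i))
      simp [lw, this]
    | 1 => rw [pow_one]; exact h11 i 0
    | b + 2 =>
      rw [lw_of_two_le _ _ _ _ _ _ _ (by omega), norm_zero]
      exact pow_nonneg (hησ i) _

theorem lWeight_zero {q y : ℂ} {u v : ℕ → ℂ} {i : ℕ} (hy : 1 - u i * y ≠ 0) :
    lWeight q y u v i 0 0 0 0 = 1 := by
  simp [lWeight, lw, hy]

/-! ### The coefficients of the pairing -/

/-- The factor of `cCoeff` at a site. -/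
noncomputable def siteCoeff (q : ℂ) (u v : ℕ → ℂ) (i k : ℕ) : ℂ :=
  qPoch (u i * v i) q k / qPoch q q k

theorem siteCoeff_zero (q : ℂ) (u v : ℕ → ℂ) (i : ℕ) : siteCoeff q u v i 0 = 1 := by
  simp [siteCoeff]

theorem siteCoeff_ne_zero {q : ℂ} {u v : ℕ → ℂ} (hq : ‖q‖ < 1) (huv : ∀ i, ‖u i * v i‖ < 1)
    (i k : ℕ) : siteCoeff q u v i k ≠ 0 :=
  div_ne_zero (qPoch_ne_zero (huv i) hq k) (qPoch_ne_zero hq hq k)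

theorem siteCoeff_succ {q : ℂ} (u v : ℕ → ℂ) (hq : ‖q‖ < 1) (i k : ℕ) :
    siteCoeff q u v i (k + 1) * (1 - q ^ (k + 1))
      = siteCoeff q u v i k * (1 - u i * v i * q ^ k) := by
  have h1 := qPoch_ne_zero hq hq k
  have h2 := one_sub_pow_succ_ne_zero hq k
  rw [siteCoeff, siteCoeff, qPoch_succ, qPoch_succ, ← pow_succ']
  field_simp

theorem norm_siteCoeff_le {q : ℂ} {u v : ℕ → ℂ} (hq : ‖q‖ < 1) (huv : ∀ i, ‖u i * v i‖ < 1)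
    (i k : ℕ) : ‖siteCoeff q u v i k‖ ≤ boundT q := by
  refine le_trans ?_ (geomProd_le_boundT hq k)
  induction k with
  | zero => simp [siteCoeff_zero, geomProd]
  | succ k ih =>
    have h1 := congrArg norm (siteCoeff_succ u v hq i k)
    rw [norm_mul, norm_mul] at h1
    have h2 : 1 - ‖q‖ ^ (k + 1) ≤ ‖1 - q ^ (k + 1)‖ := by
      have := norm_sub_norm_le (1 : ℂ) (q ^ (k + 1))
      rwa [norm_one, norm_pow] at this
    have h3 : 0 < 1 - ‖q‖ ^ (k + 1) :=
      sub_pos.2 (pow_lt_one₀ (norm_nonneg _) hq (Nat.succ_ne_zero _))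
    have h4 := norm_one_sub_le (huv i).le (q := q) rfl k
    have h5 := geomProd_step (norm_nonneg q) hq k
    have h6 : ‖siteCoeff q u v i (k + 1)‖ * (1 - ‖q‖ ^ (k + 1))
        ≤ geomProd (2 / (1 - ‖q‖)) ‖q‖ (k + 1) * (1 - ‖q‖ ^ (k + 1)) := by
      calc _ ≤ ‖siteCoeff q u v i (k + 1)‖ * ‖1 - q ^ (k + 1)‖ := by gcongr
        _ = ‖siteCoeff q u v i k‖ * ‖1 - u i * v i * q ^ k‖ := h1
        _ ≤ geomProd (2 / (1 - ‖q‖)) ‖q‖ k * (1 + ‖q‖ ^ k) := by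
            have := (norm_nonneg _).trans ih
            gcongr
        _ ≤ _ := by linarith
    exact le_of_mul_le_mul_right h6 h3

/-- The coefficient `c_{κ'}`. -/
noncomputable def coeff (q : ℂ) (u v : ℕ → ℂ) (κ : YoungDiagram) : ℂ :=
  ∏ i ∈ range (κ.colLen 0), siteCoeff q u v i (colMult κ i)

theorem cCoeff_transpose (q : ℂ) (u v : ℕ → ℂ) (κ : YoungDiagram) :
    cCoeff q u v κ.transpose = coeff q u v κ := by
  rw [cCoeff, coeff, YoungDiagram.rowLen_transpose]
  exact prod_congr rfl fun i _ => by rw [mult_transpose, siteCoeff, colMult_apply]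

theorem coeff_eq {q : ℂ} {u v : ℕ → ℂ} {κ : YoungDiagram} {N : ℕ} (h : κ.colLen 0 ≤ N) :
    coeff q u v κ = ∏ i ∈ range N, siteCoeff q u v i (colMult κ i) :=
  prod_colMult_eq _ (siteCoeff_zero q u v) h

theorem coeff_ne_zero {q : ℂ} {u v : ℕ → ℂ} (hq : ‖q‖ < 1) (huv : ∀ i, ‖u i * v i‖ < 1)
    (κ : YoungDiagram) : coeff q u v κ ≠ 0 :=
  prod_ne_zero_iff.2 fun i _ => siteCoeff_ne_zero hq huv i _

/-! ### Sums of products over partitions -/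

theorem sum_seqs_prod {A : Type*} [CommSemiring A] (θ : ℕ → ℕ → A) (M N : ℕ) :
    ∑ f ∈ seqs M N, ∏ i ∈ range N, θ i (f i) = ∏ i ∈ range N, ∑ k ∈ range (M + 1), θ i k := by
  induction N with
  | zero => rw [sum_seqs_zero, prod_range_zero, prod_range_zero]
  | succ N ih =>
    rw [sum_seqs_succ, prod_range_succ, ← ih, mul_comm, sum_mul]
    refine sum_congr rfl fun k _ => ?_
    rw [mul_sum]
    refine sum_congr rfl fun f _ => ?_
    rw [Finsupp.coe_update, prod_range_succ, Function.update_self, mul_comm]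
    congr 1
    exact prod_congr rfl fun i hi => by rw [Function.update_of_ne (mem_range.1 hi).ne]

theorem sum_box_prod {A : Type*} [CommSemiring A] (θ : ℕ → ℕ → A) (hθ : ∀ i, θ i 0 = 1) (M N : ℕ) :
    ∑ κ ∈ box M N, ∏ i ∈ range (κ.colLen 0), θ i (colMult κ i)
      = ∏ i ∈ range N, ∑ k ∈ range (M + 1), θ i k := by
  rw [← sum_seqs_prod]
  have := sum_box M N fun κ => ∏ i ∈ range N, θ i (colMult κ i)
  simp only [colMult_symm_apply] at this
  rw [← this]
  exact sum_congr rfl fun κ hκ => prod_colMult_eq θ hθ (mem_box.1 hκ).1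

theorem summable_of_sum_box_le {F : YoungDiagram → ℝ} (hF : ∀ κ, 0 ≤ F κ) (B : ℝ)
    (h : ∀ N, ∑ κ ∈ box N N, F κ ≤ B) : Summable F := by
  refine summable_of_sum_le (c := B) hF fun s => ?_
  obtain ⟨N, hN⟩ := (tendsto_box.eventually (Filter.eventually_ge_atTop s)).exists
  exact (sum_le_sum_of_subset_of_nonneg hN fun κ _ _ => hF κ).trans (h N)

/-- Sums over a box factor into products over the sites; the factor at site `i` is `1 + O(ρ ^ i)`,
so the products stay bounded. -/
theorem summable_prod_of_le {θ : ℕ → ℕ → ℝ} (hθ : ∀ i, θ i 0 = 1) (hθ0 : ∀ i k, 0 ≤ θ i k)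
    {C ρ : ℝ} (hC : 0 ≤ C) (hρ : 0 ≤ ρ) (hρ1 : ρ < 1) (h : ∀ i k, θ i (k + 1) ≤ C * ρ ^ i * ρ ^ k) :
    Summable fun κ : YoungDiagram => ∏ i ∈ range (κ.colLen 0), θ i (colMult κ i) := by
  refine summable_of_sum_box_le (fun κ => prod_nonneg fun i _ => hθ0 i _)
    (Real.exp (C * (1 / (1 - ρ)) * (1 / (1 - ρ)))) fun N => ?_
  rw [sum_box_prod θ hθ]
  have h1ρ : 0 < 1 - ρ := by linarith
  refine le_trans (prod_le_prod (fun i _ => sum_nonneg fun k _ => hθ0 i k) fun i _ => ?_)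
    (geomProd_le (α := C * (1 / (1 - ρ))) (by positivity) hρ hρ1 N)
  rw [sum_range_succ', hθ, add_comm]
  gcongr
  calc ∑ k ∈ range N, θ i (k + 1) ≤ ∑ k ∈ range N, C * ρ ^ i * ρ ^ k := sum_le_sum fun k _ => h i k
    _ = C * ρ ^ i * ∑ k ∈ range N, ρ ^ k := by rw [mul_sum]
    _ ≤ C * ρ ^ i * (1 / (1 - ρ)) := by
        gcongr
        exact sum_range_pow_le hρ hρ1 N
    _ = _ := by ring

/-- A column of length `i + 1` costs at most `ρ ^ (i + 1)` in the product of the two weights,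
whatever the constants `D` and `E`. -/
theorem summable_coeff_mul_diagWeight {q : ℂ} {u v : ℕ → ℂ} {σ τ : ℕ → ℝ} {ρ D E : ℝ} (hq : ‖q‖ < 1)
    (huv : ∀ i, ‖u i * v i‖ < 1) (hσ : ∀ i, 0 < σ i) (hτ : ∀ i, 0 < τ i) (hρ1 : ρ < 1)
    (h : ∀ i, σ i * τ i ≤ ρ) (hD : 1 ≤ D) (hE : 1 ≤ E) :
    Summable fun κ => ‖coeff q u v κ‖ * (diagWeight D σ κ * diagWeight E τ κ) := by
  have hρ : 0 < ρ := (mul_pos (hσ 0) (hτ 0)).trans_le (h 0)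
  have hB := one_le_boundT hq
  have hpos : ∀ {σ : ℕ → ℝ}, (∀ i, 0 < σ i) → ∀ i, 0 < ∏ j ∈ range (i + 1), σ j :=
    fun hσ i => prod_pos fun j _ => hσ j
  have := summable_prod_of_le (ρ := ρ) (C := boundT q * D * E) (θ := fun i k => ‖siteCoeff q u v i k‖
    * (siteWeight D (∏ j ∈ range (i + 1), σ j) k * siteWeight E (∏ j ∈ range (i + 1), τ j) k))
    (fun i => by simp [siteCoeff_zero, siteWeight])
    (fun i k => mul_nonneg (norm_nonneg _) (mul_nonneg (siteWeight_pos hD (hpos hσ i) k).le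
      (siteWeight_pos hE (hpos hτ i) k).le)) (by positivity) hρ.le hρ1 fun i k => ?_
  · refine this.congr fun κ => ?_
    rw [coeff, diagWeight, diagWeight, seqWeight, seqWeight, norm_prod, ← prod_mul_distrib,
      ← prod_mul_distrib]
  · have hle : (∏ j ∈ range (i + 1), σ j) * (∏ j ∈ range (i + 1), τ j) ≤ ρ ^ (i + 1) := by
      rw [← prod_mul_distrib]
      calc _ ≤ ∏ j ∈ range (i + 1), ρ :=
            prod_le_prod (fun j _ => (mul_pos (hσ j) (hτ j)).le) fun j _ => h j
        _ = _ := by rw [prod_const, card_range]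
    have h0 := mul_pos (hpos hσ i) (hpos hτ i)
    have hpow : ((∏ j ∈ range (i + 1), σ j) * (∏ j ∈ range (i + 1), τ j)) ^ (k + 1)
        ≤ ρ ^ i * ρ ^ k := by
      calc _ ≤ (ρ ^ (i + 1)) ^ (k + 1) := by gcongr
        _ = ρ ^ (i + k + (1 + i * k)) := by rw [← pow_mul]; congr 1; ring
        _ ≤ ρ ^ (i + k) := pow_le_pow_of_le_one hρ.le hρ1.le (Nat.le_add_right _ _)
        _ = _ := pow_add _ _ _
    simp only [siteWeight, Nat.succ_ne_zero, if_false]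
    calc _ ≤ boundT q * (D * (∏ j ∈ range (i + 1), σ j) ^ (k + 1)
          * (E * (∏ j ∈ range (i + 1), τ j) ^ (k + 1))) := by
          have := hpos hσ i
          have := hpos hτ i
          gcongr
          exact norm_siteCoeff_le hq huv i _
      _ = boundT q * D * E * ((∏ j ∈ range (i + 1), σ j) * (∏ j ∈ range (i + 1), τ j)) ^ (k + 1) := by
          rw [mul_pow]; ring
      _ ≤ boundT q * D * E * (ρ ^ i * ρ ^ k) := by gcongr
      _ = _ := by ring

end QWhittaker


namespace QWhittaker

open Finset Filter Topology

/-! ### Lower triangular matrices and their pairing -/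

/-- The product of lower triangular matrices indexed by partitions. -/
noncomputable def matMul (A B : YoungDiagram → YoungDiagram → ℂ) (κ μ : YoungDiagram) : ℂ :=
  ∑ ν ∈ below κ, A κ ν * B ν μ

/-- Lower triangular matrices that act on the weights `diagWeight · σ`. -/
structure IsAdmissible (σ : ℕ → ℝ) (A : YoungDiagram → YoungDiagram → ℂ) : Prop where
  lower : ∀ {κ ν}, ¬ ν ≤ κ → A κ ν = 0
  growth : ∀ D, 1 ≤ D → ∃ D', 1 ≤ D' ∧
    ∀ κ, ∑ ν ∈ below κ, ‖A κ ν‖ * diagWeight D σ ν ≤ diagWeight D' σ κ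

theorem self_mem_below (κ : YoungDiagram) : κ ∈ below κ := mem_below.2 le_rfl

theorem below_subset {κ ν : YoungDiagram} (h : ν ≤ κ) : below ν ⊆ below κ := fun _ hη =>
  mem_below.2 ((mem_below.1 hη).trans h)

section admissible

variable {σ τ : ℕ → ℝ} {A B B₁ B₂ : YoungDiagram → YoungDiagram → ℂ}

/-- Each column of an admissible matrix is dominated by a weight: keep a single term of the growth
bound. -/
theorem IsAdmissible.norm_le (hA : IsAdmissible σ A) (hσ : ∀ i, 0 < σ i) (ν : YoungDiagram) :
    ∃ C D, 0 ≤ C ∧ 1 ≤ D ∧ ∀ κ, ‖A κ ν‖ ≤ C * diagWeight D σ κ := by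
  obtain ⟨D, hD, h⟩ := hA.growth 1 le_rfl
  have hpos := diagWeight_pos (le_refl (1 : ℝ)) hσ
  refine ⟨(diagWeight 1 σ ν)⁻¹, D, (inv_pos.2 (hpos ν)).le, hD, fun κ => ?_⟩
  rw [inv_mul_eq_div, le_div_iff₀ (hpos ν)]
  by_cases hν : ν ≤ κ
  · refine le_trans ?_ (h κ)
    exact single_le_sum (f := fun ν => ‖A κ ν‖ * diagWeight 1 σ ν)
      (fun η _ => mul_nonneg (norm_nonneg _) (hpos η).le) (mem_below.2 hν)
  · rw [hA.lower hν, norm_zero, zero_mul]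
    exact (diagWeight_pos hD hσ κ).le

theorem IsAdmissible.mul (hσ : ∀ i, 0 < σ i) (hA : IsAdmissible σ A) (hB : IsAdmissible σ B) :
    IsAdmissible σ (matMul A B) where
  lower {κ μ} h := sum_eq_zero fun ν hν => by
    rw [hB.lower fun h' => h (h'.trans (mem_below.1 hν)), mul_zero]
  growth D hD := by
    obtain ⟨D₁, hD₁, h₁⟩ := hB.growth D hD
    obtain ⟨D₂, hD₂, h₂⟩ := hA.growth D₁ hD₁
    refine ⟨D₂, hD₂, fun κ => le_trans ?_ (h₂ κ)⟩
    calc ∑ μ ∈ below κ, ‖matMul A B κ μ‖ * diagWeight D σ μ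
        ≤ ∑ μ ∈ below κ, ∑ ν ∈ below κ, ‖A κ ν‖ * (‖B ν μ‖ * diagWeight D σ μ) := by
          refine sum_le_sum fun μ _ => ?_
          rw [matMul]
          calc _ ≤ (∑ ν ∈ below κ, ‖A κ ν * B ν μ‖) * diagWeight D σ μ := by
                exact mul_le_mul_of_nonneg_right (norm_sum_le _ _) (diagWeight_pos hD hσ μ).le
            _ = _ := by
                rw [sum_mul]
                exact sum_congr rfl fun ν _ => by rw [norm_mul]; ring
      _ = ∑ ν ∈ below κ, ‖A κ ν‖ * ∑ μ ∈ below κ, ‖B ν μ‖ * diagWeight D σ μ := by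
          rw [sum_comm]
          exact sum_congr rfl fun ν _ => by rw [mul_sum]
      _ ≤ ∑ ν ∈ below κ, ‖A κ ν‖ * diagWeight D₁ σ ν := by
          refine sum_le_sum fun ν hν => ?_
          gcongr
          refine le_trans (le_of_eq ?_) (h₁ ν)
          symm
          refine sum_subset (below_subset (mem_below.1 hν)) fun μ _ hμ => ?_
          rw [hB.lower fun h => hμ (mem_below.2 h), norm_zero, zero_mul]

open Classical in
/-- The identity matrix. -/
noncomputable def idMat (κ μ : YoungDiagram) : ℂ := if κ = μ then 1 else 0

theorem idMat_self (κ : YoungDiagram) : idMat κ κ = 1 := if_pos rfl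

theorem idMat_of_ne {κ μ : YoungDiagram} (h : κ ≠ μ) : idMat κ μ = 0 := if_neg h

theorem isAdmissible_one : IsAdmissible σ idMat where
  lower {κ ν} h := idMat_of_ne fun h' => h h'.ge
  growth D hD := ⟨D, hD, fun κ => le_of_eq <| by
    rw [sum_eq_single_of_mem κ (self_mem_below κ)]
    · rw [idMat_self, norm_one, one_mul]
    · intro ν _ hν
      rw [idMat_of_ne (Ne.symm hν), norm_zero, zero_mul]⟩

theorem isAdmissible_mat {w : ℕ → ℕ → ℕ → ℕ → ℕ → ℂ} {η K : ℝ} (hσ : ∀ i, 0 < σ i) (hη : 0 ≤ η)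
    (hη1 : η < 1) (hK : 1 ≤ K) (hw : IsBounded w σ η K) (hw0 : ∀ i, w i 0 0 0 0 = 1) :
    IsAdmissible σ (mat w) where
  lower := mat_eq_zero
  growth D hD := by
    obtain ⟨D', hD', h⟩ := exists_sum_mat_mul_diagWeight_le hσ hη hη1 hK hD
    exact ⟨D', hD', h w hw hw0⟩

/-- `A` and `B` commute up to the factor `z` when `A` is transposed with respect to the pairing with
coefficients `c`. -/
def IsDual (c : YoungDiagram → ℂ) (A B : YoungDiagram → YoungDiagram → ℂ) (z : ℂ) : Prop :=
  ∀ ν η, HasSum (fun κ => c κ * A κ ν * B κ η)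
    (z * ∑ κ ∈ below ν, c ν * c η / c κ * A η κ * B ν κ)

/-- Coefficients for which the pairing of admissible matrices converges. -/
def IsPairing (c : YoungDiagram → ℂ) (σ τ : ℕ → ℝ) : Prop :=
  (∀ κ, c κ ≠ 0) ∧ (∀ i, 0 < σ i) ∧ (∀ i, 0 < τ i) ∧
    ∀ D E, 1 ≤ D → 1 ≤ E → Summable fun κ => ‖c κ‖ * (diagWeight D σ κ * diagWeight E τ κ)

variable {c : YoungDiagram → ℂ} {z z₁ z₂ : ℂ}

theorem IsPairing.symm (hc : IsPairing c σ τ) : IsPairing c τ σ :=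
  ⟨hc.1, hc.2.2.1, hc.2.1, fun D E hD hE => (hc.2.2.2 E D hE hD).congr fun κ => by ring⟩

/-- Lower triangularity reduces both finite sums to the partitions contained in `ν ⊓ η`, where they
are visibly symmetric. -/
theorem IsDual.symm (hA : IsAdmissible τ A) (hB : IsAdmissible σ B) (h : IsDual c A B z) :
    IsDual c B A z := by
  intro ν η
  convert h η ν using 1
  · funext κ
    ring
  · congr 1
    have h1 : ∀ ν η : YoungDiagram, ∑ κ ∈ below ν, c ν * c η / c κ * B η κ * A ν κ
        = ∑ κ ∈ below (ν ⊓ η), c ν * c η / c κ * B η κ * A ν κ := by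
      intro ν η
      symm
      refine sum_subset (below_subset inf_le_left) fun κ hκ hκ' => ?_
      rw [hB.lower fun h => hκ' (mem_below.2 (le_inf (mem_below.1 hκ) h))]
      ring
    have h2 : ∑ κ ∈ below η, c η * c ν / c κ * A ν κ * B η κ
        = ∑ κ ∈ below (ν ⊓ η), c η * c ν / c κ * A ν κ * B η κ := by
      symm
      refine sum_subset (below_subset inf_le_right) fun κ hκ hκ' => ?_
      rw [hA.lower fun h => hκ' (mem_below.2 (le_inf h (mem_below.1 hκ)))]
      ring
    rw [h1, h2]
    exact sum_congr rfl fun κ _ => by ring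

theorem summable_pairing (hc : IsPairing c σ τ) (hA : IsAdmissible τ A) (hB : IsAdmissible σ B)
    (ν η : YoungDiagram) : Summable fun κ => c κ * A κ ν * B κ η := by
  obtain ⟨C₁, D₁, hC₁, hD₁, h₁⟩ := hA.norm_le hc.2.2.1 ν
  obtain ⟨C₂, D₂, hC₂, hD₂, h₂⟩ := hB.norm_le hc.2.1 η
  refine Summable.of_norm_bounded ((hc.2.2.2 D₂ D₁ hD₂ hD₁).mul_left (C₁ * C₂)) fun κ => ?_
  rw [norm_mul, norm_mul]
  calc _ ≤ ‖c κ‖ * (C₁ * diagWeight D₁ τ κ) * (C₂ * diagWeight D₂ σ κ) := by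
        have := mul_nonneg hC₁ (diagWeight_pos hD₁ hc.2.2.1 κ).le
        gcongr
        · exact h₁ κ
        · exact h₂ κ
    _ = _ := by ring

/-- Fubini for the double sum over `κ` and the intermediate partition. Absolute convergence comes
from the growth bound of `B₁` applied to the columns of `B₂`. The value `S` of the inner pairing is
left arbitrary, because the lemma is also applied where the duality of `A` and `B₂` is not yet
known. -/
theorem hasSum_mul_matMul (hc : IsPairing c σ τ) (hA : IsAdmissible τ A) (hB₁ : IsAdmissible σ B₁)
    (hB₂ : IsAdmissible σ B₂) (h : IsDual c A B₁ z) (lam μ : YoungDiagram) {S : YoungDiagram → ℂ}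
    (hS : ∀ κ, HasSum (fun ν => c ν * A ν κ * B₂ ν μ) (S κ)) :
    HasSum (fun κ => c κ * A κ lam * matMul B₁ B₂ κ μ)
      (z * ∑ κ ∈ below lam, c lam / c κ * B₁ lam κ * S κ) := by
  set F : YoungDiagram × YoungDiagram → ℂ := fun p => c p.1 * A p.1 lam * (B₁ p.1 p.2 * B₂ p.2 μ)
    with hF
  have hfin : ∀ κ ν, ν ∉ below κ → F (κ, ν) = 0 := fun κ ν hν => by
    simp only [hF]
    rw [hB₁.lower fun h => hν (mem_below.2 h)]
    ring
  have hsum : Summable F := by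
    obtain ⟨C₁, D₁, hC₁, hD₁, h₁⟩ := hA.norm_le hc.2.2.1 lam
    obtain ⟨C₂, D₂, hC₂, hD₂, h₂⟩ := hB₂.norm_le hc.2.1 μ
    obtain ⟨D₃, hD₃, h₃⟩ := hB₁.growth D₂ hD₂
    refine Summable.of_norm ?_
    rw [summable_prod_of_nonneg fun p => norm_nonneg _]
    have hfs : ∀ κ, HasSum (fun ν => ‖F (κ, ν)‖) (∑ ν ∈ below κ, ‖F (κ, ν)‖) := fun κ =>
      hasSum_sum_of_ne_finset_zero fun ν hν => by rw [hfin κ ν hν, norm_zero]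
    refine ⟨fun κ => (hfs κ).summable, ?_⟩
    refine Summable.of_nonneg_of_le (fun κ => tsum_nonneg fun ν => norm_nonneg _) (fun κ => ?_)
      ((hc.2.2.2 D₃ D₁ hD₃ hD₁).mul_left (C₁ * C₂))
    rw [(hfs κ).tsum_eq]
    calc ∑ ν ∈ below κ, ‖F (κ, ν)‖
        ≤ ∑ ν ∈ below κ, ‖c κ‖ * (C₁ * diagWeight D₁ τ κ) * C₂
            * (‖B₁ κ ν‖ * diagWeight D₂ σ ν) := by
          refine sum_le_sum fun ν _ => ?_
          simp only [hF, norm_mul]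
          calc _ ≤ ‖c κ‖ * (C₁ * diagWeight D₁ τ κ) * (‖B₁ κ ν‖ * (C₂ * diagWeight D₂ σ ν)) := by
                have := mul_nonneg hC₁ (diagWeight_pos hD₁ hc.2.2.1 κ).le
                gcongr
                · exact h₁ κ
                · exact h₂ ν
            _ = _ := by ring
      _ = ‖c κ‖ * (C₁ * diagWeight D₁ τ κ) * C₂
            * ∑ ν ∈ below κ, ‖B₁ κ ν‖ * diagWeight D₂ σ ν := by rw [mul_sum]
      _ ≤ ‖c κ‖ * (C₁ * diagWeight D₁ τ κ) * C₂ * diagWeight D₃ σ κ := by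
          have := (diagWeight_pos hD₁ hc.2.2.1 κ).le
          gcongr
          exact h₃ κ
      _ = _ := by ring
  have hrows : HasSum (fun κ => c κ * A κ lam * matMul B₁ B₂ κ μ) (∑' p, F p) := by
    refine hsum.hasSum.prod_fiberwise fun κ => ?_
    rw [matMul, mul_sum]
    exact hasSum_sum_of_ne_finset_zero fun ν hν => hfin κ ν hν
  have hcols : HasSum (fun ν => z * ∑ κ ∈ below lam, c lam / c κ * B₁ lam κ
      * (c ν * A ν κ * B₂ ν μ)) (∑' p, F p) := by
    have hswap : HasSum (fun p : YoungDiagram × YoungDiagram => F p.swap) (∑' p, F p) :=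
      (Equiv.prodComm YoungDiagram YoungDiagram).hasSum_iff.2 hsum.hasSum
    refine hswap.prod_fiberwise fun ν => ?_
    have h1 := (h lam ν).mul_right (B₂ ν μ)
    have e1 : (fun κ => c κ * A κ lam * B₁ κ ν * B₂ ν μ) = fun κ => F (ν, κ).swap := by
      funext κ
      simp only [hF, Prod.swap]
      ring
    have e2 : z * (∑ κ ∈ below lam, c lam * c ν / c κ * A ν κ * B₁ lam κ) * B₂ ν μ
        = z * ∑ κ ∈ below lam, c lam / c κ * B₁ lam κ * (c ν * A ν κ * B₂ ν μ) := by
      rw [mul_assoc, sum_mul]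
      congr 1
      exact sum_congr rfl fun κ _ => by ring
    rwa [e1, e2] at h1
  have hcols' : HasSum (fun ν => z * ∑ κ ∈ below lam, c lam / c κ * B₁ lam κ
      * (c ν * A ν κ * B₂ ν μ)) (z * ∑ κ ∈ below lam, c lam / c κ * B₁ lam κ * S κ) :=
    (hasSum_sum fun κ _ => (hS κ).mul_left _).mul_left z
  rw [← hcols.unique hcols']
  exact hrows

theorem sum_below_matMul (hc : IsPairing c σ τ) (hB₂ : IsAdmissible σ B₂) (lam μ : YoungDiagram) :
    ∑ η ∈ below lam, c lam * c μ / c η * A μ η * matMul B₁ B₂ lam η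
      = ∑ κ ∈ below lam, c lam / c κ * B₁ lam κ
        * ∑ η ∈ below κ, c κ * c μ / c η * A μ η * B₂ κ η := by
  have hinner : ∀ κ ∈ below lam, ∑ η ∈ below κ, c κ * c μ / c η * A μ η * B₂ κ η
      = ∑ η ∈ below lam, c κ * c μ / c η * A μ η * B₂ κ η := fun κ hκ =>
    sum_subset (below_subset (mem_below.1 hκ)) fun η _ hη => by
      rw [hB₂.lower fun h => hη (mem_below.2 h), mul_zero]
  calc ∑ η ∈ below lam, c lam * c μ / c η * A μ η * matMul B₁ B₂ lam η
      = ∑ η ∈ below lam, ∑ κ ∈ below lam,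
          c lam * c μ / c η * A μ η * (B₁ lam κ * B₂ κ η) := by
        simp only [matMul, mul_sum]
    _ = ∑ κ ∈ below lam, ∑ η ∈ below lam,
          c lam / c κ * B₁ lam κ * (c κ * c μ / c η * A μ η * B₂ κ η) := by
        rw [sum_comm]
        refine sum_congr rfl fun κ _ => sum_congr rfl fun η _ => ?_
        have := hc.1 κ
        field_simp
    _ = _ := by
        refine sum_congr rfl fun κ hκ => ?_
        rw [hinner κ hκ, mul_sum]

/-- The adjoint of `A` is moved past `B₁` and then past `B₂`, collecting one scalar each time. -/
theorem IsDual.mul (hc : IsPairing c σ τ) (hA : IsAdmissible τ A) (hB₁ : IsAdmissible σ B₁)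
    (hB₂ : IsAdmissible σ B₂) (h₁ : IsDual c A B₁ z₁) (h₂ : IsDual c A B₂ z₂) :
    IsDual c A (matMul B₁ B₂) (z₁ * z₂) := by
  intro lam μ
  convert hasSum_mul_matMul hc hA hB₁ hB₂ h₁ lam μ (fun κ => h₂ κ μ) using 1
  rw [mul_assoc, sum_below_matMul hc hB₂, mul_sum]
  congr 1
  exact sum_congr rfl fun κ _ => by ring

theorem isDual_one (hc : IsPairing c σ τ) (hB : IsAdmissible σ B) : IsDual c idMat B 1 := by
  intro ν η
  have h1 : HasSum (fun κ => c κ * idMat κ ν * B κ η) (c ν * idMat ν ν * B ν η) :=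
    hasSum_single ν fun κ hκ => by rw [idMat_of_ne hκ]; ring
  rw [idMat_self, mul_one] at h1
  convert h1 using 1
  rw [one_mul]
  by_cases h : η ≤ ν
  · rw [sum_eq_single_of_mem η (mem_below.2 h)]
    · rw [idMat_self]
      have := hc.1 η
      field_simp
    · intro κ _ hκ
      rw [idMat_of_ne (Ne.symm hκ)]
      ring
  · rw [hB.lower h, mul_zero]
    refine sum_eq_zero fun κ hκ => ?_
    rw [idMat_of_ne fun h' => h (h'.le.trans (mem_below.1 hκ))]
    ring

end admissible

end QWhittaker


namespace QWhittaker

open Finset Filter Topology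

/-! ### The exchange relations for matrices -/

theorem mat_tWeight_mul_q {q y : ℂ} {u v : ℕ → ℂ} (hq : ‖q‖ < 1) (hy : ∀ i, 1 - u i * y ≠ 0) :
    mat (tWeight q (q * y) u v) = matMul (mat (lWeight q y u v)) (mat (tWeight q y u v)) := by
  funext κ μ
  set N := max (κ.colLen 0) (μ.colLen 0)
  set M := κ.rowLen 0 + 1
  have hL : ∀ i, lWeight q y u v i 0 0 0 0 = 1 := fun i => lWeight_zero (hy i)
  have key := sum_row_lWeight_mul_row (v := v) hq hy (colMult κ) (colMult μ) M N (fun i _ => by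
    have := κ.rowLen_anti 0 i (Nat.zero_le i)
    rw [colMult_apply]
    omega) 0 0 (Nat.zero_le 1)
  rw [zero_add] at key
  rw [mat_eq_row (tWeight_zero hq u v) (le_max_left _ _) (le_max_right _ _), ← key, matMul]
  have hbox := sum_box M N fun ν => row (lWeight q y u v) (colMult κ) (colMult ν) N 0
    * row (tWeight q y u v) (colMult ν) (colMult μ) N 0
  simp only [colMult_symm_apply] at hbox
  rw [← hbox]
  symm
  have hsub : below κ ⊆ box M N := below_subset_box κ (le_max_left _ _) (Nat.le_succ _)
  rw [← sum_subset hsub]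
  · refine sum_congr rfl fun ν hν => ?_
    have hle := (colLen_mono (mem_below.1 hν)).trans (le_max_left (κ.colLen 0) (μ.colLen 0))
    rw [mat_eq_row hL (le_max_left _ _) hle,
      mat_eq_row (tWeight_zero hq u v) hle (le_max_right _ _)]
  · intro ν hν hν'
    have h0 : mat (lWeight q y u v) κ ν = 0 := mat_eq_zero fun h => hν' (mem_below.2 h)
    rw [mat_eq_row hL (le_max_left _ _) (mem_box.1 hν).1] at h0
    rw [h0, zero_mul]

/-- The bottom labels of an auxiliary row exceed its top labels by at most one, so any cutoff above
that gives the same sum. This allows the cutoff to be frozen while the number of sites grows. -/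
theorem auxAbove_eq_of_le {q x y : ℂ} {u v : ℕ → ℂ} {g : ℕ → ℕ → ℂ} {a c : ℕ → ℕ} {M M' : ℕ} (N : ℕ)
    (hM : ∀ i < N, c i + 1 ≤ M) (hM' : ∀ i < N, c i + 1 ≤ M') (b e : ℕ) (he : e ≤ 1) :
    auxAbove q x y u v g a c M N b e = auxAbove q x y u v g a c M' N b e := by
  induction N generalizing b e with
  | zero => simp only [auxAbove, sum_seqs_zero]
  | succ N ih =>
    have ih' := ih (fun i hi => hM i (hi.trans N.lt_succ_self))
      fun i hi => hM' i (hi.trans N.lt_succ_self)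
    rw [auxAbove_succ _ _ _ _ _ _ _ _ _ _ _ _ he (hM N N.lt_succ_self),
      auxAbove_succ _ _ _ _ _ _ _ _ _ _ _ _ he (hM' N N.lt_succ_self)]
    simp only [ih' _ 0 (Nat.zero_le 1), ih' _ 1 le_rfl]

theorem auxAbove_succ_of_eq_zero {q x y : ℂ} {u v : ℕ → ℂ} {g : ℕ → ℕ → ℂ} {a c : ℕ → ℕ} {M N : ℕ}
    (hg : g N 0 = 1) (ha : a N = 0) (hc : c N = 0) (hM : 1 ≤ M) :
    auxAbove q x y u v g a c M (N + 1) 1 1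
      = tWeight q x v u N 0 1 0 1 * lWeight q y u v N 0 1 0 1 * auxAbove q x y u v g a c M N 1 1 := by
  rw [auxAbove_succ _ _ _ _ _ _ _ _ _ _ _ _ le_rfl (by omega), ha, hc]
  simp only [nonpos_iff_eq_zero, one_ne_zero, if_false, zero_add, tsub_self, zero_le, if_true, hg,
    tWeight, lWeight, tsub_zero]
  ring

/-- Apply `zipper` with left labels zero and let the number of sites tend to infinity. The finite
side stabilizes, the partial sums converge to the pairing, and the unwanted term with left labels
`1, 1` tends to zero: both lines must cross many empty sites, at a cost of at most `σ_i τ_i ≤ ρ < 1`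
each. -/
theorem isDual_lWeight {q x y : ℂ} {u v : ℕ → ℂ} {σ τ : ℕ → ℝ} {η K K' ρ : ℝ} (hq : ‖q‖ < 1)
    (huv : ∀ i, ‖u i * v i‖ < 1) (hy : ∀ i, 1 - u i * y ≠ 0)
    (hη : 0 ≤ η) (hη1 : η < 1) (hK : 1 ≤ K) (hK' : 1 ≤ K')
    (hc : IsPairing (coeff q u v) σ τ) (hρ : ρ < 1) (hστ : ∀ i, σ i * τ i ≤ ρ)
    (hT : IsBounded (tWeight q x v u) τ η K) (hL : IsBounded (lWeight q y u v) σ η K') :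
    IsDual (coeff q u v) (mat (tWeight q x v u)) (mat (lWeight q y u v)) (1 - x * y) := by
  intro lam μ
  have hL0 : ∀ i, lWeight q y u v i 0 0 0 0 = 1 := fun i => lWeight_zero (hy i)
  have hT0 : ∀ i, tWeight q x v u i 0 0 0 0 = 1 := tWeight_zero hq v u
  have hAT := isAdmissible_mat hc.2.2.1 hη hη1 hK hT hT0
  have hAL := isAdmissible_mat hc.2.1 hη hη1 hK' hL hL0
  have hsum := (summable_pairing hc hAT hAL lam μ).hasSum
  -- Beyond `N₀` all sites of both diagrams are empty, and `N₀` also strictly exceeds all their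
  -- column multiplicities, as the cutoff in `zipper` requires.
  set N₀ := max (lam.colLen 0) (μ.colLen 0) + lam.rowLen 0 + μ.rowLen 0 + 1 with hN₀
  set g := siteCoeff q u v with hg
  have hMa : ∀ N, N₀ ≤ N → ∀ i, colMult lam i + 1 ≤ N := fun N hN i => by
    have := lam.rowLen_anti 0 i (Nat.zero_le i)
    rw [colMult_apply]
    omega
  have hMc : ∀ N, N₀ ≤ N → ∀ i, colMult μ i + 1 ≤ N := fun N hN i => by
    have := μ.rowLen_anti 0 i (Nat.zero_le i)
    rw [colMult_apply]
    omega
  have hbelow : ∀ N, N₀ ≤ N → auxBelow q x y u v g (colMult lam) (colMult μ) N N 0 0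
      = ∑ κ ∈ below lam, coeff q u v lam * coeff q u v μ / coeff q u v κ
        * mat (tWeight q x v u) μ κ * mat (lWeight q y u v) lam κ := by
    intro N hN
    have hlam : lam.colLen 0 ≤ N := by omega
    have hμ : μ.colLen 0 ≤ N := by omega
    have hbox := sum_box N N fun κ => row (lWeight q y u v) (colMult lam) (colMult κ) N 0
      * row (tWeight q x v u) (colMult μ) (colMult κ) N 0
      * ∏ i ∈ range N, g i (colMult lam i) * g i (colMult μ i) / g i (colMult κ i)
    simp only [colMult_symm_apply] at hbox
    rw [auxBelow, ← hbox, ← sum_subset (below_subset_box lam hlam (by omega : lam.rowLen 0 ≤ N))]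
    · refine sum_congr rfl fun κ hκ => ?_
      have hle := (colLen_mono (mem_below.1 hκ)).trans hlam
      rw [mat_eq_row hL0 hlam hle, mat_eq_row hT0 hμ hle, coeff_eq hlam, coeff_eq hμ, coeff_eq hle,
        prod_div_distrib, prod_mul_distrib]
      ring
    · intro κ hκ hκ'
      have h0 : mat (lWeight q y u v) lam κ = 0 := mat_eq_zero fun h => hκ' (mem_below.2 h)
      rw [mat_eq_row hL0 hlam (mem_box.1 hκ).1] at h0
      rw [h0, zero_mul, zero_mul]
  have habove : ∀ N, N₀ ≤ N → auxAbove q x y u v g (colMult lam) (colMult μ) N N 0 0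
      = ∑ κ ∈ box N N, coeff q u v κ * mat (tWeight q x v u) κ lam
        * mat (lWeight q y u v) κ μ := by
    intro N hN
    have hbox := sum_box N N fun κ => (∏ i ∈ range N, g i (colMult κ i))
      * row (tWeight q x v u) (colMult κ) (colMult lam) N 0
      * row (lWeight q y u v) (colMult κ) (colMult μ) N 0
    simp only [colMult_symm_apply] at hbox
    rw [auxAbove, ← hbox]
    refine sum_congr rfl fun κ hκ => ?_
    have hle := (mem_box.1 hκ).1
    rw [mat_eq_row hL0 hle (by omega), mat_eq_row hT0 hle (by omega), coeff_eq hle]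
  have hzero : Tendsto (fun N => auxAbove q x y u v g (colMult lam) (colMult μ) N N 1 1) atTop
      (𝓝 0) := by
    -- The cutoff is fixed at `N₀` so that consecutive terms are related by one empty site.
    set t : ℕ → ℂ := fun N => auxAbove q x y u v g (colMult lam) (colMult μ) N₀ N 1 1 with ht
    have hρ0 : 0 < ρ := (mul_pos (hc.2.1 0) (hc.2.2.1 0)).trans_le (hστ 0)
    have hstep : ∀ k, ‖t (N₀ + k)‖ ≤ ρ ^ k * ‖t N₀‖ := by
      intro k
      induction k with
      | zero => simp
      | succ k ih =>
        have hrec : t (N₀ + (k + 1)) = _ := auxAbove_succ_of_eq_zero (M := N₀) (N := N₀ + k)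
          (siteCoeff_zero q u v _) (colMult_eq_zero (by omega)) (colMult_eq_zero (by omega))
          (by omega)
        have h1 := hT.empty_le (N₀ + k) 1
        have h2 := hL.empty_le (N₀ + k) 1
        have h3 : (η * τ (N₀ + k)) * (η * σ (N₀ + k)) ≤ ρ := by
          have h4 := mul_pos (hc.2.1 (N₀ + k)) (hc.2.2.1 (N₀ + k))
          have h5 : η * η ≤ 1 := mul_le_one₀ hη1.le hη hη1.le
          nlinarith [hστ (N₀ + k)]
        rw [hrec, norm_mul, norm_mul, pow_succ]
        rw [pow_one] at h1 h2
        calc _ ≤ (η * τ (N₀ + k)) * (η * σ (N₀ + k)) * (ρ ^ k * ‖t N₀‖) := by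
              have := (norm_nonneg _).trans h1
              have := (norm_nonneg _).trans h2
              gcongr
          _ ≤ ρ * (ρ ^ k * ‖t N₀‖) := by gcongr
          _ = _ := by ring
    have hlim : Tendsto (fun k => t (N₀ + k)) atTop (𝓝 0) := by
      refine squeeze_zero_norm hstep ?_
      simpa using (tendsto_pow_atTop_nhds_zero_of_lt_one hρ0.le hρ).mul_const ‖t N₀‖
    have hlim' : Tendsto t atTop (𝓝 0) := by
      rw [← tendsto_add_atTop_iff_nat N₀]
      simpa only [add_comm] using hlim
    refine hlim'.congr' ?_
    filter_upwards [eventually_ge_atTop N₀] with N hN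
    exact auxAbove_eq_of_le N (fun i _ => hMc N₀ le_rfl i) (fun i _ => hMc N hN i) 1 1 le_rfl
  have hlim : Tendsto (fun N => auxAbove q x y u v g (colMult lam) (colMult μ) N N 0 0) atTop
      (𝓝 (∑' κ, coeff q u v κ * mat (tWeight q x v u) κ lam * mat (lWeight q y u v) κ μ)) := by
    refine (hsum.comp tendsto_box).congr' ?_
    filter_upwards [eventually_ge_atTop N₀] with N hN
    exact (habove N hN).symm
  have hlim2 := hlim.sub (hzero.const_mul (x * y))
  rw [mul_zero, sub_zero] at hlim2
  have hconst : Tendsto (fun N => auxAbove q x y u v g (colMult lam) (colMult μ) N N 0 0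
      - x * y * auxAbove q x y u v g (colMult lam) (colMult μ) N N 1 1) atTop
      (𝓝 ((1 - x * y) * ∑ κ ∈ below lam, coeff q u v lam * coeff q u v μ / coeff q u v κ
        * mat (tWeight q x v u) μ κ * mat (lWeight q y u v) lam κ)) := by
    refine tendsto_const_nhds.congr' ?_
    filter_upwards [eventually_ge_atTop N₀] with N hN
    rw [← hbelow N hN, (zipper hq (siteCoeff_ne_zero hq huv) (siteCoeff_succ u v hq) N
      (fun i _ => hMa N hN i) (fun i _ => hMc N hN i) 0).1]
  rwa [tendsto_nhds_unique hlim2 hconst] at hsum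

end QWhittaker


namespace QWhittaker

open Finset Filter Topology

/-! ### The infinite `q`-Pochhammer symbol -/

theorem norm_neg_mul_pow_le {a q : ℂ} (ha : ‖a‖ ≤ 1) (j : ℕ) : ‖-(a * q ^ j)‖ ≤ ‖q‖ ^ j := by
  rw [norm_neg, norm_mul, norm_pow]
  exact mul_le_of_le_one_left (by positivity) ha

theorem summable_norm_neg_mul_pow {q : ℂ} (hq : ‖q‖ < 1) (a : ℂ) :
    Summable fun j : ℕ => ‖-(a * q ^ j)‖ := by
  simpa only [norm_neg, norm_mul, norm_pow] using
    (summable_geometric_of_lt_one (norm_nonneg q) hq).mul_left ‖a‖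

theorem multipliable_qPochInf {q : ℂ} (hq : ‖q‖ < 1) (a : ℂ) :
    Multipliable fun j : ℕ => 1 - a * q ^ j := by
  simpa only [sub_eq_add_neg] using multipliable_one_add_of_summable (summable_norm_neg_mul_pow hq a)

theorem one_sub_mul_qPochInf {q : ℂ} (hq : ‖q‖ < 1) (a : ℂ) :
    (1 - a) * qPochInf (q * a) q = qPochInf a q := by
  have e : ∀ j : ℕ, 1 - q * a * q ^ j = 1 - a * q ^ (j + 1) := fun j => by ring
  have h := multipliable_qPochInf hq (q * a)
  simp only [e] at h
  have h1 := tprod_eq_zero_mul' (f := fun j : ℕ => 1 - a * q ^ j) h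
  rw [pow_zero, mul_one] at h1
  simp only [qPochInf, e, h1]

theorem qPochInf_zero (q : ℂ) : qPochInf 0 q = 1 := by
  simp [qPochInf]

theorem one_sub_mul_pow_ne_zero {a q : ℂ} (ha : ‖a‖ < 1) (hq : ‖q‖ < 1) (j : ℕ) :
    1 - a * q ^ j ≠ 0 :=
  one_sub_ne_zero_of_norm_lt (by
    rw [norm_mul, norm_pow]
    exact (mul_le_of_le_one_right (norm_nonneg a) (pow_le_one₀ (norm_nonneg q) hq.le)).trans_lt ha)

theorem qPochInf_ne_zero {a q : ℂ} (ha : ‖a‖ < 1) (hq : ‖q‖ < 1) : qPochInf a q ≠ 0 := by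
  have := tprod_one_add_ne_zero_of_summable (f := fun j : ℕ => -(a * q ^ j))
    (fun j => by simpa only [← sub_eq_add_neg] using one_sub_mul_pow_ne_zero ha hq j)
    (summable_norm_neg_mul_pow hq a)
  simp only [← sub_eq_add_neg] at this
  exact this

theorem differentiableOn_qPochInf {q : ℂ} (hq : ‖q‖ < 1) :
    DifferentiableOn ℂ (fun a => qPochInf a q) (Metric.ball 0 1) := by
  have h : HasProdLocallyUniformlyOn (fun (j : ℕ) (a : ℂ) => 1 + -(a * q ^ j))
      (fun a => ∏' j : ℕ, (1 + -(a * q ^ j))) (Metric.ball (0 : ℂ) 1) :=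
    Summable.hasProdLocallyUniformlyOn_one_add Metric.isOpen_ball
      (summable_geometric_of_lt_one (norm_nonneg q) hq)
      (Eventually.of_forall fun j a ha =>
        norm_neg_mul_pow_le (mem_ball_zero_iff.1 ha).le j)
      (fun j => by fun_prop)
  simp only [qPochInf, sub_eq_add_neg]
  refine h.differentiableOn (.of_forall fun s => ?_) Metric.isOpen_ball
  simpa [Finset.prod_fn] using DifferentiableOn.finsetProd (fun _ _ => by fun_prop)

/-! ### Rows as functions of the spectral parameter -/

theorem differentiable_wt (q u v : ℂ) (b c d : ℕ) : Differentiable ℂ fun x => wt q x u v b c d := by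
  induction b generalizing c d with
  | zero =>
    simp only [wt_zero, qPoch]
    fun_prop
  | succ b ih =>
    rcases c with _ | c <;> rcases d with _ | d
    · simp only [wt_succ_zero_zero]
      fun_prop
    · simp only [wt_succ_zero_succ]
      exact (ih _ _).const_mul _
    · simp only [wt_succ_succ_zero]
      exact (ih _ _).const_mul _
    · simp only [wt_succ_succ_succ]
      exact ((ih _ _).const_mul _).add ((ih _ _).const_mul _)

theorem differentiable_row (q : ℂ) (u v : ℕ → ℂ) (a c : ℕ → ℕ) (N b : ℕ) :
    Differentiable ℂ fun x => row (tWeight q x u v) a c N b := by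
  induction N generalizing b with
  | zero => simp only [row]; fun_prop
  | succ N ih =>
    simp only [row]
    split_ifs
    · exact (differentiable_wt q _ _ _ _ _).mul (ih _)
    · fun_prop

theorem differentiable_mat (q : ℂ) (u v : ℕ → ℂ) (κ ν : YoungDiagram) :
    Differentiable ℂ fun x => mat (tWeight q x u v) κ ν :=
  differentiable_row q u v _ _ _ _

theorem row_tWeight_zero {q : ℂ} (hq : ‖q‖ < 1) (u v : ℕ → ℂ) (a c : ℕ → ℕ) (N : ℕ) :
    row (tWeight q 0 u v) a c N 0 = if ∀ i < N, a i = c i then 1 else 0 := by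
  induction N with
  | zero => simp [row]
  | succ N ih =>
    rw [row, add_zero]
    rcases lt_trichotomy (a N) (c N) with h | h | h
    · rw [if_neg (by omega), if_neg fun h' => h.ne (h' N N.lt_succ_self)]
    · rw [if_pos h.ge, h, tsub_self, ih, tWeight, wt_zero, add_zero, qBinom_self hq]
      have : (∀ i < N + 1, a i = c i) ↔ ∀ i < N, a i = c i := by
        refine ⟨fun H i hi => H i (hi.trans N.lt_succ_self), fun H i hi => ?_⟩
        rcases Nat.lt_succ_iff_lt_or_eq.1 hi with hi | rfl
        · exact H i hi
        · exact h
      simp only [this]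
      simp [qPoch]
    · rw [if_pos h.le, tWeight, wt_zero, zero_pow (by omega),
        if_neg fun h' => h.ne' (h' N N.lt_succ_self)]
      ring

theorem mat_tWeight_zero {q : ℂ} (hq : ‖q‖ < 1) (u v : ℕ → ℂ) :
    mat (tWeight q 0 u v) = idMat := by
  funext κ ν
  rw [mat, row_tWeight_zero hq, idMat]
  congr 1
  rw [eq_iff_iff]
  refine ⟨fun h => colMult_injective (Finsupp.ext fun i => ?_), fun h i _ => by rw [h]⟩
  by_cases hi : i < max (κ.colLen 0) (ν.colLen 0)
  · exact h i hi
  · rw [colMult_eq_zero (by omega), colMult_eq_zero (by omega)]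

end QWhittaker


namespace QWhittaker

open Finset Filter Topology

/-! ### The exchange relation of two rows -/

/-- The parameters of the model, spectral parameters bounded by `t`, and a margin `ζ`. -/
structure IsRange (q : ℂ) (u v : ℕ → ℂ) (r t ζ : ℝ) : Prop where
  hq : ‖q‖ < 1
  hu : ∀ i, ‖u i‖ ≤ 1
  hv : ∀ i, ‖v i‖ ≤ 1
  huv : ∀ i, ‖u i * v i‖ ≤ r
  t_pos : 0 < t
  t_lt : t < 1
  one_lt : 1 < ζ
  lt_one : ζ ^ 4 * max r t < 1

/-- The ratio of the weights of partitions that dominate the rows with parameters `v`. -/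
noncomputable def ratio (v : ℕ → ℂ) (t ζ : ℝ) (i : ℕ) : ℝ := ζ ^ 2 * max ‖v i‖ t

theorem exists_isRange {q : ℂ} {u v : ℕ → ℂ} {r t : ℝ} (hq : ‖q‖ < 1) (hu : ∀ i, ‖u i‖ ≤ 1)
    (hv : ∀ i, ‖v i‖ ≤ 1) (hr : r < 1) (huv : ∀ i, ‖u i * v i‖ ≤ r) (ht : 0 < t) (ht1 : t < 1) :
    ∃ ζ, IsRange q u v r t ζ := by
  have hlim : Tendsto (fun ζ : ℝ => ζ ^ 4 * max r t) (𝓝[>] 1) (𝓝 (1 ^ 4 * max r t)) :=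
    ((continuous_id.pow 4).mul continuous_const).continuousAt.tendsto.mono_left nhdsWithin_le_nhds
  -- At `ζ = 1` the required inequality is strict, so it persists for `ζ` slightly larger.
  have h1 : (1 : ℝ) ^ 4 * max r t < 1 := by simp [hr, ht1]
  obtain ⟨ζ, h, hζ⟩ := ((hlim.eventually_lt_const h1).and self_mem_nhdsWithin).exists
  exact ⟨ζ, hq, hu, hv, huv, ht, ht1, hζ, h⟩

namespace IsRange

variable {q x y : ℂ} {u v : ℕ → ℂ} {r t ζ : ℝ}

theorem symm (h : IsRange q u v r t ζ) : IsRange q v u r t ζ :=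
  ⟨h.hq, h.hv, h.hu, fun i => by rw [mul_comm]; exact h.huv i, h.t_pos, h.t_lt, h.one_lt, h.lt_one⟩

theorem ratio_pos (h : IsRange q u v r t ζ) (w : ℕ → ℂ) (i : ℕ) : 0 < ratio w t ζ i := by
  have := h.t_pos.trans_le (le_max_right ‖w i‖ t)
  have := zero_lt_one.trans h.one_lt
  rw [ratio]
  positivity

theorem norm_mul_lt_one (h : IsRange q u v r t ζ) (i : ℕ) : ‖u i * v i‖ < 1 := by
  have h1 := (h.huv i).trans (le_max_left r t)
  have h2 : (1 : ℝ) ≤ ζ ^ 4 := one_le_pow₀ h.one_lt.le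
  have h3 : 0 < max r t := h.t_pos.trans_le (le_max_right r t)
  nlinarith [h.lt_one]

theorem ratio_mul_ratio_le (h : IsRange q u v r t ζ) (i : ℕ) :
    ratio v t ζ i * ratio u t ζ i ≤ ζ ^ 4 * max r t := by
  have hz := zero_lt_one.trans h.one_lt
  have key : max ‖v i‖ t * max ‖u i‖ t ≤ max r t := by
    have hu := h.hu i
    have hv := h.hv i
    have hu0 := norm_nonneg (u i)
    have hv0 := norm_nonneg (v i)
    have huv := h.huv i
    have ht := h.t_pos
    have ht1 := h.t_lt
    rw [norm_mul] at huv
    rcases max_cases ‖v i‖ t with ⟨e1, _⟩ | ⟨e1, _⟩ <;>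
      rcases max_cases ‖u i‖ t with ⟨e2, _⟩ | ⟨e2, _⟩ <;> rw [e1, e2]
    · exact le_trans (by linarith) (le_max_left r t)
    all_goals exact le_trans (by nlinarith) (le_max_right r t)
  calc _ = ζ ^ 4 * (max ‖v i‖ t * max ‖u i‖ t) := by rw [ratio, ratio]; ring
    _ ≤ _ := by gcongr

theorem isPairing (h : IsRange q u v r t ζ) :
    IsPairing (coeff q u v) (ratio v t ζ) (ratio u t ζ) :=
  ⟨coeff_ne_zero h.hq h.norm_mul_lt_one, h.ratio_pos v, h.ratio_pos u, fun _ _ hD hE =>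
    summable_coeff_mul_diagWeight h.hq h.norm_mul_lt_one (h.ratio_pos v) (h.ratio_pos u) h.lt_one
      h.ratio_mul_ratio_le hD hE⟩

theorem inv_mul_ratio (h : IsRange q u v r t ζ) (w : ℕ → ℂ) (i : ℕ) :
    ζ⁻¹ * ratio w t ζ i = ζ * max ‖w i‖ t := by
  have hz := (zero_lt_one.trans h.one_lt).ne'
  rw [ratio]
  field_simp

theorem inv_nonneg (h : IsRange q u v r t ζ) : 0 ≤ ζ⁻¹ :=
  (inv_pos.2 (zero_lt_one.trans h.one_lt)).le

theorem inv_lt_one (h : IsRange q u v r t ζ) : ζ⁻¹ < 1 := inv_lt_one_of_one_lt₀ h.one_lt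

theorem isBounded_tWeight (h : IsRange q u v r t ζ) (hy : ‖y‖ ≤ t) :
    IsBounded (tWeight q y u v) (ratio v t ζ) ζ⁻¹ (boundT q) := by
  refine QWhittaker.isBounded_tWeight h.hq h.hu h.hv (hy.trans h.t_lt.le) fun i => ?_
  rw [h.inv_mul_ratio]
  have h0 : 0 ≤ max ‖v i‖ t := (norm_nonneg _).trans (le_max_left _ _)
  exact (max_le_max le_rfl hy).trans (le_mul_of_one_le_left h0 h.one_lt.le)

theorem isAdmissible (h : IsRange q u v r t ζ) (hy : ‖y‖ ≤ t) :
    IsAdmissible (ratio v t ζ) (mat (tWeight q y u v)) :=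
  isAdmissible_mat (h.ratio_pos v) h.inv_nonneg h.inv_lt_one (one_le_boundT h.hq)
    (h.isBounded_tWeight hy) (tWeight_zero h.hq u v)

/-- The bound for the parameters of auxiliary rows. -/
theorem exists_isBounded_lWeight (h : IsRange q u v r t ζ) :
    ∃ δ, 0 < δ ∧ δ ≤ t ∧ ∀ y : ℂ, ‖y‖ ≤ δ →
      IsBounded (lWeight q y u v) (ratio v t ζ) ζ⁻¹ (2 / (1 - δ)) := by
  have hz := zero_lt_one.trans h.one_lt
  have ht := h.t_pos
  have ht1 := h.t_lt
  have hz1 : 0 < ζ - 1 := sub_pos.2 h.one_lt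
  have hden : 0 < 1 + ζ * t := by positivity
  -- With `S = max |v_i| t ≥ t`, the bound `|v_i| + δ ≤ ζ S (1 - δ)` follows from `δ ≤ t (ζ - 1 - ζ
  -- δ)`; solving for `δ` gives the second entry of the minimum.
  refine ⟨min t (t * (ζ - 1) / (1 + ζ * t)), by positivity, min_le_left _ _, fun y hy => ?_⟩
  set δ := min t (t * (ζ - 1) / (1 + ζ * t)) with hδ
  have hδt : δ ≤ t := min_le_left _ _
  have hδ2 : δ * (1 + ζ * t) ≤ t * (ζ - 1) := by
    rw [← le_div_iff₀ hden]
    exact min_le_right _ _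
  have hδ1 : δ < 1 := hδt.trans_lt ht1
  refine isBounded_lWeight h.hq h.hu h.hv hδ1 hy fun i => ?_
  rw [h.inv_mul_ratio, div_le_iff₀ (by linarith)]
  have h1 := le_max_left ‖v i‖ t
  have h2 := le_max_right ‖v i‖ t
  set S := max ‖v i‖ t
  have h3 : 0 ≤ ζ - 1 - ζ * δ := by
    have hδ0 : 0 ≤ δ := (norm_nonneg y).trans hy
    have : t * (ζ - 1 - ζ * δ) ≥ 0 := by nlinarith
    exact nonneg_of_mul_nonneg_right this ht
  nlinarith [mul_le_mul_of_nonneg_right h2 h3]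

theorem one_sub_ne_zero (h : IsRange q u v r t ζ) (hy : ‖y‖ ≤ t) (i : ℕ) : 1 - u i * y ≠ 0 :=
  one_sub_ne_zero_of_norm_lt (by
    rw [norm_mul]
    exact (mul_le_of_le_one_left (norm_nonneg y) (h.hu i)).trans_lt (hy.trans_lt h.t_lt))

theorem norm_q_mul_le (h : IsRange q u v r t ζ) (y : ℂ) : ‖q * y‖ ≤ ‖y‖ := by
  rw [norm_mul]
  exact mul_le_of_le_one_left (norm_nonneg y) h.hq.le

end IsRange

/-- The difference of the two sides of the exchange relation of two rows. -/
noncomputable def defect (q x : ℂ) (u v : ℕ → ℂ) (lam μ : YoungDiagram) (y : ℂ) : ℂ :=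
  qPochInf (x * y) q * (∑' κ, coeff q u v κ * mat (tWeight q x v u) κ lam * mat (tWeight q y u v) κ μ)
    - ∑ κ ∈ below lam, coeff q u v lam * coeff q u v μ / coeff q u v κ
      * mat (tWeight q x v u) μ κ * mat (tWeight q y u v) lam κ

/-! ### The `q`-difference equation for the defect and its only solution. -/

section defect

variable {q x : ℂ} {u v : ℕ → ℂ} {r t ζ : ℝ}

theorem defect_zero (h : IsRange q u v r t ζ) (hx : ‖x‖ ≤ t) (lam μ : YoungDiagram) :
    defect q x u v lam μ 0 = 0 := by
  have hA := h.symm.isAdmissible hx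
  have key := (isDual_one h.isPairing.symm hA).symm isAdmissible_one (σ := ratio u t ζ) hA
    (τ := ratio v t ζ) lam μ
  rw [defect, mat_tWeight_zero h.hq, mul_zero, qPochInf_zero, one_mul, key.tsum_eq, one_mul, sub_self]

/-- Substitute `T(qy) = L(y) T(y)` and move the dual row past `L(y)`. The scalar `1 - xy` turns
`(qxy;q)_∞` back into `(xy;q)_∞`, so the infinite product fits the recursion exactly. -/
theorem defect_mul_q (h : IsRange q u v r t ζ) (hx : ‖x‖ ≤ t) {δ : ℝ} (hδt : δ ≤ t)
    (hδ : ∀ y : ℂ, ‖y‖ ≤ δ → IsBounded (lWeight q y u v) (ratio v t ζ) ζ⁻¹ (2 / (1 - δ)))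
    (lam μ : YoungDiagram) {y : ℂ} (hy : ‖y‖ ≤ δ) :
    defect q x u v lam μ (q * y)
      = ∑ η ∈ below lam, coeff q u v lam / coeff q u v η * mat (lWeight q y u v) lam η
        * defect q x u v η μ y := by
  have hyt := hy.trans hδt
  have hδ0 : 0 ≤ δ := (norm_nonneg y).trans hy
  have hδ1 : δ < 1 := hδt.trans_lt h.t_lt
  have hK : 1 ≤ 2 / (1 - δ) := by rw [le_div_iff₀ (by linarith)]; linarith
  have hc := h.isPairing
  have hA := h.symm.isAdmissible hx
  have hT := h.isAdmissible hyt
  have hL : IsAdmissible (ratio v t ζ) (mat (lWeight q y u v)) :=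
    isAdmissible_mat (h.ratio_pos v) h.inv_nonneg h.inv_lt_one hK (hδ y hy)
      fun i => lWeight_zero (h.one_sub_ne_zero hyt i)
  have hdual := isDual_lWeight h.hq h.norm_mul_lt_one (h.one_sub_ne_zero hyt) h.inv_nonneg
    h.inv_lt_one (one_le_boundT h.hq) hK hc h.lt_one h.ratio_mul_ratio_le
    (h.symm.isBounded_tWeight hx) (hδ y hy)
  have hsum := hasSum_mul_matMul hc hA hL hT hdual lam μ
    fun κ => (summable_pairing hc hA hT κ μ).hasSum
  have hfin := sum_below_matMul (A := mat (tWeight q x v u)) (B₁ := mat (lWeight q y u v)) hc hT lam μ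
  rw [defect, mat_tWeight_mul_q h.hq (h.one_sub_ne_zero hyt), hsum.tsum_eq, hfin,
    ← mul_assoc, show x * (q * y) = q * (x * y) by ring, mul_comm (qPochInf _ q),
    one_sub_mul_qPochInf h.hq, mul_sum, ← sum_sub_distrib]
  refine sum_congr rfl fun κ _ => ?_
  rw [defect]
  ring

/-- Each matrix entry is a polynomial in `y`, and the series is dominated by a summable bound
uniform on the disc. -/
theorem differentiableOn_defect (h : IsRange q u v r t ζ) (hx : ‖x‖ ≤ t) (lam μ : YoungDiagram) :
    DifferentiableOn ℂ (defect q x u v lam μ) (Metric.ball 0 t) := by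
  have hc := h.isPairing
  have hA := h.symm.isAdmissible hx
  obtain ⟨C₁, D₁, hC₁, hD₁, h₁⟩ := hA.norm_le hc.2.2.1 lam
  obtain ⟨D₂, hD₂, h₂⟩ := exists_sum_mat_mul_diagWeight_le (h.ratio_pos v) h.inv_nonneg
    h.inv_lt_one (one_le_boundT h.hq) (le_refl (1 : ℝ))
  have hpos := diagWeight_pos (le_refl (1 : ℝ)) (h.ratio_pos v)
  have hTle : ∀ y ∈ Metric.ball (0 : ℂ) t, ∀ κ, ‖mat (tWeight q y u v) κ μ‖
      ≤ (diagWeight 1 (ratio v t ζ) μ)⁻¹ * diagWeight D₂ (ratio v t ζ) κ := by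
    intro y hy κ
    have hyt := (mem_ball_zero_iff.1 hy).le
    rw [inv_mul_eq_div, le_div_iff₀ (hpos μ)]
    by_cases hμ : μ ≤ κ
    · refine le_trans ?_ (h₂ _ (h.isBounded_tWeight hyt) (tWeight_zero h.hq u v) κ)
      exact single_le_sum (f := fun ν => ‖mat (tWeight q y u v) κ ν‖ * diagWeight 1 (ratio v t ζ) ν)
        (fun η _ => mul_nonneg (norm_nonneg _) (hpos η).le) (mem_below.2 hμ)
    · rw [mat_eq_zero hμ, norm_zero, zero_mul]
      exact (diagWeight_pos hD₂ (h.ratio_pos v) κ).le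
  have hinv : 0 ≤ (diagWeight 1 (ratio v t ζ) μ)⁻¹ := (inv_pos.2 (hpos μ)).le
  have hsum : DifferentiableOn ℂ (fun y => ∑' κ, coeff q u v κ * mat (tWeight q x v u) κ lam
      * mat (tWeight q y u v) κ μ) (Metric.ball 0 t) := by
    refine Complex.differentiableOn_tsum_of_summable_norm
      ((hc.2.2.2 D₂ D₁ hD₂ hD₁).mul_left (C₁ * (diagWeight 1 (ratio v t ζ) μ)⁻¹))
      (fun κ => ((differentiable_mat q u v κ μ).const_mul _).differentiableOn) Metric.isOpen_ball
      fun κ y hy => ?_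
    rw [norm_mul, norm_mul]
    calc _ ≤ ‖coeff q u v κ‖ * (C₁ * diagWeight D₁ (ratio u t ζ) κ)
          * ((diagWeight 1 (ratio v t ζ) μ)⁻¹ * diagWeight D₂ (ratio v t ζ) κ) := by
          have := mul_nonneg hC₁ (diagWeight_pos hD₁ hc.2.2.1 κ).le
          gcongr
          · exact h₁ κ
          · exact hTle y hy κ
      _ = _ := by ring
  have hpoch : DifferentiableOn ℂ (fun y => qPochInf (x * y) q) (Metric.ball 0 t) := by
    refine (differentiableOn_qPochInf h.hq).comp (f := fun y => x * y) (by fun_prop) fun y hy => ?_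
    rw [mem_ball_zero_iff] at hy ⊢
    rw [norm_mul]
    exact (mul_le_of_le_one_left (norm_nonneg y) (hx.trans h.t_lt.le)).trans_lt (hy.trans h.t_lt)
  refine (hpoch.mul hsum).sub (DifferentiableOn.fun_sum fun κ _ => ?_)
  exact ((differentiable_mat q u v lam κ).const_mul _).differentiableOn

theorem mat_lWeight_self_mul {y : ℂ} (hy : ∀ i, 1 - u i * y ≠ 0) (lam : YoungDiagram) :
    mat (lWeight q y u v) lam lam * ∏ i ∈ range (lam.colLen 0), qPoch (u i * y) q (colMult lam i)
      = ∏ i ∈ range (lam.colLen 0), qPoch (u i * (q * y)) q (colMult lam i) := by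
  rw [mat, max_self, row_self, ← prod_mul_distrib]
  refine prod_congr rfl fun i _ => ?_
  have h1 := qPoch_mul_shift (u i * y) q (colMult lam i)
  have h2 := hy i
  rw [lWeight, lw, show u i * (q * y) = q * (u i * y) by ring]
  rw [div_mul_eq_mul_div, div_eq_iff h2]
  linear_combination -h1

/-- Smaller partitions drop out by induction on the number of boxes. The diagonal coefficient is the
ratio `P(qy)/P(y)`, so `defect / P` takes the same value at all `q ^ k * y`, and by continuity this
is its value `0` at the origin. -/
theorem defect_eq_zero_of_small (h : IsRange q u v r t ζ) (hx : ‖x‖ ≤ t) {δ : ℝ} (hδ0 : 0 < δ)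
    (hδt : δ ≤ t)
    (hδ : ∀ y : ℂ, ‖y‖ ≤ δ → IsBounded (lWeight q y u v) (ratio v t ζ) ζ⁻¹ (2 / (1 - δ)))
    (lam μ : YoungDiagram) {y : ℂ} (hy : ‖y‖ ≤ δ) : defect q x u v lam μ y = 0 := by
  induction hn : lam.cells.card using Nat.strong_induction_on generalizing lam y with
  | _ n ih =>
    set P : ℂ → ℂ := fun y => ∏ i ∈ range (lam.colLen 0), qPoch (u i * y) q (colMult lam i) with hP
    have hP0 : ∀ y : ℂ, ‖y‖ ≤ δ → P y ≠ 0 := fun y hy => prod_ne_zero_iff.2 fun i _ =>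
      qPoch_ne_zero (by
        rw [norm_mul]
        exact (mul_le_of_le_one_left (norm_nonneg y) (h.hu i)).trans_lt
          ((hy.trans hδt).trans_lt h.t_lt)) h.hq _
    have hstep : ∀ y : ℂ, ‖y‖ ≤ δ → defect q x u v lam μ (q * y) / P (q * y)
        = defect q x u v lam μ y / P y := by
      intro y hy
      have hrec := defect_mul_q h hx hδt hδ lam μ hy
      rw [sum_eq_single_of_mem lam (self_mem_below lam)] at hrec
      · rw [div_self (h.isPairing.1 lam), one_mul] at hrec
        rw [div_eq_div_iff (hP0 _ ((h.norm_q_mul_le y).trans hy)) (hP0 y hy), hrec, hP]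
        simp only
        rw [← mat_lWeight_self_mul (v := v) (h.one_sub_ne_zero (hy.trans hδt)) lam]
        ring
      · intro η hη hne
        have hlt : η < lam := lt_of_le_of_ne (mem_below.1 hη) hne
        -- The induction hypothesis is used at the same `y`, for strictly smaller partitions.
        rw [ih η.cells.card (hn ▸ card_lt_card (YoungDiagram.cells_ssubset_iff.2 hlt)) η hy rfl,
          mul_zero]
    have hpow : ∀ k : ℕ, ‖q ^ k * y‖ ≤ δ := fun k => by
      rw [norm_mul, norm_pow]
      exact (mul_le_of_le_one_left (norm_nonneg y) (pow_le_one₀ (norm_nonneg q) h.hq.le)).trans hy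
    have hconst : ∀ k : ℕ, defect q x u v lam μ (q ^ k * y) / P (q ^ k * y)
        = defect q x u v lam μ y / P y := by
      intro k
      induction k with
      | zero => simp
      | succ k ihk => rw [← ihk, ← hstep _ (hpow k), pow_succ', mul_assoc]
    have hlim : Tendsto (fun k : ℕ => q ^ k * y) atTop (𝓝 0) := by
      simpa using (tendsto_pow_atTop_nhds_zero_of_norm_lt_one h.hq).mul_const y
    have hcont : ContinuousAt (fun y => defect q x u v lam μ y / P y) 0 := by
      refine ContinuousAt.div ?_ ?_ (hP0 0 (by simpa using hδ0.le))
      · exact ((differentiableOn_defect h hx lam μ).continuousOn).continuousAt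
          (Metric.ball_mem_nhds 0 h.t_pos)
      · have : Continuous P := by
          simp only [hP, qPoch]
          fun_prop
        exact this.continuousAt
    have h1 := hcont.tendsto.comp hlim
    rw [defect_zero h hx, zero_div] at h1
    have h2 : (fun y => defect q x u v lam μ y / P y) ∘ (fun k : ℕ => q ^ k * y)
        = fun _ => defect q x u v lam μ y / P y := funext hconst
    rw [h2] at h1
    have h3 := tendsto_nhds_unique tendsto_const_nhds h1
    exact (div_eq_zero_iff.1 h3).resolve_right (hP0 y hy)

/-- The bounds for the auxiliary row hold only for small `y`; the identity theorem removes this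
restriction. -/
theorem defect_eq_zero (h : IsRange q u v r t ζ) (hx : ‖x‖ ≤ t) (lam μ : YoungDiagram) {y : ℂ}
    (hy : ‖y‖ < t) : defect q x u v lam μ y = 0 := by
  obtain ⟨δ, hδ0, hδt, hδ⟩ := h.exists_isBounded_lWeight
  have han : AnalyticOnNhd ℂ (defect q x u v lam μ) (Metric.ball 0 t) :=
    (differentiableOn_defect h hx lam μ).analyticOnNhd Metric.isOpen_ball
  refine han.eqOn_zero_of_preconnected_of_eventuallyEq_zero (convex_ball 0 t).isPreconnected
    (Metric.mem_ball_self h.t_pos) ?_ (mem_ball_zero_iff.2 hy)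
  filter_upwards [Metric.ball_mem_nhds (0 : ℂ) hδ0] with z hz
  exact defect_eq_zero_of_small h hx hδ0 hδt hδ lam μ (mem_ball_zero_iff.1 hz).le

theorem isDual_tWeight (h : IsRange q u v r t ζ) (hx : ‖x‖ ≤ t) {y : ℂ} (hy : ‖y‖ < t) :
    IsDual (coeff q u v) (mat (tWeight q x v u)) (mat (tWeight q y u v))
      (1 / qPochInf (x * y) q) := by
  intro lam μ
  have hxy : ‖x * y‖ < 1 := by
    rw [norm_mul]
    exact (mul_le_of_le_one_left (norm_nonneg y) (hx.trans h.t_lt.le)).trans_lt (hy.trans h.t_lt)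
  have h0 := qPochInf_ne_zero hxy h.hq
  have hd := defect_eq_zero h hx lam μ hy
  rw [defect, sub_eq_zero] at hd
  have hs := (summable_pairing h.isPairing (h.symm.isAdmissible hx) (h.isAdmissible hy.le)
    lam μ).hasSum
  rwa [← hd, ← mul_assoc, one_div, inv_mul_cancel₀ h0, one_mul]

end defect

end QWhittaker


namespace QWhittaker

open Finset Filter Topology

/-! ### The skew polynomials -/

/-- The skew polynomials as a matrix. -/
noncomputable def skewMat (q : ℂ) (u v : ℕ → ℂ) (n : ℕ) (x : Fin n → ℂ) (κ μ : YoungDiagram) : ℂ :=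
  skewG q u v κ μ n x

theorem skewMat_zero (q : ℂ) (u v : ℕ → ℂ) (x : Fin 0 → ℂ) : skewMat q u v 0 x = idMat := by
  funext κ μ
  rw [skewMat, skewG, idMat]

theorem skewMat_succ {q : ℂ} (hq : ‖q‖ < 1) (u v : ℕ → ℂ) (n : ℕ) (x : Fin (n + 1) → ℂ) :
    skewMat q u v (n + 1) x
      = matMul (mat (tWeight q (x (Fin.last n)) u v)) (skewMat q u v n (Fin.init x)) := by
  funext κ μ
  rw [skewMat, skewG, matMul]
  exact sum_congr rfl fun ν _ => by rw [transfer_eq_mat hq, skewMat]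

variable {q : ℂ} {u v : ℕ → ℂ} {r t ζ : ℝ}

theorem isAdmissible_skewMat (h : IsRange q u v r t ζ) (n : ℕ) (x : Fin n → ℂ)
    (hx : ∀ i, ‖x i‖ < t) : IsAdmissible (ratio v t ζ) (skewMat q u v n x) := by
  induction n with
  | zero =>
    rw [skewMat_zero]
    exact isAdmissible_one
  | succ n ih =>
    rw [skewMat_succ h.hq]
    exact (h.isAdmissible (hx _).le).mul (h.ratio_pos v) (ih _ fun i => hx i.castSucc)

theorem isDual_tWeight_skewMat (h : IsRange q u v r t ζ) {x : ℂ} (hx : ‖x‖ < t) (m : ℕ)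
    (y : Fin m → ℂ) (hy : ∀ j, ‖y j‖ < t) :
    IsDual (coeff q u v) (mat (tWeight q x v u)) (skewMat q u v m y)
      (∏ j, 1 / qPochInf (x * y j) q) := by
  have hA := h.symm.isAdmissible hx.le
  induction m with
  | zero =>
    rw [skewMat_zero, Fin.prod_univ_zero]
    exact (isDual_one h.isPairing.symm hA).symm isAdmissible_one (σ := ratio u t ζ) hA
      (τ := ratio v t ζ)
  | succ m ih =>
    rw [skewMat_succ h.hq, Fin.prod_univ_castSucc, mul_comm]
    exact (isDual_tWeight h hx.le (hy _)).mul h.isPairing hA (h.isAdmissible (hy _).le)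
      (isAdmissible_skewMat h m _ fun j => hy j.castSucc) (ih _ fun j => hy j.castSucc)

/-- Duality is multiplicative in its second argument; symmetry transfers this to the first, so
variables `x` can be added one at a time as well. -/
theorem isDual_skewMat (h : IsRange q u v r t ζ) (n m : ℕ) (x : Fin n → ℂ) (y : Fin m → ℂ)
    (hx : ∀ i, ‖x i‖ < t) (hy : ∀ j, ‖y j‖ < t) :
    IsDual (coeff q u v) (skewMat q v u n x) (skewMat q u v m y)
      (∏ i, ∏ j, 1 / qPochInf (x i * y j) q) := by
  have hB := isAdmissible_skewMat h m y hy
  induction n with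
  | zero =>
    rw [skewMat_zero, Fin.prod_univ_zero]
    exact isDual_one h.isPairing hB
  | succ n ih =>
    have hA₁ := h.symm.isAdmissible (hx (Fin.last n)).le
    have hA₂ := isAdmissible_skewMat h.symm n (Fin.init x) fun i => hx i.castSucc
    rw [skewMat_succ h.hq, Fin.prod_univ_castSucc, mul_comm]
    refine IsDual.symm (τ := ratio v t ζ) hB (hA₁.mul (h.ratio_pos u) hA₂) ?_
    exact ((isDual_tWeight_skewMat h (hx _) m y hy).symm hA₁ hB).mul h.isPairing.symm hB hA₁ hA₂
      ((ih _ fun i => hx i.castSucc).symm hA₂ hB)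

theorem exists_bound {n m : ℕ} (x : Fin n → ℂ) (y : Fin m → ℂ) (hx : ∀ i, ‖x i‖ < 1)
    (hy : ∀ j, ‖y j‖ < 1) : ∃ t : ℝ, 0 < t ∧ t < 1 ∧ (∀ i, ‖x i‖ < t) ∧ ∀ j, ‖y j‖ < t := by
  have h0 : ∀ a : ℝ, a < 1 → ∀ᶠ t in 𝓝[<] (1 : ℝ), a < t := fun a ha =>
    nhdsWithin_le_nhds (eventually_gt_nhds ha)
  obtain ⟨t, ⟨ht, hx', hy'⟩, ht1⟩ := (((h0 0 one_pos).and ((eventually_all.2 fun i => h0 _ (hx i)).and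
    (eventually_all.2 fun j => h0 _ (hy j)))).and self_mem_nhdsWithin).exists
  exact ⟨t, ht, ht1, hx', hy'⟩

theorem below_bot : below ⊥ = {(⊥ : YoungDiagram)} := by
  ext κ
  rw [mem_below, le_bot_iff, mem_singleton]

theorem colLen_bot : (⊥ : YoungDiagram).colLen 0 = 0 := by
  by_contra h
  exact YoungDiagram.notMem_bot _ (YoungDiagram.mem_iff_lt_colLen.2 (Nat.pos_of_ne_zero h))

theorem coeff_bot (q : ℂ) (u v : ℕ → ℂ) : coeff q u v ⊥ = 1 := by
  rw [coeff, colLen_bot, prod_range_zero]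

theorem skewMat_bot (hq : ‖q‖ < 1) (u v : ℕ → ℂ) (n : ℕ) (x : Fin n → ℂ) :
    skewMat q u v n x ⊥ ⊥ = 1 := by
  induction n with
  | zero => rw [skewMat_zero, idMat_self]
  | succ n ih =>
    rw [skewMat_succ hq, matMul, below_bot, sum_singleton, ih, mat, colLen_bot, max_self, row, one_mul]

theorem hasSum_skewG (hq : ‖q‖ < 1) (hu : ∀ i, ‖u i‖ ≤ 1) (hv : ∀ i, ‖v i‖ ≤ 1)
    (huv : ∃ r < (1 : ℝ), ∀ i, ‖u i * v i‖ ≤ r) (n m : ℕ) (x : Fin n → ℂ) (y : Fin m → ℂ)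
    (hx : ∀ i, ‖x i‖ < 1) (hy : ∀ j, ‖y j‖ < 1) (lam mu : YoungDiagram) :
    HasSum
      (fun κ : {κ : YoungDiagram // lam ≤ κ ∧ mu ≤ κ} =>
        cCoeff q u v κ.1.transpose / cCoeff q u v lam.transpose
          * skewG q v u κ.1 lam n x * skewG q u v κ.1 mu m y)
      ((∏ i, ∏ j, 1 / qPochInf (x i * y j) q)
        * ∑ κ ∈ below (lam ⊓ mu), cCoeff q u v mu.transpose / cCoeff q u v κ.transpose
            * skewG q v u mu κ n x * skewG q u v lam κ m y) := by
  obtain ⟨r, hr, huv⟩ := huv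
  obtain ⟨t, ht, ht1, hx', hy'⟩ := exists_bound x y hx hy
  obtain ⟨ζ, h⟩ := exists_isRange hq hu hv hr huv ht ht1
  have hA := isAdmissible_skewMat h.symm n x hx'
  have hB := isAdmissible_skewMat h m y hy'
  have hlam := h.isPairing.1 lam
  have key := (isDual_skewMat h n m x y hx' hy' lam mu).mul_left (coeff q u v lam)⁻¹
  simp only [cCoeff_transpose]
  -- Triangularity of both factors confines the sum to partitions containing `lam` and `mu`.
  have hsupp : Function.support (fun κ => (coeff q u v lam)⁻¹
      * (coeff q u v κ * skewMat q v u n x κ lam * skewMat q u v m y κ mu))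
      ⊆ {κ | lam ≤ κ ∧ mu ≤ κ} := by
    intro κ hκ
    rw [Function.mem_support] at hκ
    constructor
    · by_contra h'
      exact hκ (by rw [hA.lower h']; ring)
    · by_contra h'
      exact hκ (by rw [hB.lower h']; ring)
  rw [← hasSum_subtype_iff_of_support_subset hsupp] at key
  have e1 : ∀ κ : {κ : YoungDiagram // lam ≤ κ ∧ mu ≤ κ}, (coeff q u v lam)⁻¹
      * (coeff q u v κ * skewMat q v u n x κ lam * skewMat q u v m y κ mu)
      = coeff q u v κ.1 / coeff q u v lam * skewG q v u κ.1 lam n x * skewG q u v κ.1 mu m y := by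
    intro κ
    simp only [skewMat]
    ring
  have e2 : (coeff q u v lam)⁻¹ * ((∏ i, ∏ j, 1 / qPochInf (x i * y j) q)
      * ∑ κ ∈ below lam, coeff q u v lam * coeff q u v mu / coeff q u v κ
        * skewMat q v u n x mu κ * skewMat q u v m y lam κ)
      = (∏ i, ∏ j, 1 / qPochInf (x i * y j) q) * ∑ κ ∈ below (lam ⊓ mu),
        coeff q u v mu / coeff q u v κ * skewG q v u mu κ n x * skewG q u v lam κ m y := by
    rw [mul_left_comm, mul_sum, ← sum_subset (below_subset (inf_le_left (a := lam) (b := mu)))]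
    · congr 1
      refine sum_congr rfl fun κ _ => ?_
      simp only [skewMat]
      field_simp
    · intro κ hκ hκ'
      rw [hA.lower fun h' => hκ' (mem_below.2 (le_inf (mem_below.1 hκ) h'))]
      ring
  rw [e2] at key
  rw [← funext e1]
  exact key

theorem hasSum_polyG_mul_polyF (hq : ‖q‖ < 1) (hu : ∀ i, ‖u i‖ ≤ 1) (n m : ℕ) (x : Fin n → ℂ)
    (y : Fin m → ℂ) (hx : ∀ i, ‖x i‖ < 1) (hy : ∀ j, ‖y j‖ < 1) :
    HasSum (fun κ : YoungDiagram => cCoeff q u 0 κ.transpose * polyG q u κ n x * polyF q u κ m y)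
      (∏ i, ∏ j, 1 / qPochInf (x i * y j) q) := by
  obtain ⟨t, ht, ht1, hx', hy'⟩ := exists_bound x y hx hy
  obtain ⟨ζ, h⟩ := exists_isRange (v := 0) hq hu (fun i => by simp) zero_lt_one
    (fun i => by simp) ht ht1
  have key := isDual_skewMat h n m x y hx' hy' ⊥ ⊥
  rw [below_bot, sum_singleton, skewMat_bot hq, skewMat_bot hq, coeff_bot] at key
  simp only [mul_one, div_one] at key
  simpa only [cCoeff_transpose, polyG, polyF, skewMat] using key

end QWhittaker


namespace QWhittaker

open Finset Filter Topology

/-! ### The reproducing kernel in terms of power sums -/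

theorem tendsto_box_prod : Tendsto (fun p : ℕ × ℕ => box p.1 p.2) atTop atTop := by
  refine tendsto_atTop_finset_of_monotone ?_ ?_
  · rintro ⟨M, N⟩ ⟨M', N'⟩ h κ hκ
    rw [mem_box] at hκ ⊢
    exact ⟨hκ.1.trans h.2, fun i => (hκ.2 i).trans h.1⟩
  · intro κ
    obtain ⟨K, hK⟩ := exists_mem_box κ
    exact ⟨(K, K), hK K K le_rfl le_rfl⟩

/-- A sum over partitions of products over the column lengths is a product of sums. -/
theorem tendsto_prod_of_hasSum {θ : ℕ → ℕ → ℂ} (hθ : ∀ i, θ i 0 = 1) {e : ℕ → ℂ}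
    (he : ∀ i, HasSum (θ i) (e i)) {S : ℂ}
    (hS : HasSum (fun κ : YoungDiagram => ∏ i ∈ range (κ.colLen 0), θ i (colMult κ i)) S) :
    Tendsto (fun N => ∏ i ∈ range N, e i) atTop (𝓝 S) := by
  have h1 := hS.comp tendsto_box_prod
  simp only [Function.comp_def, sum_box_prod θ hθ] at h1
  have h2 : ∀ N, Tendsto (fun M => ∏ i ∈ range N, ∑ k ∈ range (M + 1), θ i k) atTop
      (𝓝 (∏ i ∈ range N, e i)) := fun N =>
    tendsto_finsetProd _ fun i _ => ((he i).tendsto_sum_nat.comp (tendsto_add_atTop_nat 1))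
  rw [Metric.tendsto_atTop] at h1 ⊢
  intro ε hε
  obtain ⟨⟨M₀, N₀⟩, h⟩ := h1 (ε / 2) (half_pos hε)
  -- The box sums converge jointly in `M` and `N`. With `N ≥ N₀` fixed, letting `M` tend to infinity
  -- turns each truncated factor into its full sum while preserving the error bound.
  refine ⟨N₀, fun N hN => lt_of_le_of_lt ?_ (half_lt_self hε)⟩
  refine le_of_tendsto ((h2 N).dist tendsto_const_nhds) ?_
  filter_upwards [eventually_ge_atTop M₀] with M hM
  exact (h (M, N) ⟨hM, hN⟩).le

/-- Expand each factor of `∏ exp (a i)`. Convergence over partitions uses `C^(k+1)/(k+1)! ≤ exp C`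
for the constants and `(i+1)(k+1) ≥ i + k` for the powers of `R`. -/
theorem hasSum_prod_pow_div_factorial {a : ℕ → ℂ} {C R : ℝ} (hR : 0 ≤ R) (hR1 : R < 1)
    (ha : ∀ i, ‖a i‖ ≤ C * R ^ (i + 1)) :
    HasSum (fun κ : YoungDiagram => ∏ i ∈ range (κ.colLen 0),
      a i ^ colMult κ i / ((colMult κ i).factorial : ℂ)) (Complex.exp (∑' i, a i)) := by
  set θ : ℕ → ℕ → ℂ := fun i k => a i ^ k / (k.factorial : ℂ) with hθdef
  have hC0 : 0 ≤ max C 0 := le_max_right _ _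
  have ha' : ∀ i, ‖a i‖ ≤ max C 0 * R ^ (i + 1) := fun i => (ha i).trans (by
    gcongr
    exact le_max_left _ _)
  have hθ : ∀ i, θ i 0 = 1 := fun i => by simp [hθdef]
  have hsum : Summable fun κ : YoungDiagram => ∏ i ∈ range (κ.colLen 0), θ i (colMult κ i) := by
    refine Summable.of_norm ?_
    simp only [norm_prod]
    refine summable_prod_of_le (θ := fun i k => ‖θ i k‖) (C := Real.exp (max C 0)) (ρ := R)
      (fun i => by simp [hθ]) (fun i k => norm_nonneg _) (Real.exp_pos _).le hR hR1 fun i k => ?_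
    simp only [hθdef, norm_div, norm_pow, Complex.norm_natCast]
    calc ‖a i‖ ^ (k + 1) / ((k + 1).factorial : ℝ)
        ≤ (max C 0 * R ^ (i + 1)) ^ (k + 1) / ((k + 1).factorial : ℝ) := by
          gcongr
          exact ha' i
      _ = max C 0 ^ (k + 1) / ((k + 1).factorial : ℝ) * R ^ (i + k + (1 + i * k)) := by
          rw [mul_pow, ← pow_mul]
          ring_nf
      _ ≤ Real.exp (max C 0) * R ^ (i + k) := by
          exact mul_le_mul (Real.pow_div_factorial_le_exp _ hC0 _)
            (pow_le_pow_of_le_one hR hR1.le (Nat.le_add_right _ _)) (pow_nonneg hR _)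
            (Real.exp_pos _).le
      _ = _ := by rw [pow_add]; ring
  have hasum : Summable a := by
    refine Summable.of_norm_bounded (g := fun i => C * R * R ^ i)
      ((summable_geometric_of_lt_one hR hR1).mul_left _) fun i => (ha i).trans (le_of_eq ?_)
    ring
  have hexp : ∀ i, HasSum (θ i) (Complex.exp (a i)) := fun i => by
    rw [Complex.exp_eq_exp_ℂ]
    exact NormedSpace.expSeries_div_hasSum_exp (a i)
  have h1 := tendsto_prod_of_hasSum hθ hexp hsum.hasSum
  simp only [← Complex.exp_sum] at h1
  have h2 : Tendsto (fun N => Complex.exp (∑ i ∈ range N, a i)) atTop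
      (𝓝 (Complex.exp (∑' i, a i))) :=
    (Complex.continuous_exp.tendsto _).comp hasum.hasSum.tendsto_sum_nat
  rw [tendsto_nhds_unique h2 h1]
  exact hsum.hasSum

/-- Expand `-log (1 - z q^j)` for every `j` and interchange the absolutely convergent sums: the
geometric series over `j` produces the denominator `1 - q^(k+1)`. -/
theorem exists_hasSum_exp_eq_inv_qPochInf {q z : ℂ} (hq : ‖q‖ < 1) (hz : ‖z‖ < 1) :
    ∃ l : ℂ, HasSum (fun k : ℕ => z ^ (k + 1) / (((k + 1 : ℕ) : ℂ) * (1 - q ^ (k + 1)))) l ∧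
      Complex.exp l = 1 / qPochInf z q := by
  have hzq : ∀ j : ℕ, ‖z * q ^ j‖ < 1 := fun j => by
    rw [norm_mul, norm_pow]
    exact (mul_le_of_le_one_right (norm_nonneg z) (pow_le_one₀ (norm_nonneg q) hq.le)).trans_lt hz
  set F : ℕ × ℕ → ℂ := fun p => (z * q ^ p.1) ^ (p.2 + 1) / ((p.2 + 1 : ℕ) : ℂ) with hF
  have hsum : Summable F := by
    refine Summable.of_norm_bounded (g := fun p : ℕ × ℕ => ‖q‖ ^ p.1 * ‖z‖ ^ p.2)
      ((summable_geometric_of_lt_one (norm_nonneg q) hq).mul_of_nonneg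
        (summable_geometric_of_lt_one (norm_nonneg z) hz) (fun _ => by positivity)
        fun _ => by positivity) fun ⟨j, k⟩ => ?_
    simp only [hF, norm_div, norm_pow, norm_mul, Complex.norm_natCast]
    calc (‖z‖ * ‖q‖ ^ j) ^ (k + 1) / ((k + 1 : ℕ) : ℝ) ≤ (‖z‖ * ‖q‖ ^ j) ^ (k + 1) :=
          div_le_self (by positivity) (by exact_mod_cast Nat.succ_le_succ (Nat.zero_le k))
      _ = ‖q‖ ^ j * ‖z‖ ^ k * (‖z‖ * (‖q‖ ^ j) ^ k) := by rw [mul_pow]; ring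
      _ ≤ ‖q‖ ^ j * ‖z‖ ^ k * 1 := by
          gcongr
          exact mul_le_one₀ hz.le (by positivity)
            (pow_le_one₀ (by positivity) (pow_le_one₀ (norm_nonneg q) hq.le))
      _ = _ := mul_one _
  have hlog : ∀ j : ℕ, HasSum (fun k => F (j, k)) (-Complex.log (1 - z * q ^ j)) := fun j => by
    have := Complex.hasSum_taylorSeries_neg_log (hzq j)
    rw [← hasSum_nat_add_iff' 1] at this
    simpa [hF] using this
  have hrow := hsum.hasSum.prod_fiberwise hlog
  have hcol : HasSum (fun k : ℕ => z ^ (k + 1) / (((k + 1 : ℕ) : ℂ) * (1 - q ^ (k + 1))))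
      (∑' p, F p) := by
    have hswap : HasSum (fun p : ℕ × ℕ => F p.swap) (∑' p, F p) :=
      (Equiv.prodComm ℕ ℕ).hasSum_iff.2 hsum.hasSum
    refine hswap.prod_fiberwise fun k => ?_
    have hqk : ‖q ^ (k + 1)‖ < 1 := by
      rw [norm_pow]
      exact pow_lt_one₀ (norm_nonneg q) hq (Nat.succ_ne_zero k)
    have hg := (hasSum_geometric_of_norm_lt_one hqk).mul_left (z ^ (k + 1) / ((k + 1 : ℕ) : ℂ))
    have e1 : (fun j : ℕ => z ^ (k + 1) / ((k + 1 : ℕ) : ℂ) * (q ^ (k + 1)) ^ j)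
        = fun j => F (k, j).swap := by
      funext j
      simp only [hF, Prod.swap, mul_pow, ← pow_mul, mul_comm j]
      ring
    rw [e1, ← div_eq_mul_inv, div_div] at hg
    exact hg
  refine ⟨_, hcol, ?_⟩
  have hneg := hrow.neg
  simp only [neg_neg] at hneg
  have hprod := Complex.cexp_tsum_eq_tprod (one_sub_mul_pow_ne_zero hz hq) hneg.summable
  rw [hneg.tsum_eq, Complex.exp_neg] at hprod
  rw [qPochInf, ← hprod, one_div, inv_inv]

theorem prod_map_rowLens {A : Type*} [CommMonoid A] (ρ : YoungDiagram) (F : ℕ → A) :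
    (ρ.rowLens.map F).prod = ∏ i ∈ range (ρ.rowLen 0), F (i + 1) ^ mult ρ (i + 1) := by
  rw [prod_list_map_count, ← prod_image (s := range (ρ.rowLen 0)) (g := fun i => i + 1)
    (f := fun k => F k ^ mult ρ k) (fun i _ j _ h => Nat.succ_injective h)]
  refine prod_subset (fun k hk => ?_) fun k _ hk => ?_
  · rw [List.mem_toFinset] at hk
    have h1 := ρ.pos_of_mem_rowLens k hk
    rw [YoungDiagram.rowLens, List.mem_map] at hk
    obtain ⟨j, -, rfl⟩ := hk
    have h2 := ρ.rowLen_anti 0 j (Nat.zero_le j)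
    exact mem_image.2 ⟨ρ.rowLen j - 1, mem_range.2 (by omega), by omega⟩
  · rw [List.count_eq_zero.2 fun h => hk (List.mem_toFinset.2 h), pow_zero]

/-- Summing the logarithms over all pairs of variables gives the series with terms `p_k(x) p_k(y) /
(k (1 - q^k))`. In the expanded exponential, the exponent of the `k`-th term is the multiplicity of
`k` and its factorial completes the norm of `p_ρ`. -/
theorem hasSum_powerSum {q : ℂ} (hq : ‖q‖ < 1) (n m : ℕ) (x : Fin n → ℂ) (y : Fin m → ℂ) {t : ℝ}
    (ht : 0 < t) (ht1 : t < 1) (hx : ∀ i, ‖x i‖ < t) (hy : ∀ j, ‖y j‖ < t) :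
    HasSum (fun ρ : YoungDiagram => powerSum ρ n x * powerSum ρ m y / qHallNorm q ρ)
      (∏ i, ∏ j, 1 / qPochInf (x i * y j) q) := by
  have hxy : ∀ i j, ‖x i * y j‖ < 1 := fun i j => by
    rw [norm_mul]
    nlinarith [hx i, hy j, norm_nonneg (x i), norm_nonneg (y j)]
  choose l hl hexp using fun i j => exists_hasSum_exp_eq_inv_qPochInf hq (hxy i j)
  set a : ℕ → ℂ := fun k => (∑ i, x i ^ (k + 1)) * (∑ j, y j ^ (k + 1))
    / (((k + 1 : ℕ) : ℂ) * (1 - q ^ (k + 1))) with ha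
  have hasum : HasSum a (∑ i, ∑ j, l i j) := by
    have h1 := hasSum_sum (s := univ) fun i _ => hasSum_sum (s := univ) fun j _ => hl i j
    convert h1 using 2 with k
    rw [ha]
    simp only [sum_mul_sum, sum_div, mul_pow]
  have hbound : ∀ k, ‖a k‖ ≤ (n * m / (1 - ‖q‖)) * t ^ (k + 1) := by
    intro k
    have hp : ∀ (n : ℕ) (x : Fin n → ℂ), (∀ i, ‖x i‖ < t) → ‖∑ i, x i ^ (k + 1)‖ ≤ n * t ^ (k + 1) := by
      intro n x hx
      refine (norm_sum_le _ _).trans ((sum_le_card_nsmul _ _ (t ^ (k + 1)) fun i _ => ?_).trans ?_)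
      · rw [norm_pow]
        exact pow_le_pow_left₀ (norm_nonneg _) (hx i).le _
      · simp
    have hden : 1 - ‖q‖ ≤ ‖((k + 1 : ℕ) : ℂ) * (1 - q ^ (k + 1))‖ := by
      rw [norm_mul, Complex.norm_natCast]
      have h1 : 1 - ‖q‖ ≤ ‖1 - q ^ (k + 1)‖ := by
        have h2 := norm_sub_norm_le (1 : ℂ) (q ^ (k + 1))
        rw [norm_one, norm_pow, pow_succ] at h2
        have h3 : ‖q‖ ^ k * ‖q‖ ≤ ‖q‖ :=
          mul_le_of_le_one_left (norm_nonneg q) (pow_le_one₀ (norm_nonneg q) hq.le)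
        linarith
      refine h1.trans (le_mul_of_one_le_left (norm_nonneg _) ?_)
      exact_mod_cast Nat.succ_le_succ (Nat.zero_le k)
    have hq1 : 0 < 1 - ‖q‖ := by linarith
    rw [ha]
    simp only
    rw [norm_div, norm_mul]
    calc _ ≤ (n * t ^ (k + 1)) * (m * t ^ (k + 1)) / (1 - ‖q‖) :=
          div_le_div₀ (by positivity) (mul_le_mul (hp n x hx) (hp m y hy) (norm_nonneg _)
            (by positivity)) hq1 hden
      _ = n * m / (1 - ‖q‖) * t ^ (k + 1) * t ^ (k + 1) := by ring
      _ ≤ _ := mul_le_of_le_one_right (by positivity) (pow_le_one₀ ht.le ht1.le)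
  have key := hasSum_prod_pow_div_factorial ht.le ht1 hbound
  rw [hasum.tsum_eq, Complex.exp_sum] at key
  simp only [Complex.exp_sum, hexp] at key
  -- The expansion is indexed by column multiplicities, so it is compared with the sum over
  -- conjugate partitions.
  rw [← YoungDiagram.transposeOrderIso.toEquiv.hasSum_iff]
  convert key using 1
  funext κ
  change powerSum κ.transpose n x * powerSum κ.transpose m y / qHallNorm q κ.transpose = _
  rw [powerSum, powerSum, qHallNorm, prod_map_rowLens, prod_map_rowLens, prod_map_rowLens,
    YoungDiagram.rowLen_transpose, ← prod_mul_distrib, ← prod_mul_distrib, ← prod_div_distrib]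
  refine prod_congr rfl fun i _ => ?_
  rw [mult_transpose, ← colMult_apply, ha]
  simp only
  rw [div_pow, mul_pow, mul_pow, div_div]
  congr 1
  ring

end QWhittaker

/-! ### The skew Cauchy identity and the reproducing kernel. -/

theorem mainTheorem1 (q : ℂ) (hq : ‖q‖ < 1) (u v : ℕ → ℂ)
    (hu : ∀ i, ‖u i‖ ≤ 1) (hv : ∀ i, ‖v i‖ ≤ 1) (huv : ∃ r < (1 : ℝ), ∀ i, ‖u i * v i‖ ≤ r)
    (n m : ℕ) (x : Fin n → ℂ) (y : Fin m → ℂ)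
    (hx : ∀ i, ‖x i‖ < 1) (hy : ∀ j, ‖y j‖ < 1) :
    (∀ lam mu : YoungDiagram,
      HasSum
        (fun κ : {κ : YoungDiagram // lam ≤ κ ∧ mu ≤ κ} =>
          QWhittaker.cCoeff q u v κ.1.transpose / QWhittaker.cCoeff q u v lam.transpose
            * QWhittaker.skewG q v u κ.1 lam n x * QWhittaker.skewG q u v κ.1 mu m y)
        ((∏ i, ∏ j, 1 / QWhittaker.qPochInf (x i * y j) q)
          * ∑ κ ∈ QWhittaker.below (lam ⊓ mu),
            QWhittaker.cCoeff q u v mu.transpose / QWhittaker.cCoeff q u v κ.transpose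
              * QWhittaker.skewG q v u mu κ n x * QWhittaker.skewG q u v lam κ m y)) ∧
    HasSum
      (fun κ : YoungDiagram => QWhittaker.cCoeff q u 0 κ.transpose
        * QWhittaker.polyG q u κ n x * QWhittaker.polyF q u κ m y)
      (∏ i, ∏ j, 1 / QWhittaker.qPochInf (x i * y j) q) ∧
    HasSum
      (fun ρ : YoungDiagram => QWhittaker.powerSum ρ n x * QWhittaker.powerSum ρ m y
        / QWhittaker.qHallNorm q ρ)
      (∏ i, ∏ j, 1 / QWhittaker.qPochInf (x i * y j) q) := by
  obtain ⟨t, ht, ht1, hx', hy'⟩ := QWhittaker.exists_bound x y hx hy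
  exact ⟨QWhittaker.hasSum_skewG hq hu hv huv n m x y hx hy,
    QWhittaker.hasSum_polyG_mul_polyF hq hu n m x y hx hy,
    QWhittaker.hasSum_powerSum hq n m x y ht ht1 hx' hy'⟩
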